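/- Let $\epsilon>0$, $\delta\in\mathbb{R}\setminus\{0\}$, $N\in\mathbb{N}$, $a=\left(1+\frac{\epsilon^4}{\delta^2}\right)^{1/2}$, $c=\frac{1-\sqrt{-1}\,\epsilon^2/\delta}{a}$ (so $|c|=1$), and let $p_1,\dots,p_N\in\mathbb{C}$ satisfy $p_i\neq 0$, $ap_i\ne1$, $p_i\neq a$ and $p_ip_j^*\neq 1$ for all $i,j$, where $*$ is complex conjugation. For $b\in\mathbb{C}$ with $|b|=1$, $n,m,r,s\in\mathbb{Z}$ and $z\in\mathbb{R}$ put $$\varphi_i^{(1)}=p_i^{-n}e^{\zeta_i}(1-ap_i)^{-m}(1-bp_i)^{-r},\qquad \varphi_i^{(2)}=-\left(1-\tfrac{a}{p_i}\right)^m\left(1-\tfrac{1}{bp_i}\right)^s,$$ $$\psi_i^{(1)}=(1-ap_i^*)^{-m}\left(1-\tfrac{p_i^*}{b}\right)^{-s},\qquad \psi_i^{(2)}=-(p_i^*)^{-n}e^{\zeta_i^*}\left(1-\tfrac{a}{p_i^*}\right)^m\left(1-\tfrac{b}{p_i^*}\right)^r,$$ $$m^{(1)}_{ij}=-\frac{\varphi_i^{(1)}\psi_j^{(2)}}{p_i-1/p_j^*},\qquad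 m^{(2)}_{ij}=-\frac{\psi_i^{(1)}\varphi_j^{(2)}}{p_i^*-1/p_j},\qquad \zeta_i=\frac12\,\frac{1+bp_i}{1-bp_i}\,z,$$ and, with $M_k=(m^{(k)}_{ij})$, the column vectors $\varphi^{(1)},\psi^{(1)}$ and the row vectors $\varphi^{(2)},\psi^{(2)}$, $$\tau=\begin{vmatrix}M_1&I\\-I&M_2\end{vmatrix},\qquad \sigma=\begin{vmatrix}M_1&I&\varphi^{(1)}\\-I&M_2&0\\0&\varphi^{(2)}&0\end{vmatrix},\qquad \rho=\begin{vmatrix}M_1&I&0\\-I&M_2&\psi^{(1)}\\\psi^{(2)}&0&0\end{vmatrix}.$$ Put $F_n^m=\tau_n^m(0,0;z)$, $G_n^m=\rho_n^m(0,0;z)$, $h_n^m=b^{-n}\sigma_n^m(1,-1;z)$ and $$u_n^m=\frac{(-1)^mc^{-n-2m}}{\epsilon}\frac{G_n^m}{F_n^m},\qquad \Gamma_n^m=\frac{2a}{c+\frac1c}\,\frac{F_{n-1}^{m+1}F_n^m}{F_n^{m+1}F_{n-1}^m}.$$ (1) For every $b$ with $|b|=1$ (in particular for $b=c$ and for $b=c^{-1}$),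 all $F_n^m$ are real and positive, all $\Gamma_n^m$ are real, and $(u,\Gamma)$ solves dNLS: for all $n,m\in\mathbb{Z}$, $$\left(\sqrt{-1}\tfrac{\epsilon^2}{\delta}-1\right)u_n^{m+1}-\left(\sqrt{-1}\tfrac{\epsilon^2}{\delta}+1\right)u_n^m+(u_{n+1}^m+u_{n-1}^{m+1})(1+\epsilon^2|u_n^m|^2)\Gamma_n^m=0,\qquad \frac{\Gamma_{n+1}^m}{\Gamma_n^m}=\frac{1+\epsilon^2|u_n^m|^2}{1+\epsilon^2|u_n^{m+1}|^2}.$$ (2) Let $b=c^{-1}$. Then $$\gamma_n^m=\epsilon\left[\;(-1)^m\frac{h_n^m+(h_n^m)^*}{F_n^m},\;\;\frac{(-1)^m}{\sqrt{-1}}\frac{h_n^m-(h_n^m)^*}{F_n^m},\;\;2\frac{\partial}{\partial z}\log F_n^m-n-2m\right]^{T}$$ lies in $\mathbb{R}^3$, $|\gamma_{n+1}^m-\gamma_n^m|=\epsilon$ for all $n,m$, and $u_n^m$ is the complex discrete curvature of $\gamma_n^m$, as follows. Let $T_n^m=(\gamma_{n+1}^m-\gamma_n^m)/\epsilon$, $B_n^m=\frac{T_{n-1}^m\times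 T_n^m}{|T_{n-1}^m\times T_n^m|}$, $N_n^m=B_n^m\times T_n^m$. There are real $\kappa_n^m\in[0,\pi)$, $\nu_n^m$, $\Lambda_n^m$ such that for all $n,m$ one has $\langle T_{n-1}^m,T_n^m\rangle=\cos\kappa_n^m$ and $u_n^m=\frac1\epsilon\tan\frac{\kappa_n^m}{2}\,e^{\sqrt{-1}\Lambda_n^m}$; if $u_n^m\ne0$, then $\kappa_n^m>0$, $T_{n-1}^m\times T_n^m\neq0$ and $\Phi_n^m=[T_n^m,N_n^m,B_n^m]\in\mathrm{SO}(3)$; and if $u_{n-1}^m\neq0$ and $u_n^m\ne0$, then $-\pi\le\nu_n^m<\pi$, $\langle B_n^m,B_{n-1}^m\rangle=\cos\nu_n^m$, $\langle B_n^m,N_{n-1}^m\rangle=\sin\nu_n^m$ and $\Lambda_n^m-\Lambda_{n-1}^m=-\nu_n^m$. The discrete Frenet–Serret formula $$\Phi_{n+1}^m=\Phi_n^mR_1(-\nu_{n+1}^m)R_3(\kappa_{n+1}^m),\quad R_1(\theta)=\begin{bmatrix}1&0&0\\0&\cos\theta&-\sin\theta\\0&\sin\theta&\cos\theta\end{bmatrix},\quad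 R_3(\theta)=\begin{bmatrix}\cos\theta&-\sin\theta&0\\\sin\theta&\cos\theta&0\\0&0&1\end{bmatrix}$$ holds whenever $u_n^m\ne0$ and $u_{n+1}^m\neq0$, and the deformation equation $$\frac{\gamma_n^{m+1}-\gamma_n^m}{\delta}=\frac{2}{\epsilon^3}\left(P_n^mT_n^m+Q_n^mN_n^m+R_n^mB_n^m\right),\qquad P_n^m=\delta\left(-1+\frac{\Gamma_n^m}{\cos^2\frac{\kappa_n^m}{2}}\right),$$ $$Q_n^m=\delta\left[\tan\tfrac{\kappa_n^m}{2}-\tan\tfrac{\kappa_{n-1}^{m+1}}{2}\cos(\Lambda_{n-1}^{m+1}-\Lambda_n^m)\frac{\Gamma_n^m}{\cos^2\frac{\kappa_n^m}{2}}\right],$$ $$R_n^m=\epsilon^2\tan\tfrac{\kappa_n^m}{2}-\delta\tan\tfrac{\kappa_{n-1}^{m+1}}{2}\sin(\Lambda_{n-1}^{m+1}-\Lambda_n^m)\frac{\Gamma_n^m}{\cos^2\frac{\kappa_n^m}{2}}$$ holds whenever $u_n^m\neq0$. (If no $u_n^m$ vanishes, all of this holds for all $n,m$ with $0<\kappa_n^m<\pi$.)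 -/

import Mathlib

open scoped ComplexConjugate

noncomputable section

namespace DNLS

/-! ### Determinants -/

/-- The `2N × 2N` block matrix with diagonal blocks `M₁`, `M₂` and off-diagonal blocks `1`, `-1`. -/
def tauMatrix {N : ℕ} (M₁ M₂ : Matrix (Fin N) (Fin N) ℂ) :
    Matrix (Fin N ⊕ Fin N) (Fin N ⊕ Fin N) ℂ :=
  Matrix.fromBlocks M₁ 1 (-1) M₂

/-- The determinant of the `tauMatrix` bordered by a last column `x`, a last row `y` and the
corner entry `0`. -/
def borderedDet {N : ℕ} (M₁ M₂ : Matrix (Fin N) (Fin N) ℂ) (x y : Fin N ⊕ Fin N → ℂ) : ℂ :=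
  (Matrix.fromBlocks (tauMatrix M₁ M₂) (Matrix.replicateCol Unit x)
    (Matrix.replicateRow Unit y) 0).det

/-- The parameters of the entries of the determinants: a real number `a`, a complex number `b`
(of modulus one in the theorem) and complex numbers `p₁, …, p_N`. -/
structure Params (N : ℕ) where
  a : ℝ
  b : ℂ
  p : Fin N → ℂ

namespace Params

variable {N : ℕ} (P : Params N)

/-- `exp ζᵢ = exp ((1/2) (1 + b pᵢ) / (1 - b pᵢ) z)`. -/
def expZeta (z : ℝ) (i : Fin N) : ℂ :=
  Complex.exp (1 / 2 * ((1 + P.b * P.p i) / (1 - P.b * P.p i)) * (z : ℂ))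

def phi1 (n m r : ℤ) (z : ℝ) (i : Fin N) : ℂ :=
  P.p i ^ (-n) * P.expZeta z i * (1 - P.a * P.p i) ^ (-m) * (1 - P.b * P.p i) ^ (-r)

def phi2 (m s : ℤ) (i : Fin N) : ℂ :=
  -((1 - P.a / P.p i) ^ m * (1 - 1 / (P.b * P.p i)) ^ s)

def psi1 (m s : ℤ) (i : Fin N) : ℂ :=
  (1 - P.a * conj (P.p i)) ^ (-m) * (1 - conj (P.p i) / P.b) ^ (-s)

def psi2 (n m r : ℤ) (z : ℝ) (i : Fin N) : ℂ :=
  -(conj (P.p i) ^ (-n) * conj (P.expZeta z i) * (1 - P.a / conj (P.p i)) ^ m *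
    (1 - P.b / conj (P.p i)) ^ r)

def m1 (n m r : ℤ) (z : ℝ) : Matrix (Fin N) (Fin N) ℂ :=
  Matrix.of fun i j =>
    -(P.phi1 n m r z i * P.psi2 n m r z j) / (P.p i - 1 / conj (P.p j))

def m2 (m s : ℤ) : Matrix (Fin N) (Fin N) ℂ :=
  Matrix.of fun i j =>
    -(P.psi1 m s i * P.phi2 m s j) / (conj (P.p i) - 1 / P.p j)

/-- `τ_n^m(r, s; z)` -/
def tau (n m r s : ℤ) (z : ℝ) : ℂ :=
  (tauMatrix (P.m1 n m r z) (P.m2 m s)).det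

/-- `σ_n^m(r, s; z)` -/
def sigma (n m r s : ℤ) (z : ℝ) : ℂ :=
  borderedDet (P.m1 n m r z) (P.m2 m s)
    (Sum.elim (P.phi1 n m r z) 0) (Sum.elim 0 (P.phi2 m s))

/-- `ρ_n^m(r, s; z)` -/
def rho (n m r s : ℤ) (z : ℝ) : ℂ :=
  borderedDet (P.m1 n m r z) (P.m2 m s)
    (Sum.elim 0 (P.psi1 m s)) (Sum.elim (P.psi2 n m r z) 0)

def F (n m : ℤ) (z : ℝ) : ℂ := P.tau n m 0 0 z

def G (n m : ℤ) (z : ℝ) : ℂ := P.rho n m 0 0 z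

def h (n m : ℤ) (z : ℝ) : ℂ := P.b ^ (-n) * P.sigma n m 1 (-1) z

/-- `u_n^m = ((-1)^m c^(-n-2m) / ε) G_n^m / F_n^m` -/
def u (ε : ℝ) (c : ℂ) (z : ℝ) (n m : ℤ) : ℂ :=
  (-1) ^ m * c ^ (-n - 2 * m) / ε * (P.G n m z / P.F n m z)

/-- `Γ_n^m = (2a / (c + 1/c)) F_{n-1}^{m+1} F_n^m / (F_n^{m+1} F_{n-1}^m)` -/
def Gam (c : ℂ) (z : ℝ) (n m : ℤ) : ℂ :=
  2 * P.a / (c + 1 / c) *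
    ((P.F (n - 1) (m + 1) z * P.F n m z) / (P.F n (m + 1) z * P.F (n - 1) m z))

/-- The coordinates of the curve `γ_n^m`, as complex numbers. -/
def curve (ε : ℝ) (z : ℝ) (n m : ℤ) : Fin 3 → ℂ :=
  ![ε * ((-1) ^ m * ((P.h n m z + conj (P.h n m z)) / P.F n m z)),
    ε * ((-1) ^ m / Complex.I * ((P.h n m z - conj (P.h n m z)) / P.F n m z)),
    ε * (2 * deriv (fun w : ℝ => Complex.log (P.F n m w)) z - n - 2 * m)]

end Params

/-! ### The discrete nonlinear Schrödinger equation -/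

/-- The pair `(u, Γ)` solves dNLS with lattice intervals `ε`, `δ`. -/
def IsSolution (ε δ : ℝ) (u : ℤ → ℤ → ℂ) (Γ : ℤ → ℤ → ℝ) : Prop :=
  ∀ n m : ℤ,
    (Complex.I * (ε ^ 2 / δ) - 1) * u n (m + 1) - (Complex.I * (ε ^ 2 / δ) + 1) * u n m +
        (u (n + 1) m + u (n - 1) (m + 1)) * (1 + (ε : ℂ) ^ 2 * (‖u n m‖ : ℂ) ^ 2) * (Γ n m : ℂ)
      = 0 ∧
    Γ (n + 1) m / Γ n m = (1 + ε ^ 2 * ‖u n m‖ ^ 2) / (1 + ε ^ 2 * ‖u n (m + 1)‖ ^ 2)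

/-! ### Discrete space curves -/

abbrev E3 := EuclideanSpace ℝ (Fin 3)

def cross (v w : E3) : E3 := WithLp.toLp 2 (crossProduct v.ofLp w.ofLp)

def tangent (ε : ℝ) (γ : ℤ → E3) (n : ℤ) : E3 := (1 / ε) • (γ (n + 1) - γ n)

def binormal (ε : ℝ) (γ : ℤ → E3) (n : ℤ) : E3 :=
  (1 / ‖cross (tangent ε γ (n - 1)) (tangent ε γ n)‖) •
    cross (tangent ε γ (n - 1)) (tangent ε γ n)

def normal (ε : ℝ) (γ : ℤ → E3) (n : ℤ) : E3 := cross (binormal ε γ n) (tangent ε γ n)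

/-- The discrete Frenet frame `Φ_n = [T_n, N_n, B_n]`, the matrix with these columns. -/
def frame (ε : ℝ) (γ : ℤ → E3) (n : ℤ) : Matrix (Fin 3) (Fin 3) ℝ :=
  Matrix.of fun i j => ![tangent ε γ n, normal ε γ n, binormal ε γ n] j i

def R1 (θ : ℝ) : Matrix (Fin 3) (Fin 3) ℝ :=
  !![1, 0, 0; 0, Real.cos θ, -Real.sin θ; 0, Real.sin θ, Real.cos θ]

def R3 (θ : ℝ) : Matrix (Fin 3) (Fin 3) ℝ :=
  !![Real.cos θ, -Real.sin θ, 0; Real.sin θ, Real.cos θ, 0; 0, 0, 1]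

/-- `γ` is a discrete space curve with edge length `ε` and complex discrete curvature `u`, and `κ`,
`ν`, `Λ` are its curvature angles, its torsion angles and the argument of `u`.
The frame exists at the vertices `n` with `u n ≠ 0`; where `u n = 0`, the adjacent edges are
parallel, `κ n = 0` and `Λ n` is of no significance. If `u` has no zero, then this
is the usual definition, with `0 < κ n < π` for all `n`. -/
structure HasComplexCurvature (ε : ℝ) (γ : ℤ → E3) (u : ℤ → ℂ) (κ ν Λ : ℤ → ℝ) : Prop where
  edge : ∀ n, ‖γ (n + 1) - γ n‖ = ε
  kappa_mem : ∀ n, 0 ≤ κ n ∧ κ n < Real.pi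
  cos_kappa : ∀ n, inner ℝ (tangent ε γ (n - 1)) (tangent ε γ n) = Real.cos (κ n)
  kappa_pos : ∀ n, u n ≠ 0 → 0 < κ n
  frame_mem : ∀ n, u n ≠ 0 → cross (tangent ε γ (n - 1)) (tangent ε γ n) ≠ 0 ∧
    frame ε γ n ∈ Matrix.specialOrthogonalGroup (Fin 3) ℝ
  nu_mem : ∀ n, u (n - 1) ≠ 0 → u n ≠ 0 → -Real.pi ≤ ν n ∧ ν n < Real.pi
  cos_nu : ∀ n, u (n - 1) ≠ 0 → u n ≠ 0 →
    inner ℝ (binormal ε γ n) (binormal ε γ (n - 1)) = Real.cos (ν n)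
  sin_nu : ∀ n, u (n - 1) ≠ 0 → u n ≠ 0 →
    inner ℝ (binormal ε γ n) (normal ε γ (n - 1)) = Real.sin (ν n)
  u_eq : ∀ n, u n = 1 / (ε : ℂ) * (Real.tan (κ n / 2) : ℂ) * Complex.exp (Complex.I * Λ n)
  lambda_sub : ∀ n, u (n - 1) ≠ 0 → u n ≠ 0 → Λ n - Λ (n - 1) = -ν n

/-- The discrete Frenet–Serret formula `Φ_{n+1} = Φ_n R₁(-ν_{n+1}) R₃(κ_{n+1})`, at all edges both
of whose ends carry a frame. -/
def FrenetSerret (ε : ℝ) (γ : ℤ → E3) (u : ℤ → ℂ) (κ ν : ℤ → ℝ) : Prop :=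
  ∀ n, u n ≠ 0 → u (n + 1) ≠ 0 →
    frame ε γ (n + 1) = frame ε γ n * (R1 (-ν (n + 1)) * R3 (κ (n + 1)))

/-- The coefficient of `T_n^m` in the deformation. -/
def coeffP (δ : ℝ) (Γ κ : ℤ → ℤ → ℝ) (n m : ℤ) : ℝ :=
  δ * (-1 + Γ n m / Real.cos (κ n m / 2) ^ 2)

/-- The coefficient of `N_n^m` in the deformation. -/
def coeffQ (δ : ℝ) (Γ κ Λ : ℤ → ℤ → ℝ) (n m : ℤ) : ℝ :=
  δ * (Real.tan (κ n m / 2) - Real.tan (κ (n - 1) (m + 1) / 2) *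
    Real.cos (Λ (n - 1) (m + 1) - Λ n m) * (Γ n m / Real.cos (κ n m / 2) ^ 2))

/-- The coefficient of `B_n^m` in the deformation. -/
def coeffR (ε δ : ℝ) (Γ κ Λ : ℤ → ℤ → ℝ) (n m : ℤ) : ℝ :=
  ε ^ 2 * Real.tan (κ n m / 2) - δ * Real.tan (κ (n - 1) (m + 1) / 2) *
    Real.sin (Λ (n - 1) (m + 1) - Λ n m) * (Γ n m / Real.cos (κ n m / 2) ^ 2)

/-- The deformation equation
`(γ_n^{m+1} - γ_n^m) / δ = (2 / ε³) (P_n^m T_n^m + Q_n^m N_n^m + R_n^m B_n^m)`,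
at all `n`, `m` for which the frame exists. -/
def Deformation (ε δ : ℝ) (γ : ℤ → ℤ → E3) (u : ℤ → ℤ → ℂ) (Γ κ Λ : ℤ → ℤ → ℝ) : Prop :=
  ∀ n m : ℤ, u n m ≠ 0 →
    (1 / δ) • (γ n (m + 1) - γ n m) = (2 / ε ^ 3) •
      (coeffP δ Γ κ n m • tangent ε (fun k => γ k m) n +
        coeffQ δ Γ κ Λ n m • normal ε (fun k => γ k m) n +
        coeffR ε δ Γ κ Λ n m • binormal ε (fun k => γ k m) n)

end DNLS

end

/-!
All determinants are built from the Cauchy-like matrix `K_{ij} = 1 / (p_i p_j^* - 1)` and from the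
weights `θ_i = p_i^{1-n} e^{ζ_i} ((1 - a / p_i) / (1 - a p_i))^m`. With `D = diag θ` and `*` for the
conjugation of the entries of a matrix, the determinant `F` is that of `1 + K D^* K^* D`, while
`G / F`, `σ / τ` and `∂_z log F` are sums over the solutions of the system `v + K D^* w = r`,
`w - K^* D v = 0`, with coefficients from `θ` and the parameters (`G_eq`, `sigma_eq`,
`hasDerivAt_F`).

**Positivity.** The solution with right-hand side `r = 1` gives the residues of a Baker–Akhiezer
function `(f, h)(λ)` with `|f|² + |h|²` constant on the unit circle (`IsSol.norm_identity`). For the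
homogeneous system the constant is `0`; then `f` vanishes identically, and so does the solution.
So the determinant, which is real, has no zero, for any weights. Scaling the weights to `0` shows
that it is positive (`solDet_pos`). No condition on the moduli of the `p_i` is needed.

**Shifts.** A step of `n` divides the weights by `p`, and a step of `m` multiplies them by the
Möbius transformation `(p - a) / (1 - a p)`, up to a step of `n`. By the displacement equation
`p K p^* = K + 1`, both change the right-hand side of the system only by multiples of the vectors
`1 / p` and `1 / p^*`, so the new solutions are explicit combinations of the old ones
(`solV_solW_mul`, `solV_solW_mobius`). In particular `1 + |G / F|²` is a ratio of determinants
(`solNorm_mul`), and `G / F` solves the dNLS equation, up to a gauge (`solAmp_dNLS`). The flow in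
`z` conjugates the matrix of the system up to a matrix of rank one, so that `∂_z log F` is a
quadratic expression of the same kind as `σ / τ` (`hasDerivAt_solDet`).

**Geometry.** For `b = 1 / c` the values of `f` and `h` at `λ = c` are, up to phases, a spinor
`(α, β)` on each edge, and the edges of `γ` are its images under the Hopf map (`curveXY_succ_sub`,
`curveZ_succ_sub`). The spinors of adjacent edges are related by
`α_{n-1} = α_n + ε u_n^* β_n`, `β_{n-1} = β_n - ε u_n α_n`. This is a rotation whose angle `κ_n`
satisfies `tan (κ_n / 2) = ε |u_n|` and whose axis is turned by the argument of `u_n`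
(`spin_transition`); hence the complex curvature is `u`, and the Frenet–Serret formula follows. The
shift in `m` expresses the motion of `γ` in the same frame (`curveXY_deform`, `curveZ_deform`).
-/

noncomputable section

open scoped ComplexConjugate

namespace DNLS

/-! ### The linear system with a Cauchy-like matrix -/

section System

variable {ι : Type*}

/-- The Cauchy-like matrix `K_{ij} = 1 / (p_i p_j^* - 1)`; it is Hermitian, and
`p_i K_{ij} p_j^* = K_{ij} + 1`. -/
def cauchy (p : ι → ℂ) (i j : ι) : ℂ := (p i * conj (p j) - 1)⁻¹

lemma conj_cauchy (p : ι → ℂ) (i j : ι) : conj (cauchy p i j) = cauchy p j i := by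
  simp [cauchy, mul_comm]

lemma cauchy_displacement {p : ι → ℂ} (hpp : ∀ i j, p i * conj (p j) ≠ 1) (i j : ι) :
    cauchy p i j * (p i * conj (p j)) = cauchy p i j + 1 := by
  have h := sub_ne_zero.2 (hpp i j)
  unfold cauchy
  field_simp
  ring

variable [Fintype ι]

/-- The linear system `v + K D^* w = r`, `w - K^* D v = s` with `D = diag θ`, where `*` conjugates
the entries of a matrix; `K^*` is the transpose of `K`. -/
structure IsSol (p θ r s v w : ι → ℂ) : Prop where
  fst : ∀ i, v i + ∑ j, cauchy p i j * (conj (θ j) * w j) = r i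
  snd : ∀ i, w i - ∑ j, cauchy p j i * (θ j * v j) = s i

namespace IsSol

variable {p θ r s v w r' s' v' w' : ι → ℂ}

lemma add (h : IsSol p θ r s v w) (h' : IsSol p θ r' s' v' w') :
    IsSol p θ (fun i => r i + r' i) (fun i => s i + s' i)
      (fun i => v i + v' i) (fun i => w i + w' i) where
  fst i := by
    rw [← h.fst, ← h'.fst]
    simp only [mul_add, Finset.sum_add_distrib]
    ring
  snd i := by
    rw [← h.snd, ← h'.snd]
    simp only [mul_add, Finset.sum_add_distrib]
    ring

lemma smul (k : ℂ) (h : IsSol p θ r s v w) :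
    IsSol p θ (fun i => k * r i) (fun i => k * s i) (fun i => k * v i) (fun i => k * w i) where
  fst i := by
    rw [← h.fst, mul_add, Finset.mul_sum]
    congr 1
    exact Finset.sum_congr rfl fun j _ => by ring
  snd i := by
    rw [← h.snd, mul_sub, Finset.mul_sum]
    congr 1
    exact Finset.sum_congr rfl fun j _ => by ring

/-- The quaternionic symmetry of the system. -/
lemma star (h : IsSol p θ r s v w) :
    IsSol p θ (fun i => -conj (s i)) (fun i => conj (r i))
      (fun i => -conj (w i)) (fun i => conj (v i)) where
  fst i := by
    rw [← h.snd]
    simp only [map_sub, map_sum, map_mul, conj_cauchy]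
    ring
  snd i := by
    rw [← h.fst]
    simp only [map_add, map_sum, map_mul, conj_cauchy, Complex.conj_conj, mul_neg,
      Finset.sum_neg_distrib]
    ring

/-- The system is symmetric with respect to the bilinear pairing with weights `θ` and `θ^*`. -/
lemma reciprocity (h : IsSol p θ r s v w) (h' : IsSol p θ r' s' v' w') :
    ∑ i, θ i * r' i * v i + ∑ i, conj (θ i) * s i * w' i
      = ∑ i, θ i * r i * v' i + ∑ i, conj (θ i) * s' i * w i := by
  have key : ∀ v v' w w' r s' : ι → ℂ, (∀ i, v i + ∑ j, cauchy p i j * (conj (θ j) * w j) = r i) →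
      (∀ i, w' i - ∑ j, cauchy p j i * (θ j * v' j) = s' i) →
      ∑ i, θ i * r i * v' i + ∑ i, conj (θ i) * s' i * w i
        = ∑ i, θ i * v i * v' i + ∑ i, conj (θ i) * w i * w' i := by
    intro v v' w w' r s' h1 h2
    have e1 : ∑ i, θ i * r i * v' i = ∑ i, θ i * v i * v' i +
        ∑ i, ∑ j, cauchy p i j * (conj (θ j) * w j) * (θ i * v' i) := by
      rw [← Finset.sum_add_distrib]
      refine Finset.sum_congr rfl fun i _ => ?_
      rw [← h1, ← Finset.sum_mul]
      ring
    have e2 : ∑ i, conj (θ i) * s' i * w i = ∑ i, conj (θ i) * w i * w' i -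
        ∑ i, ∑ j, cauchy p j i * (θ j * v' j) * (conj (θ i) * w i) := by
      rw [← Finset.sum_sub_distrib]
      refine Finset.sum_congr rfl fun i _ => ?_
      rw [← h2, ← Finset.sum_mul]
      ring
    rw [e1, e2, Finset.sum_comm (f := fun i j => cauchy p j i * (θ j * v' j) * (conj (θ i) * w i))]
    have : ∀ i j, cauchy p i j * (conj (θ j) * w j) * (θ i * v' i) =
      cauchy p i j * (θ i * v' i) * (conj (θ j) * w j) := fun i j => by ring
    simp only [this]
    ring
  rw [key v v' w w' r s' h.fst h'.snd, key v' v w' w r' s h'.fst h.snd]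
  congr 1 <;> exact Finset.sum_congr rfl fun i _ => by ring

/-- For `‖λ‖ = 1` put `f = ρ + ∑ θ_j^* w_j / (1 - λ p_j^*)` and
`h = -∑ θ_j^* v_j^* / (1 - λ p_j^*)`. Then `|f|² + |h|²` is independent of `λ`:
the poles of `f f^* + h h^*`, as a rational function of `λ`, cancel. In the statement `λ = 1 / b`
and `e_j = 1 / (1 - b p_j)`, so that `e_j^* = 1 / (1 - λ p_j^*)`. -/
lemma norm_identity (hpp : ∀ i j, p i * conj (p j) ≠ 1) {ρ : ℂ} (hρ : conj ρ = ρ)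
    (h : IsSol p θ (fun _ => ρ) 0 v w) {e : ι → ℂ} {b : ℂ} (hb : b * conj b = 1)
    (he : ∀ i, e i * (1 - b * p i) = 1) :
    (ρ + ∑ i, θ i * e i * conj (w i)) * (ρ + ∑ i, conj (θ i) * conj (e i) * w i) +
      (∑ i, θ i * e i * v i) * (∑ i, conj (θ i) * conj (e i) * conj (v i))
      = ρ * (ρ + ∑ i, θ i * conj (w i)) := by
  -- partial fractions for the products of the simple poles
  have hK : ∀ i j, e i * conj (e j) = cauchy p i j * (1 - e i - conj (e j)) := by
    intro i j
    have h1 := he i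
    have h2 := congrArg conj (he j)
    simp only [map_mul, map_sub, map_one] at h2
    have h3 := sub_ne_zero.2 (hpp i j)
    have h4 : cauchy p i j * (p i * conj (p j) - 1) = 1 := inv_mul_cancel₀ h3
    linear_combination (- e i * conj (e j)) * h4 - cauchy p i j * e i * conj (e j) * p i *
      conj (p j) * hb + cauchy p i j * (1 - conj (e j)) * h1
        - cauchy p i j * (e i * b * p i) * h2
  have hc1 : ∀ i, ∑ j, cauchy p i j * (conj (θ j) * w j) = ρ - v i := fun i => by
    rw [← h.fst i]; ring
  have hc2 : ∀ j, ∑ i, cauchy p i j * (θ i * conj (w i)) = ρ - conj (v j) := fun j => by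
    have := congrArg conj (hc1 j)
    simpa only [map_sub, map_sum, map_mul, conj_cauchy, Complex.conj_conj, hρ] using this
  have hd1 : ∀ j, ∑ i, cauchy p i j * (θ i * v i) = w j := fun i => by
    have := h.snd i
    simp only [Pi.zero_apply] at this
    linear_combination -this
  have hd2 : ∀ i, ∑ j, cauchy p i j * (conj (θ j) * conj (v j)) = conj (w i) := fun j => by
    have := congrArg conj (hd1 j)
    simpa only [map_sub, map_sum, map_mul, conj_cauchy, Complex.conj_conj] using this
  have expand : ∀ X Y A B : ι → ℂ, (∀ i, ∑ j, cauchy p i j * Y j = A i) →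
      (∀ j, ∑ i, cauchy p i j * X i = B j) →
      (∑ i, X i * e i) * (∑ j, Y j * conj (e j)) =
        ∑ i, X i * A i - ∑ i, X i * e i * A i - ∑ j, Y j * conj (e j) * B j := by
    intro X Y A B hA hB
    rw [Finset.sum_mul_sum]
    have : ∀ i j, X i * e i * (Y j * conj (e j)) = (X i - X i * e i) * (cauchy p i j * Y j)
        - (Y j * conj (e j)) * (cauchy p i j * X i) := fun i j => by
      linear_combination X i * Y j * hK i j
    simp only [this, Finset.sum_sub_distrib]
    rw [Finset.sum_comm (f := fun i j => (Y j * conj (e j)) * (cauchy p i j * X i))]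
    simp only [← Finset.mul_sum, hA, hB, sub_mul, Finset.sum_sub_distrib]
  have E1 := expand (fun i => θ i * conj (w i)) (fun i => conj (θ i) * w i) _ _ hc1 hc2
  have E2 := expand (fun i => θ i * v i) (fun i => conj (θ i) * conj (v i)) _ _ hd2 hd1
  simp only [mul_sub, Finset.sum_sub_distrib, ← Finset.sum_mul] at E1 E2
  have r1 : ∀ x y z : ι → ℂ, ∑ i, x i * y i * z i = ∑ i, x i * z i * y i := fun x y z =>
    Finset.sum_congr rfl fun i _ => by ring
  have r2 : ∀ x y z t: ι → ℂ, ∑ i, x i * y i * z i * t i = ∑ i, x i * t i * z i * y i :=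
    fun x y z t => Finset.sum_congr rfl fun i _ => by ring
  rw [r1 θ e, r1 _ (fun i => conj (e i)), r1 θ e, r1 _ (fun i => conj (e i))]
  rw [r2 _ v _ (fun i => conj (w i)), r1 _ v (fun i => conj (w i)),
    r2 _ _ _ w] at E2
  linear_combination E1 + E2

end IsSol

/-- A combination of the functions `1 / (1 - t q_j)` which vanishes on the unit circle vanishes
wherever it is defined. -/
lemma sum_div_eq_zero_of_circle {c q : ι → ℂ} (hq : ∀ j, ‖q j‖ ≠ 1)
    (h : ∀ t : ℂ, ‖t‖ = 1 → ∑ j, c j / (1 - t * q j) = 0) {t : ℂ} (ht : ∀ j, t * q j ≠ 1) :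
    ∑ j, c j / (1 - t * q j) = 0 := by
  classical
  open Polynomial in
  let P : ℂ[X] := ∑ j, C (c j) * ∏ k ∈ Finset.univ.erase j, (1 - X * C (q k))
  have hP : ∀ t : ℂ, (∀ j, t * q j ≠ 1) →
      P.eval t = (∏ k, (1 - t * q k)) * ∑ j, c j / (1 - t * q j) := by
    intro t ht
    simp only [P, Polynomial.eval_finsetSum, Polynomial.eval_mul, Polynomial.eval_C,
      Polynomial.eval_prod, Polynomial.eval_sub, Polynomial.eval_one, Polynomial.eval_X,
      Finset.mul_sum]
    refine Finset.sum_congr rfl fun j _ => ?_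
    have h1 : 1 - t * q j ≠ 0 := sub_ne_zero.2 (ht j).symm
    rw [← Finset.mul_prod_erase Finset.univ (fun k => 1 - t * q k) (Finset.mem_univ j)]
    field_simp
  have hcirc : ∀ t : ℂ, ‖t‖ = 1 → ∀ j, t * q j ≠ 1 := by
    intro t h1 j h2
    apply hq j
    have := congrArg norm h2
    simpa [h1] using this
  have hP0 : P = 0 := by
    refine Polynomial.eq_zero_of_infinite_isRoot P
      (Set.Infinite.mono (s := Metric.sphere 0 1) ?_ ?_)
    · intro t h1
      have h1 : ‖t‖ = 1 := by simpa using h1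
      show P.eval t = 0
      rw [hP t (hcirc t h1), h t h1, mul_zero]
    · refine Set.infinite_of_injective_forall_mem (f := fun n : ℕ =>
        Complex.exp ((1 / (n + 1 : ℝ) : ℝ) * Complex.I)) ?_ ?_
      · intro m n hmn
        have h0 : ∀ n : ℕ, 0 < 1 / (n + 1 : ℝ) ∧ 1 / (n + 1 : ℝ) ≤ 1 := fun n =>
          ⟨by positivity, by rw [div_le_one (by positivity)]; linarith [n.cast_nonneg (α := ℝ)]⟩
        have hpi := Real.pi_gt_three
        have := congrArg Complex.arg hmn
        simp only [] at this
        rw [Complex.arg_exp_mul_I, Complex.arg_exp_mul_I] at this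
        rw [(toIocMod_eq_self Real.two_pi_pos).2 ⟨by linarith [h0 m], by linarith [h0 m]⟩,
          (toIocMod_eq_self Real.two_pi_pos).2 ⟨by linarith [h0 n], by linarith [h0 n]⟩] at this
        rw [one_div, one_div, inv_inj] at this
        exact_mod_cast add_right_cancel this
      · intro n
        simp only [mem_sphere_zero_iff_norm]
        exact Complex.norm_exp_ofReal_mul_I _
  have h1 := hP t ht
  rw [hP0, Polynomial.eval_zero] at h1
  exact (mul_eq_zero.1 h1.symm).resolve_left
    (Finset.prod_ne_zero_iff.2 fun j _ => sub_ne_zero.2 (ht j).symm)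

end System

/-! ### The determinant of the system -/

section Determinant

variable {ι : Type*} [Fintype ι] {p θ r s v w r' s' v' w' : ι → ℂ}

/-- The system is nonsingular for all weights: for a solution of the homogeneous system the
constant of `IsSol.norm_identity` is `0`, so `f` vanishes on the unit circle and hence at the
points `λ = p_i`, where its values are the `v_i`. -/
lemma IsSol.eq_zero (hpp : ∀ i j, p i * conj (p j) ≠ 1) (h : IsSol p θ 0 0 v w) :
    v = 0 ∧ w = 0 := by
  have hq : ∀ j, ‖conj (p j)‖ ≠ 1 := by
    intro j h1
    apply hpp j j
    rw [Complex.mul_conj']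
    rw [RCLike.norm_conj] at h1
    simp [h1]
  have circ : ∀ t : ℂ, ‖t‖ = 1 → ∑ j, (conj (θ j) * w j) / (1 - t * conj (p j)) = 0 := by
    intro t ht
    have hne : ∀ j, 1 - conj t * p j ≠ 0 := by
      intro j h1
      apply hq j
      have := congrArg norm (sub_eq_zero.1 h1)
      rw [norm_mul, RCLike.norm_conj, ht, one_mul, norm_one] at this
      rw [RCLike.norm_conj, ← this]
    have hb : conj t * conj (conj t) = 1 := by
      rw [Complex.mul_conj', RCLike.norm_conj, ht]; norm_num
    have := h.norm_identity hpp (ρ := 0) (map_zero _) (e := fun i => (1 - conj t * p i)⁻¹) hb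
      (fun i => inv_mul_cancel₀ (hne i))
    simp only [zero_add, zero_mul] at this
    have e1 : ∑ i, θ i * (1 - conj t * p i)⁻¹ * conj (w i) =
        conj (∑ i, conj (θ i) * conj ((1 - conj t * p i)⁻¹) * w i) := by simp
    have e2 : ∑ i, conj (θ i) * conj ((1 - conj t * p i)⁻¹) * conj (v i) =
        conj (∑ i, θ i * (1 - conj t * p i)⁻¹ * v i) := by simp
    rw [e1, e2, Complex.conj_mul', Complex.mul_conj'] at this
    norm_cast at this
    have h3 : ‖∑ i, conj (θ i) * conj ((1 - conj t * p i)⁻¹) * w i‖ = 0 := by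
      nlinarith [norm_nonneg (∑ i, conj (θ i) * conj ((1 - conj t * p i)⁻¹) * w i),
        sq_nonneg ‖∑ i, θ i * (1 - conj t * p i)⁻¹ * v i‖]
    rw [norm_eq_zero] at h3
    rw [← h3]
    refine Finset.sum_congr rfl fun j _ => ?_
    simp only [map_inv₀, map_sub, map_one, map_mul, Complex.conj_conj]
    ring
  have hv : v = 0 := by
    funext i
    have h1 := sum_div_eq_zero_of_circle hq circ (t := p i) (hpp i)
    have h2 := h.fst i
    have h3 : ∑ j, cauchy p i j * (conj (θ j) * w j) =
        -∑ j, (conj (θ j) * w j) / (1 - p i * conj (p j)) := by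
      rw [← Finset.sum_neg_distrib]
      refine Finset.sum_congr rfl fun j _ => ?_
      rw [cauchy, ← neg_sub, inv_neg]
      ring
    rw [h3, h1] at h2
    simpa using h2
  refine ⟨hv, ?_⟩
  funext i
  have := h.snd i
  simpa [hv] using this

lemma IsSol.unique (hpp : ∀ i j, p i * conj (p j) ≠ 1) (h : IsSol p θ r s v w)
    (h' : IsSol p θ r s v' w') : v = v' ∧ w = w' := by
  have h0 : IsSol p θ 0 0 (fun i => v i + -1 * v' i) (fun i => w i + -1 * w' i) := by
    have := h.add (h'.smul (-1))
    simp only [neg_one_mul, add_neg_cancel] at this ⊢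
    exact this
  have := h0.eq_zero hpp
  constructor
  · funext i
    have := congrFun this.1 i
    simp only [Pi.zero_apply] at this
    linear_combination this
  · funext i
    have := congrFun this.2 i
    simp only [Pi.zero_apply] at this
    linear_combination this

variable [DecidableEq ι]

open Matrix

/-- The matrix `1 + K D^* K^* D` of the system `IsSol` after elimination of `w`. -/
def sysMat (p θ : ι → ℂ) : Matrix ι ι ℂ :=
  1 + Matrix.of (cauchy p) * diagonal (fun i => conj (θ i)) *
    ((Matrix.of (cauchy p))ᵀ * diagonal θ)

/-- The determinant of `1 + K D^* K^* D`, the `τ`-function as a function of the weights `θ`. -/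
def solDet (p θ : ι → ℂ) : ℂ := (sysMat p θ).det

/-- The `v`-component of the solution of the system with right-hand side `(r, 0)`. -/
def solV (p θ r : ι → ℂ) : ι → ℂ := (sysMat p θ)⁻¹ *ᵥ r

/-- The `w`-component of the solution of the system with right-hand side `(r, 0)`. -/
def solW (p θ r : ι → ℂ) (i : ι) : ℂ := ∑ j, cauchy p j i * (θ j * solV p θ r j)

lemma sysMat_mulVec (p θ v : ι → ℂ) (i : ι) : (sysMat p θ *ᵥ v) i =
    v i + ∑ j, cauchy p i j * (conj (θ j) * ∑ k, cauchy p k j * (θ k * v k)) := by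
  have h1 : ((Matrix.of (cauchy p))ᵀ * diagonal θ) *ᵥ v =
      fun j => ∑ k, cauchy p k j * (θ k * v k) := by
    funext j
    simp [mulVec, dotProduct, mul_diagonal, mul_assoc]
  rw [sysMat, add_mulVec, one_mulVec, ← mulVec_mulVec, h1]
  simp [mulVec, dotProduct, mul_diagonal, mul_assoc]

lemma isSol_of_sysMat_mulVec (h : sysMat p θ *ᵥ v = r) :
    IsSol p θ r 0 v (fun i => ∑ j, cauchy p j i * (θ j * v j)) where
  fst i := by rw [← h, sysMat_mulVec]
  snd i := by simp

lemma IsSol.sysMat_mulVec (h : IsSol p θ r 0 v w) : sysMat p θ *ᵥ v = r := by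
  funext i
  rw [DNLS.sysMat_mulVec, ← h.fst]
  have : ∀ j, ∑ k, cauchy p k j * (θ k * v k) = w j := fun j => by
    have := h.snd j
    simp only [Pi.zero_apply] at this
    linear_combination -this
  simp only [this]

lemma solDet_ne_zero (hpp : ∀ i j, p i * conj (p j) ≠ 1) (θ : ι → ℂ) : solDet p θ ≠ 0 := by
  intro h
  obtain ⟨v, hv, h0⟩ := Matrix.exists_mulVec_eq_zero_iff.2 h
  exact hv ((isSol_of_sysMat_mulVec h0).eq_zero hpp).1

lemma isSol_solV (hpp : ∀ i j, p i * conj (p j) ≠ 1) (θ r : ι → ℂ) :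
    IsSol p θ r 0 (solV p θ r) (solW p θ r) := by
  apply isSol_of_sysMat_mulVec
  rw [solV, mulVec_mulVec, mul_nonsing_inv _ (solDet_ne_zero hpp θ).isUnit, one_mulVec]

/-- By the Weinstein–Aronszajn identity, as conjugation exchanges the two factors
`K D^*` and `K^* D`. -/
lemma conj_solDet (p θ : ι → ℂ) : conj (solDet p θ) = solDet p θ := by
  have h1 : conj (solDet p θ) = (1 + ((Matrix.of (cauchy p))ᵀ * diagonal θ) *
      (Matrix.of (cauchy p) * diagonal (fun i => conj (θ i)))).det := by
    rw [solDet, sysMat, RingHom.map_det]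
    congr 1
    rw [map_add, map_one, map_mul, map_mul, map_mul]
    congr 3
    · ext i j
      simp [conj_cauchy]
    · ext i j
      simp [diagonal_apply, apply_ite conj]
    · ext i j
      simp [conj_cauchy]
    · ext i j
      simp [diagonal_apply, apply_ite conj]
  rw [h1, det_one_add_mul_comm]
  rfl

/-- Positivity follows by scaling `θ` to `0`, as the determinant has no zero. -/
lemma solDet_pos (hpp : ∀ i j, p i * conj (p j) ≠ 1) (θ : ι → ℂ) : 0 < (solDet p θ).re := by
  have him : ∀ θ : ι → ℂ, (solDet p θ).im = 0 :=
    fun θ => Complex.conj_eq_iff_im.1 (conj_solDet p θ)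
  have hre : ∀ θ : ι → ℂ, (solDet p θ).re ≠ 0 := fun θ h =>
    solDet_ne_zero hpp θ (Complex.ext h (him θ))
  by_contra hneg
  have hcont : Continuous fun t : ℝ => (solDet p (fun i => t * θ i)).re := by
    refine Complex.continuous_re.comp (Continuous.matrix_det ?_)
    unfold sysMat
    refine continuous_const.add ((continuous_const.matrix_mul ?_).matrix_mul
      (continuous_const.matrix_mul ?_))
    · refine Continuous.matrix_diagonal (continuous_pi fun i => ?_)
      fun_prop
    · refine Continuous.matrix_diagonal (continuous_pi fun i => ?_)
      fun_prop
  have h0 : (solDet p (fun i => ((0 : ℝ) : ℂ) * θ i)).re = 1 := by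
    simp [solDet, sysMat]
  have h1 : (solDet p (fun i => ((1 : ℝ) : ℂ) * θ i)).re ≤ 0 := by
    simpa using hneg
  obtain ⟨t, -, ht⟩ := intermediate_value_Icc' (zero_le_one (α := ℝ)) hcont.continuousOn
    (show (0 : ℝ) ∈ _ from ⟨h1, by simp only [h0]; norm_num⟩)
  exact hre _ ht

/-- Multiplication of the weights by `p` changes the matrix of the system, up to conjugation, by a
matrix of rank one. -/
lemma solDet_mul (hpp : ∀ i j, p i * conj (p j) ≠ 1) (h : IsSol p θ (fun _ => 1) 0 v w) :
    solDet p (fun i => p i * θ i) = solDet p θ * (1 + ∑ i, conj (θ i) * w i) := by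
  have hA := h.sysMat_mulVec
  set K : Matrix ι ι ℂ := Matrix.of (cauchy p) with hK
  set k : ι → ℂ := fun j => ∑ i, conj (θ i) * (cauchy p j i * θ j) with hk
  have e0 : diagonal p * K * diagonal (fun i => conj (p i)) =
      K + replicateCol Unit (fun _ : ι => (1 : ℂ)) * replicateRow Unit (fun _ : ι => (1 : ℂ)) := by
    ext i j
    rw [mul_diagonal, diagonal_mul]
    simp only [hK, of_apply, Matrix.add_apply, Matrix.mul_apply, replicateCol_apply,
      replicateRow_apply, Finset.univ_unique, Finset.sum_singleton, one_mul]
    linear_combination cauchy_displacement hpp i j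
  have e1 : solDet p (fun i => p i * θ i) =
      (1 + (K * diagonal (fun i => conj (p i)) * diagonal (fun i => conj (θ i)) *
        (Kᵀ * diagonal θ)) * diagonal p).det := by
    rw [solDet, sysMat]
    congr 2
    simp only [Matrix.mul_assoc, diagonal_mul_diagonal, map_mul]
    congr 4
    funext i
    ring_nf
  have e2 : 1 + diagonal p * (K * diagonal (fun i => conj (p i)) * diagonal (fun i => conj (θ i)) *
        (Kᵀ * diagonal θ)) = sysMat p θ * (1 + replicateCol Unit v * replicateRow Unit k) := by
    have : diagonal p * (K * diagonal (fun i => conj (p i)) * diagonal (fun i => conj (θ i)) *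
        (Kᵀ * diagonal θ)) = diagonal p * K * diagonal (fun i => conj (p i)) *
          (diagonal (fun i => conj (θ i)) * (Kᵀ * diagonal θ)) := by
      simp only [Matrix.mul_assoc]
    rw [this, e0, add_mul, Matrix.mul_add, Matrix.mul_one, ← Matrix.mul_assoc (sysMat p θ),
      ← replicateCol_mulVec, hA, sysMat, Matrix.mul_assoc K, add_assoc, ← hK]
    congr 2
    rw [Matrix.mul_assoc]
    congr 1
    ext i j
    simp [hk, Matrix.mul_apply, diagonal_apply, hK]
  rw [e1, det_one_add_mul_comm, e2, det_mul, det_one_add_replicateCol_mul_replicateRow, solDet]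
  congr 2
  have hw : ∀ j, w j = ∑ k, cauchy p k j * (θ k * v k) := fun j => by
    have := h.snd j
    simp only [Pi.zero_apply] at this
    linear_combination this
  simp only [dotProduct, hk, hw, Finset.mul_sum, Finset.sum_mul]
  rw [Finset.sum_comm]
  refine Finset.sum_congr rfl fun i _ => Finset.sum_congr rfl fun j _ => by ring

/-- Jacobi's formula. -/
lemma hasDerivAt_det {A : ℝ → Matrix ι ι ℂ} {A' : Matrix ι ι ℂ} {z : ℝ}
    (h : ∀ i j, HasDerivAt (fun t => A t i j) (A' i j) z) :
    HasDerivAt (fun t => (A t).det) (trace (adjugate (A z) * A')) z := by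
  have h1 : HasDerivAt (fun t => (A t).det) (∑ σ : Equiv.Perm ι, (Equiv.Perm.sign σ : ℂ) *
      ∑ k, (∏ j ∈ Finset.univ.erase k, A z (σ j) j) • A' (σ k) k) z := by
    simp only [det_apply']
    exact HasDerivAt.fun_sum fun σ _ =>
      (HasDerivAt.fun_finsetProd fun k _ => h (σ k) k).const_mul _
  convert h1 using 1
  have h2 : trace (adjugate (A z) * A') = ∑ k, ((A z).updateCol k (fun i => A' i k)).det := by
    refine Finset.sum_congr rfl fun k _ => ?_
    rw [← cramer_apply, cramer_eq_adjugate_mulVec]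
    rfl
  rw [h2]
  simp only [det_apply', Finset.mul_sum]
  rw [Finset.sum_comm]
  refine Finset.sum_congr rfl fun σ _ => Finset.sum_congr rfl fun k _ => ?_
  rw [← Finset.mul_prod_erase Finset.univ _ (Finset.mem_univ k)]
  rw [updateCol_self, smul_eq_mul, mul_comm (A' _ _)]
  congr 2
  refine Finset.prod_congr rfl fun j hj => ?_
  rw [updateCol_ne (Finset.ne_of_mem_erase hj)]

/-- The logarithmic derivative of the determinant along the flow
`θ_i' = (1/2) (1 + b p_i) / (1 - b p_i) θ_i`, which conjugates the matrix of the system up to a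
matrix of rank one. -/
lemma hasDerivAt_solDet (hpp : ∀ i j, p i * conj (p j) ≠ 1) {b : ℂ} (hb : b * conj b = 1)
    {e : ι → ℂ} (he : ∀ i, e i * (1 - b * p i) = 1) {θ : ℝ → ι → ℂ} {z : ℝ}
    (hθ : ∀ i, HasDerivAt (fun t => θ t i) ((e i - 1 / 2) * θ z i) z)
    (h : IsSol p (θ z) e 0 v w) :
    HasDerivAt (fun t => solDet p (θ t))
      (solDet p (θ z) * -∑ i, conj (θ z i) * conj (e i) * w i) z := by
  have hA := h.sysMat_mulVec
  set A := sysMat p (θ z) with hAdef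
  set E : Matrix ι ι ℂ := diagonal fun i => e i - 1 / 2 with hE
  set k : ι → ℂ := fun j => ∑ i, conj (e i) * conj (θ z i) * (cauchy p j i * θ z j) with hk
  have hKe : ∀ i j, cauchy p i j * (conj (e j) - 1 / 2) =
      -((e i - 1 / 2) * cauchy p i j) - e i * conj (e j) := by
    intro i j
    have h1 := he i
    have h2 := congrArg conj (he j)
    simp only [map_mul, map_sub, map_one] at h2
    have h4 : cauchy p i j * (p i * conj (p j) - 1) = 1 :=
      inv_mul_cancel₀ (sub_ne_zero.2 (hpp i j))
    linear_combination (- e i * conj (e j)) * h4 - cauchy p i j * e i * conj (e j) * p i *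
      conj (p j) * hb + cauchy p i j * (1 - conj (e j)) * h1
        - cauchy p i j * (e i * b * p i) * h2
  -- `A' = A E - E A - e kᵀ`: a commutator up to a matrix of rank one
  have hder : ∀ i j, HasDerivAt (fun t => sysMat p (θ t) i j)
      ((A * E - E * A - replicateCol Unit e * replicateRow Unit k) i j) z := by
    intro i j
    have hentry : ∀ t, sysMat p (θ t) i j = (1 : Matrix ι ι ℂ) i j +
        ∑ l, cauchy p i l * conj (θ t l) * (cauchy p j l * θ t j) := by
      intro t
      simp [sysMat, Matrix.mul_apply, diagonal_apply]
    simp only [hentry]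
    have hc : ∀ l, HasDerivAt (fun t => conj (θ t l)) (conj ((e l - 1 / 2) * θ z l)) z :=
      fun l => (hθ l).star
    have h1 : HasDerivAt (fun t => (1 : Matrix ι ι ℂ) i j +
        ∑ l, cauchy p i l * conj (θ t l) * (cauchy p j l * θ t j))
        (∑ l, (cauchy p i l * conj ((e l - 1 / 2) * θ z l) * (cauchy p j l * θ z j) +
          cauchy p i l * conj (θ z l) * (cauchy p j l * ((e j - 1 / 2) * θ z j)))) z :=
      HasDerivAt.const_add _ (HasDerivAt.fun_sum fun l _ =>
        ((hc l).const_mul _).mul ((hθ j).const_mul _))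
    convert h1 using 1
    have h2 : (A * E - E * A) i j = (∑ l, cauchy p i l * conj (θ z l) * (cauchy p j l * θ z j)) *
        (e j - 1 / 2) - (e i - 1 / 2) *
          ∑ l, cauchy p i l * conj (θ z l) * (cauchy p j l * θ z j) := by
      rw [Matrix.sub_apply, hE, mul_diagonal, diagonal_mul, hAdef, hentry]
      by_cases hij : i = j
      · subst hij
        ring
      · rw [one_apply_ne hij]
        ring
    rw [Matrix.sub_apply, h2]
    simp only [Matrix.mul_apply, replicateCol_apply, replicateRow_apply, Finset.univ_unique,
      Finset.sum_singleton, hk, Finset.mul_sum, Finset.sum_mul]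
    rw [← Finset.sum_sub_distrib, ← Finset.sum_sub_distrib]
    refine Finset.sum_congr rfl fun l _ => ?_
    simp only [map_mul, map_sub, map_one, map_div₀, Complex.conj_ofNat]
    linear_combination (-conj (θ z l) * cauchy p j l * θ z j) * hKe i l
  have hdet : HasDerivAt (fun t => solDet p (θ t)) _ z := hasDerivAt_det hder
  convert hdet using 1
  have hcol : adjugate A *ᵥ e = A.det • v := by
    rw [← hA, mulVec_mulVec, adjugate_mul, smul_mulVec, one_mulVec]
  rw [← hAdef, Matrix.mul_sub, Matrix.mul_sub, trace_sub, trace_sub, ← Matrix.mul_assoc,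
    ← Matrix.mul_assoc, ← Matrix.mul_assoc, adjugate_mul, trace_mul_comm (adjugate A * E),
    ← Matrix.mul_assoc, mul_adjugate, sub_self, zero_sub, ← replicateCol_mulVec, hcol,
    trace_mul_comm]
  simp only [trace, diag, Matrix.mul_apply, replicateCol_apply, replicateRow_apply,
    Finset.univ_unique, Finset.sum_singleton, hk, Pi.smul_apply, smul_eq_mul]
  have hw : ∀ j, w j = ∑ k, cauchy p k j * (θ z k * v k) := fun j => by
    have := h.snd j
    simp only [Pi.zero_apply] at this
    linear_combination this
  simp only [hw, Finset.mul_sum, Finset.sum_mul, mul_neg, neg_inj, solDet,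
    ← hAdef]
  rw [Finset.sum_comm]
  refine Finset.sum_congr rfl fun i _ => Finset.sum_congr rfl fun j _ => by ring

end Determinant

/-! ### Shifts of the weights -/

section Shift

variable {ι : Type*} {p θ θ' r s v w : ι → ℂ}

lemma conj_e {b : ℂ} {e : ι → ℂ} (he : ∀ i, e i * (1 - b * p i) = 1) (i : ι) :
    conj (e i) * (1 - conj b * conj (p i)) = 1 := by
  simpa using congrArg conj (he i)

variable [Fintype ι]

/-- The displacement `p K p^* = K + 1` turns a solution for the weights `θ` into one for `p θ`, the
right-hand side of which is changed by a multiple of the vector `1 / p^*`. -/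
lemma IsSol.mul (hp0 : ∀ i, p i ≠ 0) (hpp : ∀ i j, p i * conj (p j) ≠ 1)
    (h : IsSol p θ r s v w) :
    IsSol p (p * θ) r (fun i => (s i - ∑ j, θ j * v j) / conj (p i)) v
      (fun i => w i / conj (p i)) := by
  have hq0 : ∀ i, conj (p i) ≠ 0 := fun i => (map_ne_zero _).2 (hp0 i)
  constructor
  · intro i
    rw [← h.fst i]
    congr 1
    refine Finset.sum_congr rfl fun j _ => ?_
    have := hq0 j
    simp only [Pi.mul_apply, map_mul]
    field_simp
  · intro i
    have h1 := hq0 i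
    have h2 : ∑ j, cauchy p j i * ((p * θ) j * v j) =
        (∑ j, cauchy p j i * (θ j * v j) + ∑ j, θ j * v j) / conj (p i) := by
      rw [← Finset.sum_add_distrib, Finset.sum_div]
      refine Finset.sum_congr rfl fun j _ => ?_
      rw [eq_div_iff h1, Pi.mul_apply]
      linear_combination (θ j * v j) * cauchy_displacement hpp j i
    rw [h2, ← h.snd i]
    field_simp
    ring

/-- The displacement turns a solution for the weights `θ' = θ (p - a) / (1 - a p)` into one for
`p θ`, where the right-hand side is changed by multiples of the vectors `1 / p` and `1 / p^*`. -/
lemma IsSol.mobius (hp0 : ∀ i, p i ≠ 0) (hpp : ∀ i j, p i * conj (p j) ≠ 1) {a : ℝ}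
    (hrel : ∀ i, θ' i * (1 - a * p i) = θ i * (p i - a)) (h : IsSol p θ' r 0 v w) :
    IsSol p (p * θ)
      (fun i => (1 - a / p i) * r i - a / p i * ∑ j, conj (θ' j) * w j)
      (fun i => a / conj (p i) * ∑ j, θ' j * v j)
      (fun i => (1 - a / p i) * v i) (fun i => (1 - a / conj (p i)) * w i) := by
  have hq0 : ∀ i, conj (p i) ≠ 0 := fun i => (map_ne_zero _).2 (hp0 i)
  constructor
  · intro i
    have h1 := hp0 i
    have h2 : ∑ j, cauchy p i j * (conj ((p * θ) j) * ((1 - a / conj (p j)) * w j)) =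
        (1 - a / p i) * (∑ j, cauchy p i j * (conj (θ' j) * w j)) -
          a / p i * ∑ j, conj (θ' j) * w j := by
      rw [Finset.mul_sum, Finset.mul_sum, ← Finset.sum_sub_distrib]
      refine Finset.sum_congr rfl fun j _ => ?_
      have h3 := congrArg conj (hrel j)
      simp only [map_mul, map_sub, map_one, Complex.conj_ofReal] at h3
      have h4 := hq0 j
      simp only [Pi.mul_apply, map_mul]
      field_simp
      linear_combination (-cauchy p i j * w j * p i) * h3 -
        (conj (θ' j) * w j * a) * cauchy_displacement hpp i j
    rw [h2, ← h.fst i]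
    ring
  · intro i
    have h1 := hq0 i
    have h2 : ∑ j, cauchy p j i * ((p * θ) j * ((1 - a / p j) * v j)) =
        (1 - a / conj (p i)) * (∑ j, cauchy p j i * (θ' j * v j)) -
          a / conj (p i) * ∑ j, θ' j * v j := by
      rw [Finset.mul_sum, Finset.mul_sum, ← Finset.sum_sub_distrib]
      refine Finset.sum_congr rfl fun j _ => ?_
      have h4 := hp0 j
      simp only [Pi.mul_apply]
      field_simp
      linear_combination (-cauchy p j i * v j * conj (p i)) * hrel j -
        (θ' j * v j * a) * cauchy_displacement hpp j i
    have h3 := h.snd i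
    simp only [Pi.zero_apply] at h3
    rw [h2]
    linear_combination (1 - a / conj (p i)) * h3

variable [DecidableEq ι]

/-- The ratio of the determinants for the weights `p θ` and `θ`. -/
def solNorm (p θ : ι → ℂ) : ℂ := 1 + ∑ i, conj (θ i) * solW p θ 1 i

/-- The Ablowitz–Ladik potential, equal to `G / F` for the determinants `F`, `G`. -/
def solAmp (p θ : ι → ℂ) : ℂ := -∑ i, conj (θ i * solV p θ 1 i / p i)

/-- The value `f(c)`, `c = 1 / b`, of the first component of the Baker–Akhiezer function
`f(λ) = 1 + ∑ θ_j^* w_j / (1 - λ p_j^*)`, in terms of `e_j = 1 / (1 - b p_j)`, `|b| = 1`. -/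
def circF (p e θ : ι → ℂ) : ℂ := 1 + ∑ i, conj (θ i) * conj (e i) * solW p θ 1 i

/-- The value `h(c)`, `c = 1 / b`, of the second component of the Baker–Akhiezer function
`h(λ) = -∑ θ_j^* v_j^* / (1 - λ p_j^*)`, in terms of `e_j = 1 / (1 - b p_j)`, `|b| = 1`. -/
def circH (p e θ : ι → ℂ) : ℂ := -∑ i, conj (θ i) * conj (e i) * conj (solV p θ 1 i)

/-- The quadratic form of the resolvent at `e`, equal to `-h / F` up to a power of `b`. -/
def resS (p e θ : ι → ℂ) : ℂ := ∑ i, θ i * e i * solV p θ e i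

/-- The Hermitian form of the resolvent at `e`, equal to `∂_z log F`. -/
def resZ (p e θ : ι → ℂ) : ℂ := -∑ i, conj (θ i) * conj (e i) * solW p θ e i

lemma solNorm_mul_solDet (hpp : ∀ i j, p i * conj (p j) ≠ 1) (θ : ι → ℂ) :
    solDet p (p * θ) = solDet p θ * solNorm p θ :=
  solDet_mul hpp (isSol_solV hpp θ 1)

lemma solNorm_ne_zero (hpp : ∀ i j, p i * conj (p j) ≠ 1) (θ : ι → ℂ) : solNorm p θ ≠ 0 :=
  right_ne_zero_of_mul (solNorm_mul_solDet hpp θ ▸ solDet_ne_zero hpp (p * θ))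

lemma conj_solNorm (hpp : ∀ i j, p i * conj (p j) ≠ 1) (θ : ι → ℂ) :
    conj (solNorm p θ) = solNorm p θ := by
  have h := congrArg conj (solNorm_mul_solDet hpp θ)
  rw [map_mul, conj_solDet, conj_solDet, solNorm_mul_solDet hpp θ] at h
  exact (mul_left_cancel₀ (solDet_ne_zero hpp θ) h).symm

lemma sum_conj_mul_solW (p θ : ι → ℂ) :
    ∑ i, conj (θ i) * solW p θ 1 i = solNorm p θ - 1 := by
  rw [solNorm]; ring

lemma sum_mul_conj_solW (hpp : ∀ i j, p i * conj (p j) ≠ 1) (θ : ι → ℂ) :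
    ∑ i, θ i * conj (solW p θ 1 i) = solNorm p θ - 1 := by
  rw [← conj_solNorm hpp θ, solNorm]
  simp

/-- The vector `1 / p^*` as a right-hand side for the weights `p θ`. -/
lemma isSol_snd_inv (hp0 : ∀ i, p i ≠ 0) (hpp : ∀ i j, p i * conj (p j) ≠ 1) (θ : ι → ℂ) :
    IsSol p (p * θ) (fun _ => 0) (fun i => solNorm p θ / conj (p i))
      (fun i => -conj (solW p θ 1 i)) (fun i => conj (solV p θ 1 i) / conj (p i)) := by
  have h := (isSol_solV hpp θ 1).star.mul hp0 hpp
  have e : ∀ i, (conj ((1 : ι → ℂ) i) - ∑ j, θ j * -conj (solW p θ 1 j)) / conj (p i) =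
      solNorm p θ / conj (p i) := fun i => by
    simp only [mul_neg, Finset.sum_neg_distrib, sum_mul_conj_solW hpp, Pi.one_apply, map_one]
    ring
  simpa only [e, Pi.zero_apply, map_zero, neg_zero] using h

/-- The vector `1 / p` as a right-hand side for the weights `p θ`. -/
lemma isSol_fst_inv (hp0 : ∀ i, p i ≠ 0) (hpp : ∀ i j, p i * conj (p j) ≠ 1) (θ : ι → ℂ) :
    IsSol p (p * θ) (fun i => solNorm p θ / p i) (fun _ => 0)
      (fun i => solV p θ 1 i / p i) (fun i => solW p θ 1 i) := by
  have h := (isSol_snd_inv hp0 hpp θ).star.smul (-1)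
  simpa only [map_div₀, map_neg, Complex.conj_conj, conj_solNorm hpp, map_zero, neg_one_mul,
    neg_neg, neg_zero] using h

/-- Solutions for the weights `p θ` in terms of solutions for `θ`. -/
lemma solV_solW_mul (hp0 : ∀ i, p i ≠ 0) (hpp : ∀ i j, p i * conj (p j) ≠ 1) (θ r : ι → ℂ) :
    (∀ i, solV p (p * θ) r i =
      solV p θ r i - (∑ j, θ j * solV p θ r j) / solNorm p θ * conj (solW p θ 1 i)) ∧
    ∀ i, solW p (p * θ) r i * conj (p i) =
      solW p θ r i + (∑ j, θ j * solV p θ r j) / solNorm p θ * conj (solV p θ 1 i) := by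
  have hN := solNorm_ne_zero hpp θ
  have h := ((isSol_solV hpp θ r).mul hp0 hpp).add ((isSol_snd_inv hp0 hpp θ).smul
    ((∑ j, θ j * solV p θ r j) / solNorm p θ))
  have e1 : (fun i => r i + (∑ j, θ j * solV p θ r j) / solNorm p θ * 0) = r := by
    funext i; ring
  have e2 : (fun i => ((0 : ι → ℂ) i - ∑ j, θ j * solV p θ r j) / conj (p i) +
      (∑ j, θ j * solV p θ r j) / solNorm p θ * (solNorm p θ / conj (p i))) = 0 := by
    funext i
    simp only [Pi.zero_apply]
    field_simp
    ring
  rw [e1, e2] at h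
  obtain ⟨h1, h2⟩ := (isSol_solV hpp (p * θ) r).unique hpp h
  constructor
  · intro i
    rw [h1]; ring
  · intro i
    have : conj (p i) ≠ 0 := (map_ne_zero _).2 (hp0 i)
    rw [h2]
    field_simp

lemma sum_mul_solV (hp0 : ∀ i, p i ≠ 0) (hpp : ∀ i j, p i * conj (p j) ≠ 1) (θ : ι → ℂ) :
    ∑ j, θ j * solV p θ 1 j = -(solNorm p θ * conj (solAmp p (p * θ))) := by
  have hN := solNorm_ne_zero hpp θ
  set κ := ∑ j, θ j * solV p θ 1 j with hκ
  have h : conj (solAmp p (p * θ)) = -(κ - κ / solNorm p θ * (solNorm p θ - 1)) := by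
    rw [solAmp, map_neg, map_sum, ← sum_mul_conj_solW hpp, hκ, Finset.mul_sum,
      ← Finset.sum_sub_distrib, ← hκ]
    congr 1
    refine Finset.sum_congr rfl fun i _ => ?_
    rw [Complex.conj_conj, (solV_solW_mul hp0 hpp θ 1).1, Pi.mul_apply, ← hκ]
    have := hp0 i
    field_simp
  rw [h]
  field_simp
  ring

lemma solV_mul (hp0 : ∀ i, p i ≠ 0) (hpp : ∀ i j, p i * conj (p j) ≠ 1) (θ : ι → ℂ) (i : ι) :
    solV p (p * θ) 1 i = solV p θ 1 i + conj (solAmp p (p * θ)) * conj (solW p θ 1 i) := by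
  have hN := solNorm_ne_zero hpp θ
  rw [(solV_solW_mul hp0 hpp θ 1).1, sum_mul_solV hp0 hpp]
  field_simp
  ring

lemma solW_mul (hp0 : ∀ i, p i ≠ 0) (hpp : ∀ i j, p i * conj (p j) ≠ 1) (θ : ι → ℂ) (i : ι) :
    solW p (p * θ) 1 i * conj (p i) =
      solW p θ 1 i - conj (solAmp p (p * θ)) * conj (solV p θ 1 i) := by
  have hN := solNorm_ne_zero hpp θ
  rw [(solV_solW_mul hp0 hpp θ 1).2, sum_mul_solV hp0 hpp]
  field_simp
  ring

lemma solNorm_mul (hp0 : ∀ i, p i ≠ 0) (hpp : ∀ i j, p i * conj (p j) ≠ 1) (θ : ι → ℂ) :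
    solNorm p (p * θ) =
      solNorm p θ * (1 + solAmp p (p * θ) * conj (solAmp p (p * θ))) := by
  have h1 : ∑ i, conj ((p * θ) i) * solW p (p * θ) 1 i =
      ∑ i, conj (θ i) * solW p θ 1 i -
        conj (solAmp p (p * θ)) * conj (∑ j, θ j * solV p θ 1 j) := by
    rw [map_sum, Finset.mul_sum, ← Finset.sum_sub_distrib]
    refine Finset.sum_congr rfl fun i _ => ?_
    simp only [Pi.mul_apply, map_mul]
    linear_combination conj (θ i) * solW_mul hp0 hpp θ i
  have h2 : solNorm p (p * θ) = 1 + ∑ i, conj ((p * θ) i) * solW p (p * θ) 1 i := rfl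
  rw [h2, h1, sum_mul_solV hp0 hpp, sum_conj_mul_solW, map_neg, map_mul, Complex.conj_conj,
    conj_solNorm hpp]
  ring

/-! ### Values at a point of the unit circle -/

variable {b : ℂ} {e : ι → ℂ}

lemma circF_norm (hpp : ∀ i j, p i * conj (p j) ≠ 1) (hb : b * conj b = 1)
    (he : ∀ i, e i * (1 - b * p i) = 1) (θ : ι → ℂ) :
    circF p e θ * conj (circF p e θ) + circH p e θ * conj (circH p e θ) = solNorm p θ := by
  have h := (isSol_solV hpp θ 1).norm_identity hpp (ρ := 1) (map_one _) hb he
  rw [sum_mul_conj_solW hpp] at h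
  have h1 : conj (circF p e θ) = 1 + ∑ i, θ i * e i * conj (solW p θ 1 i) := by simp [circF]
  have h2 : conj (circH p e θ) = -∑ i, θ i * e i * solV p θ 1 i := by simp [circH]
  rw [h1, h2, circF, circH]
  linear_combination h

lemma sum_circH (p e θ : ι → ℂ) :
    ∑ i, θ i * e i * solV p θ 1 i = -conj (circH p e θ) := by simp [circH]

lemma sum_conj_circH (p e θ : ι → ℂ) :
    ∑ i, conj (θ i) * conj (e i) * conj (solV p θ 1 i) = -circH p e θ := by simp [circH]

lemma sum_conj_circF (p e θ : ι → ℂ) :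
    ∑ i, conj (θ i) * conj (e i) * solW p θ 1 i = circF p e θ - 1 := by simp [circF]

lemma sum_circF (p e θ : ι → ℂ) :
    ∑ i, θ i * e i * conj (solW p θ 1 i) = conj (circF p e θ) - 1 := by simp [circF]

/-- The pairing of the solutions with right-hand sides `1` and `e`, in two ways. -/
lemma sum_mul_solV_e (hpp : ∀ i j, p i * conj (p j) ≠ 1) (e θ : ι → ℂ) :
    ∑ i, θ i * solV p θ e i = -conj (circH p e θ) := by
  have h := (isSol_solV hpp θ 1).reciprocity (isSol_solV hpp θ e)
  simp only [Pi.zero_apply, mul_zero, zero_mul, Finset.sum_const_zero, add_zero, Pi.one_apply,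
    mul_one] at h
  rw [← h, sum_circH]

lemma sum_conj_mul_solW_e (hpp : ∀ i j, p i * conj (p j) ≠ 1) (e θ : ι → ℂ) :
    ∑ i, conj (θ i) * solW p θ e i = conj (circF p e θ) - 1 := by
  have h := (isSol_solV hpp θ 1).star.reciprocity (isSol_solV hpp θ e)
  simp only [Pi.zero_apply, mul_zero, zero_mul, Finset.sum_const_zero, add_zero, Pi.one_apply,
    mul_one, map_zero, neg_zero, map_one, mul_neg, Finset.sum_neg_distrib] at h
  rw [sum_circF] at h
  linear_combination h

end Shift

section Shift

variable {ι : Type*} [Fintype ι] [DecidableEq ι] {p θ θ' : ι → ℂ} {b : ℂ} {e : ι → ℂ}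

lemma circF_mul (hp0 : ∀ i, p i ≠ 0) (hpp : ∀ i j, p i * conj (p j) ≠ 1) (e θ : ι → ℂ) :
    circF p e (p * θ) = circF p e θ + conj (solAmp p (p * θ)) * circH p e θ := by
  have h : ∑ i, conj ((p * θ) i) * conj (e i) * solW p (p * θ) 1 i =
      ∑ i, conj (θ i) * conj (e i) * solW p θ 1 i - conj (solAmp p (p * θ)) *
        ∑ i, conj (θ i) * conj (e i) * conj (solV p θ 1 i) := by
    rw [Finset.mul_sum, ← Finset.sum_sub_distrib]
    refine Finset.sum_congr rfl fun i _ => ?_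
    simp only [Pi.mul_apply, map_mul]
    linear_combination conj (θ i) * conj (e i) * solW_mul hp0 hpp θ i
  rw [circF, h, sum_conj_circF, sum_conj_circH]
  ring

lemma circH_mul (hp0 : ∀ i, p i ≠ 0) (hpp : ∀ i j, p i * conj (p j) ≠ 1)
    (hb : b * conj b = 1) (he : ∀ i, e i * (1 - b * p i) = 1) (θ : ι → ℂ) :
    circH p e (p * θ) = b * (circH p e θ - solAmp p (p * θ) * circF p e θ) := by
  have h : ∑ i, conj ((p * θ) i) * conj (e i) * conj (solV p (p * θ) 1 i) =
      b * (∑ i, conj (θ i) * conj (e i) * conj (solV p θ 1 i) + solAmp p (p * θ) *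
        ∑ i, conj (θ i) * conj (e i) * solW p θ 1 i - conj (∑ i, θ i * solV p θ 1 i)
        - solAmp p (p * θ) * ∑ i, conj (θ i) * solW p θ 1 i) := by
    rw [map_sum, Finset.mul_sum, Finset.mul_sum, ← Finset.sum_add_distrib,
      ← Finset.sum_sub_distrib, ← Finset.sum_sub_distrib, Finset.mul_sum]
    refine Finset.sum_congr rfl fun i _ => ?_
    have h1 := conj_e he i
    rw [solV_mul hp0 hpp]
    simp only [Pi.mul_apply, map_mul, map_add, Complex.conj_conj]
    linear_combination (-conj (p i) * conj (θ i) * conj (e i) *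
      (conj (solV p θ 1 i) + solAmp p (p * θ) * solW p θ 1 i)) * hb -
      b * (conj (θ i) * (conj (solV p θ 1 i) + solAmp p (p * θ) * solW p θ 1 i)) * h1
  rw [circH, h, sum_conj_circF, sum_conj_circH, sum_mul_solV hp0 hpp, sum_conj_mul_solW, map_neg,
    map_mul, Complex.conj_conj, conj_solNorm hpp]
  ring

/-- The difference of `σ / τ`, up to powers of `b`, is quadratic in the Baker–Akhiezer function. -/
lemma resS_mul (hp0 : ∀ i, p i ≠ 0) (hpp : ∀ i j, p i * conj (p j) ≠ 1)
    (he : ∀ i, e i * (1 - b * p i) = 1) (θ : ι → ℂ) :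
    b * resS p e (p * θ) =
      resS p e θ + conj (circH p e θ) * conj (circF p e θ) / solNorm p θ := by
  have hN := solNorm_ne_zero hpp θ
  set κ := ∑ j, θ j * solV p θ e j with hκ
  have h : b * resS p e (p * θ) = ∑ i, θ i * e i * solV p θ e i - ∑ i, θ i * solV p θ e i -
      κ / solNorm p θ * (∑ i, θ i * e i * conj (solW p θ 1 i) -
        ∑ i, θ i * conj (solW p θ 1 i)) := by
    rw [resS, Finset.mul_sum, ← Finset.sum_sub_distrib, ← Finset.sum_sub_distrib, Finset.mul_sum,
      ← Finset.sum_sub_distrib]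
    refine Finset.sum_congr rfl fun i _ => ?_
    rw [(solV_solW_mul hp0 hpp θ e).1, ← hκ, Pi.mul_apply]
    linear_combination (-θ i * (solV p θ e i - κ / solNorm p θ * conj (solW p θ 1 i))) * he i
  rw [h, ← hκ, sum_circF, sum_mul_conj_solW hpp, hκ, sum_mul_solV_e hpp, resS]
  field_simp
  ring

/-- The difference of `∂_z log F` is quadratic in the Baker–Akhiezer function. -/
lemma resZ_mul (hp0 : ∀ i, p i ≠ 0) (hpp : ∀ i j, p i * conj (p j) ≠ 1) (e θ : ι → ℂ) :
    resZ p e (p * θ) = resZ p e θ - circH p e θ * conj (circH p e θ) / solNorm p θ := by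
  set κ := ∑ j, θ j * solV p θ e j with hκ
  have h : resZ p e (p * θ) = -(∑ i, conj (θ i) * conj (e i) * solW p θ e i +
      κ / solNorm p θ * ∑ i, conj (θ i) * conj (e i) * conj (solV p θ 1 i)) := by
    rw [resZ, Finset.mul_sum, ← Finset.sum_add_distrib]
    congr 1
    refine Finset.sum_congr rfl fun i _ => ?_
    have h1 := (solV_solW_mul hp0 hpp θ e).2 i
    rw [← hκ] at h1
    simp only [Pi.mul_apply, map_mul]
    linear_combination conj (θ i) * conj (e i) * h1
  rw [h, sum_conj_circH, hκ, sum_mul_solV_e hpp, resZ]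
  ring

/-! ### The shift of the weights by a Möbius transformation -/

variable {a : ℝ}

/-- Solutions for `θ' = θ (p - a) / (1 - a p)` in terms of solutions for `p θ` and `θ`. The
right-hand sides of interest are `r = 1` and `r = e`; in both cases `(1 - a / p) r` is the sum of a
multiple of `r₀ = r` and a multiple of `1 / p`. -/
lemma solV_solW_mobius (hp0 : ∀ i, p i ≠ 0) (hpp : ∀ i j, p i * conj (p j) ≠ 1)
    (hrel : ∀ i, θ' i * (1 - a * p i) = θ i * (p i - a)) {r : ι → ℂ} {r₀ : ι → ℂ} {k l : ℂ}
    (hr : ∀ i, (1 - a / p i) * r i = k * r₀ i - l * (a / p i)) :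
    (∀ i, (1 - a / p i) * solV p θ' r i = k * solV p (p * θ) r₀ i -
      a * (l + ∑ j, conj (θ' j) * solW p θ' r j) / solNorm p θ * (solV p θ 1 i / p i) -
      a * (∑ j, θ' j * solV p θ' r j) / solNorm p θ * conj (solW p θ 1 i)) ∧
    ∀ i, (1 - a / conj (p i)) * solW p θ' r i = k * solW p (p * θ) r₀ i -
      a * (l + ∑ j, conj (θ' j) * solW p θ' r j) / solNorm p θ * solW p θ 1 i +
      a * (∑ j, θ' j * solV p θ' r j) / solNorm p θ * (conj (solV p θ 1 i) / conj (p i)) := by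
  have hN := solNorm_ne_zero hpp θ
  set μ := ∑ j, conj (θ' j) * solW p θ' r j with hμ
  set μ' := ∑ j, θ' j * solV p θ' r j with hμ'
  have h1 := (isSol_solV hpp θ' r).mobius hp0 hpp hrel
  have h2 := (((isSol_solV hpp (p * θ) r₀).smul k).add ((isSol_fst_inv hp0 hpp θ).smul
    (-(a * (l + μ) / solNorm p θ)))).add ((isSol_snd_inv hp0 hpp θ).smul (a * μ' / solNorm p θ))
  have e1 : (fun i => (1 - a / p i) * r i - a / p i * μ) =
      fun i => k * r₀ i + -(a * (l + μ) / solNorm p θ) * (solNorm p θ / p i) +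
        a * μ' / solNorm p θ * 0 := by
    funext i
    have := hp0 i
    rw [hr]
    field_simp
    ring
  have e2 : (fun i => a / conj (p i) * μ') =
      fun i => k * (0 : ι → ℂ) i + -(a * (l + μ) / solNorm p θ) * 0 +
        a * μ' / solNorm p θ * (solNorm p θ / conj (p i)) := by
    funext i
    have : conj (p i) ≠ 0 := (map_ne_zero _).2 (hp0 i)
    simp only [Pi.zero_apply]
    field_simp
    ring
  rw [← hμ, ← hμ', e1, e2] at h1
  obtain ⟨h3, h4⟩ := h1.unique hpp h2
  constructor
  · intro i
    have := congrFun h3 i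
    rw [this]
    ring
  · intro i
    have := congrFun h4 i
    rw [this]
    ring

lemma solV_solW_mobius_one (hp0 : ∀ i, p i ≠ 0) (hpp : ∀ i j, p i * conj (p j) ≠ 1)
    (hrel : ∀ i, θ' i * (1 - a * p i) = θ i * (p i - a)) :
    (∀ i, (1 - a / p i) * solV p θ' 1 i = solV p (p * θ) 1 i -
      a * solNorm p θ' / solNorm p θ * (solV p θ 1 i / p i) +
      a * solNorm p θ' / solNorm p θ * conj (solAmp p (p * θ')) * conj (solW p θ 1 i)) ∧
    ∀ i, (1 - a / conj (p i)) * solW p θ' 1 i = solW p (p * θ) 1 i -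
      a * solNorm p θ' / solNorm p θ * solW p θ 1 i -
      a * solNorm p θ' / solNorm p θ * conj (solAmp p (p * θ')) *
        (conj (solV p θ 1 i) / conj (p i)) := by
  have h := solV_solW_mobius hp0 hpp hrel (r := 1) (r₀ := 1) (k := 1) (l := 1) (fun i => by simp)
  rw [sum_mul_solV hp0 hpp, sum_conj_mul_solW] at h
  constructor
  · intro i
    rw [h.1]
    ring
  · intro i
    rw [h.2]
    ring

/-- The dNLS equation for the amplitudes. -/
lemma solAmp_dNLS (hp0 : ∀ i, p i ≠ 0) (hpp : ∀ i j, p i * conj (p j) ≠ 1)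
    (hrel : ∀ i, θ' i * (1 - a * p i) = θ i * (p i - a)) :
    solAmp p θ' - solAmp p (p * θ) +
      a * solNorm p θ' / solNorm p θ * (solAmp p θ - solAmp p (p * θ')) = 0 := by
  have hN := solNorm_ne_zero hpp θ
  set g := a * solNorm p θ' / solNorm p θ with hg
  have conjAmp : ∀ θ : ι → ℂ, conj (solAmp p θ) = -∑ i, θ i * solV p θ 1 i / p i := fun θ => by
    simp [solAmp]
  have h1 : ∑ i, θ' i * solV p θ' 1 i / p i = a * ∑ i, θ' i * solV p θ' 1 i +
      (∑ i, (p * θ) i * solV p (p * θ) 1 i / p i - g * ∑ i, θ i * solV p θ 1 i / p i +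
      g * conj (solAmp p (p * θ')) * ∑ i, θ i * conj (solW p θ 1 i)) := by
    rw [Finset.mul_sum, Finset.mul_sum, Finset.mul_sum, ← Finset.sum_sub_distrib,
      ← Finset.sum_add_distrib, ← Finset.sum_add_distrib]
    refine Finset.sum_congr rfl fun i _ => ?_
    have h2 := (solV_solW_mobius_one hp0 hpp hrel).1 i
    rw [← hg] at h2
    have := hp0 i
    simp only [Pi.mul_apply]
    field_simp at h2 ⊢
    linear_combination θ i * h2 + solV p θ' 1 i * hrel i
  rw [sum_mul_solV hp0 hpp, sum_mul_conj_solW hpp] at h1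
  have h2 : conj (solAmp p θ' - solAmp p (p * θ) + g * (solAmp p θ - solAmp p (p * θ'))) = 0 := by
    have hgc : conj g = g := by
      simp [hg, conj_solNorm hpp]
    have hgN : g * solNorm p θ = a * solNorm p θ' := by rw [hg]; field_simp
    simp only [map_add, map_sub, map_mul, hgc]
    rw [conjAmp θ', conjAmp (p * θ), conjAmp θ]
    linear_combination -h1 - conj (solAmp p (p * θ')) * hgN
  simpa using congrArg conj h2

/-- The first component of the Baker–Akhiezer function for `θ'` in terms of that for `θ`: a discrete
zero-curvature representation of dNLS, at `λ = 1 / b`. -/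
lemma circF_mobius (hp0 : ∀ i, p i ≠ 0) (hpp : ∀ i j, p i * conj (p j) ≠ 1)
    (hb : b * conj b = 1) (he : ∀ i, e i * (1 - b * p i) = 1)
    (hrel : ∀ i, θ' i * (1 - a * p i) = θ i * (p i - a)) {g : ℂ}
    (hg : g = a * solNorm p θ' / solNorm p θ) :
    (1 - a * b) * circF p e θ' = (1 - g * b) * circF p e θ +
      (conj (solAmp p (p * θ)) + g * conj (solAmp p (p * θ'))) * circH p e θ := by
  have hN := solNorm_ne_zero hpp θ
  have h1 : (1 - a * b) * ∑ i, conj (θ' i) * conj (e i) * solW p θ' 1 i =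
      -(a * b) * ∑ i, conj (θ' i) * solW p θ' 1 i +
      (∑ i, conj ((p * θ) i) * conj (e i) * solW p (p * θ) 1 i -
        g * b * (∑ i, conj (θ i) * conj (e i) * solW p θ 1 i - ∑ i, conj (θ i) * solW p θ 1 i) -
        g * conj (solAmp p (p * θ')) *
          ∑ i, conj (θ i) * conj (e i) * conj (solV p θ 1 i)) := by
    simp only [Finset.mul_sum, ← Finset.sum_sub_distrib, ← Finset.sum_add_distrib]
    refine Finset.sum_congr rfl fun i _ => ?_
    have h2 := (solV_solW_mobius_one hp0 hpp hrel).2 i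
    rw [← hg] at h2
    have h3 := congrArg conj (hrel i)
    simp only [map_mul, map_sub, map_one, Complex.conj_ofReal] at h3
    have h4 := conj_e he i
    have : conj (p i) ≠ 0 := (map_ne_zero _).2 (hp0 i)
    simp only [Pi.mul_apply, map_mul]
    field_simp at h2
    linear_combination conj (θ i) * conj (e i) * h2 + conj (e i) * solW p θ' 1 i * h3 +
      (-a * b * conj (θ' i) * solW p θ' 1 i + g * b * conj (θ i) * solW p θ 1 i) * h4 +
      (-a * conj (θ' i) * solW p θ' 1 i + g * conj (θ i) * solW p θ 1 i) * conj (e i) *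
        conj (p i) * hb
  have hgN : g * solNorm p θ = a * solNorm p θ' := by rw [hg]; field_simp
  rw [sum_conj_circF, sum_conj_circF, sum_conj_circF, sum_conj_circH, sum_conj_mul_solW,
    sum_conj_mul_solW, circF_mul hp0 hpp] at h1
  linear_combination h1 + b * hgN

lemma circH_mobius (hp0 : ∀ i, p i ≠ 0) (hpp : ∀ i j, p i * conj (p j) ≠ 1)
    (hb : b * conj b = 1) (he : ∀ i, e i * (1 - b * p i) = 1)
    (hrel : ∀ i, θ' i * (1 - a * p i) = θ i * (p i - a)) {g : ℂ}
    (hg : g = a * solNorm p θ' / solNorm p θ) :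
    (1 - a * b) * circH p e θ' = (b - g) * circH p e θ -
      b * (solAmp p (p * θ) + g * solAmp p (p * θ')) * circF p e θ := by
  have hN := solNorm_ne_zero hpp θ
  have hgc : conj g = g := by
    simp [hg, conj_solNorm hpp]
  have h1 : (1 - a * b) * ∑ i, conj (θ' i) * conj (e i) * conj (solV p θ' 1 i) =
      -(a * b) * ∑ i, conj (θ' i) * conj (solV p θ' 1 i) +
      (∑ i, conj ((p * θ) i) * conj (e i) * conj (solV p (p * θ) 1 i) -
        g * ∑ i, conj (θ i) * conj (e i) * conj (solV p θ 1 i) +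
        g * solAmp p (p * θ') * b *
          (∑ i, conj (θ i) * conj (e i) * solW p θ 1 i - ∑ i, conj (θ i) * solW p θ 1 i)) := by
    simp only [Finset.mul_sum, ← Finset.sum_sub_distrib, ← Finset.sum_add_distrib]
    refine Finset.sum_congr rfl fun i _ => ?_
    have h2 := congrArg conj ((solV_solW_mobius_one hp0 hpp hrel).1 i)
    rw [← hg] at h2
    simp only [map_mul, map_sub, map_add, map_div₀, map_one, Complex.conj_ofReal, hgc,
      Complex.conj_conj] at h2
    have h3 := congrArg conj (hrel i)
    simp only [map_mul, map_sub, map_one, Complex.conj_ofReal] at h3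
    have h4 := conj_e he i
    have : conj (p i) ≠ 0 := (map_ne_zero _).2 (hp0 i)
    simp only [Pi.mul_apply, map_mul]
    field_simp at h2
    linear_combination conj (θ i) * conj (e i) * h2 + conj (e i) * conj (solV p θ' 1 i) * h3 +
      (-a * b * conj (θ' i) * conj (solV p θ' 1 i) -
        g * solAmp p (p * θ') * b * conj (θ i) * solW p θ 1 i) * h4 +
      (-a * conj (θ' i) * conj (solV p θ' 1 i) -
        g * solAmp p (p * θ') * conj (θ i) * solW p θ 1 i) * conj (e i) * conj (p i) * hb
  have hgN : g * solNorm p θ = a * solNorm p θ' := by rw [hg]; field_simp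
  have h5 := congrArg conj (sum_mul_solV hp0 hpp θ')
  simp only [map_neg, map_mul, map_sum, Complex.conj_conj, conj_solNorm hpp] at h5
  rw [sum_conj_circF, sum_conj_circH, sum_conj_circH, sum_conj_circH, h5,
    sum_conj_mul_solW, circH_mul hp0 hpp hb he] at h1
  linear_combination -h1 + b * solAmp p (p * θ') * hgN

lemma solV_solW_mobius_e (hp0 : ∀ i, p i ≠ 0) (hpp : ∀ i j, p i * conj (p j) ≠ 1)
    (he : ∀ i, e i * (1 - b * p i) = 1)
    (hrel : ∀ i, θ' i * (1 - a * p i) = θ i * (p i - a)) :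
    (∀ i, (1 - a / p i) * solV p θ' e i = (1 - a * b) * solV p (p * θ) e i -
      a * conj (circF p e θ') / solNorm p θ * (solV p θ 1 i / p i) +
      a * conj (circH p e θ') / solNorm p θ * conj (solW p θ 1 i)) ∧
    ∀ i, (1 - a / conj (p i)) * solW p θ' e i = (1 - a * b) * solW p (p * θ) e i -
      a * conj (circF p e θ') / solNorm p θ * solW p θ 1 i -
      a * conj (circH p e θ') / solNorm p θ * (conj (solV p θ 1 i) / conj (p i)) := by
  have h := solV_solW_mobius hp0 hpp hrel (r := e) (r₀ := e) (k := 1 - a * b) (l := 1)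
    (fun i => by
      have := hp0 i
      field_simp
      linear_combination (-a : ℂ) * he i)
  rw [sum_mul_solV_e hpp, sum_conj_mul_solW_e hpp] at h
  constructor
  · intro i
    rw [h.1]
    ring
  · intro i
    rw [h.2]
    ring

lemma resS_mobius (hp0 : ∀ i, p i ≠ 0) (hpp : ∀ i j, p i * conj (p j) ≠ 1)
    (he : ∀ i, e i * (1 - b * p i) = 1)
    (hrel : ∀ i, θ' i * (1 - a * p i) = θ i * (p i - a)) :
    (a - b) * resS p e θ' = -b * (1 - a * b) * resS p e (p * θ) - a / solNorm p θ *
      (b * conj (circF p e θ') * conj (circH p e θ) +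
        conj (circH p e θ') * conj (circF p e θ)) := by
  have hN := solNorm_ne_zero hpp θ
  have h1 : (a - b) * ∑ i, θ' i * e i * solV p θ' e i = a * ∑ i, θ' i * solV p θ' e i -
      (b * (1 - a * b) * ∑ i, (p * θ) i * e i * solV p (p * θ) e i -
        b * (a * conj (circF p e θ') / solNorm p θ) * ∑ i, θ i * e i * solV p θ 1 i +
        a * conj (circH p e θ') / solNorm p θ *
          (∑ i, θ i * e i * conj (solW p θ 1 i) - ∑ i, θ i * conj (solW p θ 1 i))) := by
    simp only [Finset.mul_sum, ← Finset.sum_sub_distrib, ← Finset.sum_add_distrib]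
    refine Finset.sum_congr rfl fun i _ => ?_
    have h2 := (solV_solW_mobius_e hp0 hpp he hrel).1 i
    set t := a * conj (circF p e θ') / solNorm p θ
    set t' := a * conj (circH p e θ') / solNorm p θ
    have := hp0 i
    simp only [Pi.mul_apply]
    field_simp at h2
    linear_combination -b * θ i * e i * h2 - b * e i * solV p θ' e i * hrel i +
      (a * θ' i * solV p θ' e i + t' * θ i * conj (solW p θ 1 i)) * he i
  rw [sum_mul_solV_e hpp, sum_circH, sum_circF, sum_mul_conj_solW hpp] at h1
  rw [resS, resS, h1]
  field_simp
  ring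

lemma resZ_mobius (hp0 : ∀ i, p i ≠ 0) (hpp : ∀ i j, p i * conj (p j) ≠ 1)
    (he : ∀ i, e i * (1 - b * p i) = 1)
    (hrel : ∀ i, θ' i * (1 - a * p i) = θ i * (p i - a)) :
    (a - conj b) * resZ p e θ' = a - conj b * (1 - a * b) * resZ p e (p * θ) - a / solNorm p θ *
      (conj (circF p e θ') * circF p e θ - conj b * conj (circH p e θ') * circH p e θ) := by
  have hN := solNorm_ne_zero hpp θ
  have h1 : (a - conj b) * ∑ i, conj (θ' i) * conj (e i) * solW p θ' e i =
      a * ∑ i, conj (θ' i) * solW p θ' e i -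
      (conj b * (1 - a * b) * ∑ i, conj ((p * θ) i) * conj (e i) * solW p (p * θ) e i -
        a * conj (circF p e θ') / solNorm p θ *
          (∑ i, conj (θ i) * conj (e i) * solW p θ 1 i - ∑ i, conj (θ i) * solW p θ 1 i) -
        conj b * (a * conj (circH p e θ') / solNorm p θ) *
          ∑ i, conj (θ i) * conj (e i) * conj (solV p θ 1 i)) := by
    simp only [Finset.mul_sum, ← Finset.sum_sub_distrib]
    refine Finset.sum_congr rfl fun i _ => ?_
    have h2 := (solV_solW_mobius_e hp0 hpp he hrel).2 i
    set t := a * conj (circF p e θ') / solNorm p θ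
    set t' := a * conj (circH p e θ') / solNorm p θ
    have h3 := congrArg conj (hrel i)
    simp only [map_mul, map_sub, map_one, Complex.conj_ofReal] at h3
    have h4 := conj_e he i
    have : conj (p i) ≠ 0 := (map_ne_zero _).2 (hp0 i)
    simp only [Pi.mul_apply, map_mul]
    field_simp at h2
    linear_combination -conj b * conj (θ i) * conj (e i) * h2 -
      conj b * conj (e i) * solW p θ' e i * h3 +
      (a * conj (θ' i) * solW p θ' e i - t * conj (θ i) * solW p θ 1 i) * h4
  rw [sum_conj_mul_solW_e hpp, sum_conj_circF, sum_conj_mul_solW, sum_conj_circH] at h1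
  rw [resZ, resZ, mul_neg, h1]
  field_simp
  ring

end Shift

/-! ### The determinants of the theorem in terms of the linear system -/

section

open Matrix

section Bordered

variable {N : ℕ} {M₁ M₂ : Matrix (Fin N) (Fin N) ℂ}

lemma det_tauMatrix (M₁ M₂ : Matrix (Fin N) (Fin N) ℂ) :
    (tauMatrix M₁ M₂).det = (1 + M₁ * M₂).det := by
  have h1 : tauMatrix M₁ M₂ * (fromBlocks 1 (-1) 0 1 * (fromBlocks 1 0 1 1 *
      fromBlocks 1 (-1) 0 1)) = fromBlocks 1 (-M₁) M₂ 1 := by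
    simp [tauMatrix, fromBlocks_multiply]
  have h2 := congrArg det h1
  simp only [det_mul, det_fromBlocks_zero₂₁, det_fromBlocks_zero₁₂, det_one, mul_one,
    det_fromBlocks_one₁₁, Matrix.mul_neg, sub_neg_eq_add] at h2
  rw [h2, det_one_add_mul_comm]

/-- A bordered determinant from a solution of the linear system with the border as right-hand
side. No inverse occurs, so the matrix may be singular. -/
lemma borderedDet_eq {x y ξ : Fin N ⊕ Fin N → ℂ} (h : tauMatrix M₁ M₂ *ᵥ ξ = x) :
    borderedDet M₁ M₂ x y = -((tauMatrix M₁ M₂).det * y ⬝ᵥ ξ) := by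
  have h1 : fromBlocks (tauMatrix M₁ M₂) (replicateCol Unit x) (replicateRow Unit y) 0 *
      fromBlocks 1 (-replicateCol Unit ξ) 0 1 =
      fromBlocks (tauMatrix M₁ M₂) 0 (replicateRow Unit y)
        (-(replicateRow Unit y * replicateCol Unit ξ)) := by
    rw [fromBlocks_multiply, ← h, replicateCol_mulVec]
    simp
  have h2 := congrArg det h1
  rw [det_mul, det_fromBlocks_zero₂₁, det_fromBlocks_zero₁₂, det_one, det_one, mul_one,
    mul_one] at h2
  rw [borderedDet, h2]
  simp

/-- Adding multiples of the border to the rows and columns of the matrix. -/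
lemma borderedDet_add (M₁ M₂ : Matrix (Fin N) (Fin N) ℂ) (x y k l : Fin N → ℂ) :
    borderedDet (M₁ + vecMulVec x k) (M₂ + vecMulVec l y) (Sum.elim x 0) (Sum.elim 0 y) =
      borderedDet M₁ M₂ (Sum.elim x 0) (Sum.elim 0 y) := by
  have h1 : fromBlocks (tauMatrix (M₁ + vecMulVec x k) (M₂ + vecMulVec l y))
        (replicateCol Unit (Sum.elim x 0)) (replicateRow Unit (Sum.elim 0 y)) 0 =
      fromBlocks 1 (replicateCol Unit (Sum.elim 0 l)) 0 1 *
      (fromBlocks (tauMatrix M₁ M₂) (replicateCol Unit (Sum.elim x 0))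
        (replicateRow Unit (Sum.elim 0 y)) 0 *
      fromBlocks 1 0 (replicateRow Unit (Sum.elim k 0)) 1) := by
    rw [fromBlocks_multiply, fromBlocks_multiply]
    ext i j
    rcases i with (i | i) | i <;> rcases j with (j | j) | j <;>
      simp [tauMatrix, Matrix.mul_apply, vecMulVec_apply]
  rw [borderedDet, h1, det_mul, det_mul, det_fromBlocks_zero₂₁, det_fromBlocks_zero₁₂]
  simp [borderedDet]

end Bordered

namespace Params

variable {N : ℕ} (P : Params N)

/-- The weights `θ_i = p_i^{1-n} e^{ζ_i} ((1 - a / p_i) / (1 - a p_i))^m`. -/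
def weight (n m : ℤ) (z : ℝ) (i : Fin N) : ℂ :=
  P.p i ^ (1 - n) * P.expZeta z i * ((1 - P.a / P.p i) / (1 - P.a * P.p i)) ^ m

/-- `e_i = 1 / (1 - b p_i)` -/
def res (i : Fin N) : ℂ := (1 - P.b * P.p i)⁻¹

/-- The nondegeneracy conditions on the parameters. -/
structure Good (P : Params N) : Prop where
  p_ne_zero : ∀ i, P.p i ≠ 0
  one_sub_ne : ∀ i, 1 - P.a * P.p i ≠ 0
  sub_ne : ∀ i, 1 - P.a / P.p i ≠ 0
  mul_conj_ne : ∀ i j, P.p i * conj (P.p j) ≠ 1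
  norm_b : ‖P.b‖ = 1

namespace Good

variable {P} (hP : P.Good)

include hP

lemma b_mul_conj : P.b * conj P.b = 1 := by
  rw [Complex.mul_conj', hP.norm_b]; norm_num

lemma b_ne_zero : P.b ≠ 0 := left_ne_zero_of_mul_eq_one hP.b_mul_conj

/-- `b p_i = 1` would imply `p_i p_i^* = 1`. -/
lemma one_sub_b_ne (i : Fin N) : 1 - P.b * P.p i ≠ 0 := by
  intro h
  apply hP.mul_conj_ne i i
  have h1 := congrArg norm (sub_eq_zero.1 h)
  rw [norm_mul, hP.norm_b, one_mul, norm_one] at h1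
  rw [Complex.mul_conj', ← h1]; norm_num

lemma res_mul (i : Fin N) : P.res i * (1 - P.b * P.p i) = 1 :=
  inv_mul_cancel₀ (hP.one_sub_b_ne i)

lemma p_mul_weight (n m : ℤ) (z : ℝ) : P.p * P.weight (n + 1) m z = P.weight n m z := by
  funext i
  have h : P.p i ^ (1 - n) = P.p i * P.p i ^ (1 - (n + 1)) := by
    rw [← zpow_one_add₀ (hP.p_ne_zero i)]
    congr 1
    ring
  rw [Pi.mul_apply, weight, weight, h]
  ring

lemma weight_succ (n m : ℤ) (z : ℝ) (i : Fin N) : P.weight n (m + 1) z i *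
    (1 - P.a * P.p i) = P.weight (n + 1) m z i * (P.p i - P.a) := by
  have h1 := hP.one_sub_ne i
  have h0 := hP.p_ne_zero i
  rw [← congrFun (hP.p_mul_weight n (m + 1) z) i, Pi.mul_apply, weight, weight,
    zpow_add_one₀ (div_ne_zero (hP.sub_ne i) h1)]
  have h2 : (1 - P.a / P.p i) / (1 - P.a * P.p i) * (1 - P.a * P.p i) = 1 - P.a / P.p i :=
    div_mul_cancel₀ _ h1
  have h3 : P.p i * (1 - P.a / P.p i) = P.p i - P.a := by field_simp
  set R := ((1 - P.a / P.p i) / (1 - P.a * P.p i)) ^ m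
  linear_combination P.p i ^ (1 - (n + 1)) * P.expZeta z i * R * (P.p i * h2 + h3)

/-- The first block, up to a change of gauge. -/
lemma m1_eq (n m : ℤ) (z : ℝ) : P.m1 n m 0 z = diagonal (P.phi1 n m 0 z) *
    Matrix.of (cauchy P.p) * diagonal fun j => -(conj (P.p j) * P.psi2 n m 0 z j) := by
  ext i j
  have h0 : conj (P.p j) ≠ 0 := (map_ne_zero _).2 (hP.p_ne_zero j)
  have h1 := sub_ne_zero.2 (hP.mul_conj_ne i j)
  have h2 : P.p i - 1 / conj (P.p j) ≠ 0 := by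
    intro h
    apply h1
    field_simp at h
    linear_combination h
  rw [mul_diagonal, diagonal_mul, m1, of_apply, of_apply, cauchy]
  field_simp

lemma m2_eq (m : ℤ) : P.m2 m 0 = diagonal (P.psi1 m 0) *
    (Matrix.of (cauchy P.p))ᵀ * diagonal fun j => -(P.p j * P.phi2 m 0 j) := by
  ext i j
  have h0 := hP.p_ne_zero j
  have h1 := sub_ne_zero.2 (hP.mul_conj_ne j i)
  have h2 : conj (P.p i) - 1 / P.p j ≠ 0 := by
    intro h
    apply h1
    field_simp at h
    linear_combination h
  rw [mul_diagonal, diagonal_mul, m2, of_apply, transpose_apply, of_apply, cauchy]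
  field_simp

lemma phi_mul (n m : ℤ) (z : ℝ) (j : Fin N) :
    -(P.p j * P.phi2 m 0 j) * P.phi1 n m 0 z j = P.weight n m z j := by
  have h0 := hP.p_ne_zero j
  have h1 := hP.one_sub_ne j
  rw [phi2, phi1, weight, div_zpow, _root_.zpow_neg, _root_.zpow_neg, zpow_sub₀ h0]
  field_simp
  simp

lemma psi_mul (n m : ℤ) (z : ℝ) (j : Fin N) :
    -(conj (P.p j) * P.psi2 n m 0 z j) * P.psi1 m 0 j = conj (P.weight n m z j) := by
  have h0 : conj (P.p j) ≠ 0 := (map_ne_zero _).2 (hP.p_ne_zero j)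
  have h1 : 1 - P.a * conj (P.p j) ≠ 0 := by
    have := (map_ne_zero (starRingEnd ℂ)).2 (hP.one_sub_ne j)
    simpa using this
  simp only [psi2, psi1, weight, map_mul, map_zpow₀, map_div₀, map_sub, map_one,
    Complex.conj_ofReal]
  rw [div_zpow, _root_.zpow_neg, _root_.zpow_neg, zpow_sub₀ h0]
  field_simp
  simp

lemma F_eq (n m : ℤ) (z : ℝ) : P.F n m z = solDet P.p (P.weight n m z) := by
  rw [F, tau, det_tauMatrix, hP.m1_eq, hP.m2_eq, Matrix.mul_assoc (diagonal _),
    Matrix.mul_assoc (diagonal (P.phi1 n m 0 z)), det_one_add_mul_comm, solDet, sysMat]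
  congr 2
  simp only [Matrix.mul_assoc, diagonal_mul_diagonal, hP.phi_mul]
  congr 1
  simp only [← Matrix.mul_assoc, diagonal_mul_diagonal, hP.psi_mul]

/-- The linear system is solved by the quaternionic conjugate of the solution with right-hand
side `1`. -/
lemma G_eq (n m : ℤ) (z : ℝ) :
    P.G n m z = P.F n m z * solAmp P.p (P.weight n m z) := by
  set θ := P.weight n m z with hθ
  have hs := isSol_solV hP.mul_conj_ne θ 1
  have h : tauMatrix (P.m1 n m 0 z) (P.m2 m 0) *ᵥ
      Sum.elim (fun i => -(P.psi1 m 0 i * conj (solV P.p θ 1 i)))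
        (fun i => P.phi1 n m 0 z i * conj (solW P.p θ 1 i)) =
        Sum.elim (0 : Fin N → ℂ) (P.psi1 m 0) := by
    rw [tauMatrix, fromBlocks_mulVec]
    congr 1
    · funext i
      have h1 := hs.star.fst i
      simp only [Pi.zero_apply, map_zero, neg_zero] at h1
      simp only [hP.m1_eq, Function.comp_def, Sum.elim_inl, Sum.elim_inr, Pi.add_apply,
        one_mulVec, mulVec, dotProduct, mul_diagonal, diagonal_mul, of_apply, Pi.zero_apply]
      have h2 : ∑ j, P.phi1 n m 0 z i * cauchy P.p i j * -(conj (P.p j) * P.psi2 n m 0 z j) *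
          -(P.psi1 m 0 j * conj (solV P.p θ 1 j)) = -P.phi1 n m 0 z i *
            ∑ j, cauchy P.p i j * (conj (θ j) * conj (solV P.p θ 1 j)) := by
        rw [Finset.mul_sum]
        refine Finset.sum_congr rfl fun j _ => ?_
        rw [hθ, ← hP.psi_mul]
        ring
      rw [h2]
      linear_combination -P.phi1 n m 0 z i * h1
    · funext i
      have h1 := hs.star.snd i
      simp only [Pi.one_apply, map_one] at h1
      simp only [hP.m2_eq, Function.comp_def, Sum.elim_inl, Sum.elim_inr, Pi.add_apply,
        neg_mulVec, one_mulVec, mulVec, dotProduct, mul_diagonal, diagonal_mul, of_apply,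
        transpose_apply, Pi.neg_apply]
      have h2 : ∑ j, P.psi1 m 0 i * cauchy P.p j i * -(P.p j * P.phi2 m 0 j) *
          (P.phi1 n m 0 z j * conj (solW P.p θ 1 j)) = -P.psi1 m 0 i *
            ∑ j, cauchy P.p j i * (θ j * -conj (solW P.p θ 1 j)) := by
        rw [Finset.mul_sum]
        refine Finset.sum_congr rfl fun j _ => ?_
        rw [hθ, ← hP.phi_mul]
        ring
      rw [h2]
      linear_combination P.psi1 m 0 i * h1
  rw [G, rho, borderedDet_eq h, F, tau, ← mul_neg]
  congr 1
  rw [solAmp]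
  simp only [dotProduct, Fintype.sum_sum_type, Sum.elim_inl, Sum.elim_inr, Pi.zero_apply, zero_mul,
    Finset.sum_const_zero, add_zero]
  congr 1
  refine Finset.sum_congr rfl fun j _ => ?_
  have h0 : conj (P.p j) ≠ 0 := (map_ne_zero _).2 (hP.p_ne_zero j)
  rw [map_div₀, map_mul, hθ, ← hP.psi_mul]
  field_simp

/-- The shifts of `r` and `s` change the blocks by multiples of the border, which do not affect the
bordered determinant. -/
lemma sigma_eq (n m : ℤ) (z : ℝ) : P.sigma n m 1 (-1) z =
    -(P.b * P.F n m z * resS P.p P.res (P.weight n m z)) := by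
  set θ := P.weight n m z with hθ
  have hb0 := hP.b_ne_zero
  have hphi1 : ∀ i, P.phi1 n m 1 z i = P.phi1 n m 0 z i * P.res i := fun i => by
    simp [phi1, res]
  have hpsi2 : ∀ i, P.psi2 n m 1 z i = P.psi2 n m 0 z i * (1 - P.b / conj (P.p i)) := fun i => by
    simp [psi2]
  have hphi2 : ∀ i, P.phi2 m (-1) i = -(P.b * P.p i * P.res i * P.phi2 m 0 i) := fun i => by
    have h0 := hP.p_ne_zero i
    have h1 := hP.one_sub_b_ne i
    have h2 : 1 - 1 / (P.b * P.p i) = -((1 - P.b * P.p i) / (P.b * P.p i)) := by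
      field_simp
      ring
    simp only [phi2, res, h2, _root_.zpow_neg_one, zpow_zero]
    rw [inv_neg, inv_div]
    field_simp
  have hpsi1 : ∀ i, P.psi1 m (-1) i = P.psi1 m 0 i * (1 - conj (P.p i) / P.b) := fun i => by
    simp [psi1]
  have hm1 : P.m1 n m 1 z = P.m1 n m 0 z +
      vecMulVec (P.phi1 n m 1 z) (fun j => -(P.b * P.psi2 n m 0 z j)) := by
    ext i j
    have h0 : conj (P.p j) ≠ 0 := (map_ne_zero _).2 (hP.p_ne_zero j)
    have h1 := sub_ne_zero.2 (hP.mul_conj_ne i j)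
    have h2 : P.p i - 1 / conj (P.p j) ≠ 0 := by
      intro h
      apply h1
      field_simp at h
      linear_combination h
    rw [Matrix.add_apply, vecMulVec_apply, m1, m1, of_apply, of_apply, hphi1, hpsi2]
    rw [div_add' _ _ _ h2, div_left_inj' h2]
    linear_combination (-P.phi1 n m 0 z i * P.psi2 n m 0 z j) * hP.res_mul i
  have hm2 : P.m2 m (-1) = P.m2 m 0 +
      vecMulVec (fun i => P.psi1 m 0 i / P.b) (P.phi2 m (-1)) := by
    ext i j
    have h0 := hP.p_ne_zero j
    have h1 := sub_ne_zero.2 (hP.mul_conj_ne j i)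
    have h2 : conj (P.p i) - 1 / P.p j ≠ 0 := by
      intro h
      apply h1
      field_simp at h
      linear_combination h
    rw [Matrix.add_apply, vecMulVec_apply, m2, m2, of_apply, of_apply, hphi2, hpsi1]
    rw [div_add' _ _ _ h2, div_left_inj' h2]
    field_simp
    linear_combination (-P.psi1 m 0 i * P.phi2 m 0 j) * hP.res_mul j
  have hs := isSol_solV hP.mul_conj_ne θ P.res
  have h : tauMatrix (P.m1 n m 0 z) (P.m2 m 0) *ᵥ
      Sum.elim (fun i => P.psi1 m 0 i * solW P.p θ P.res i)
        (fun i => P.phi1 n m 0 z i * solV P.p θ P.res i) = Sum.elim (P.phi1 n m 1 z) 0 := by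
    rw [tauMatrix, fromBlocks_mulVec]
    congr 1
    · funext i
      have h1 := hs.fst i
      simp only [hP.m1_eq, Function.comp_def, Sum.elim_inl, Sum.elim_inr, Pi.add_apply,
        one_mulVec, mulVec, dotProduct, mul_diagonal, diagonal_mul, of_apply]
      have h2 : ∑ j, P.phi1 n m 0 z i * cauchy P.p i j * -(conj (P.p j) * P.psi2 n m 0 z j) *
          (P.psi1 m 0 j * solW P.p θ P.res j) = P.phi1 n m 0 z i *
            ∑ j, cauchy P.p i j * (conj (θ j) * solW P.p θ P.res j) := by
        rw [Finset.mul_sum]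
        refine Finset.sum_congr rfl fun j _ => ?_
        rw [hθ, ← hP.psi_mul]
        ring
      rw [h2, hphi1]
      linear_combination P.phi1 n m 0 z i * h1
    · funext i
      have h1 := hs.snd i
      simp only [Pi.zero_apply] at h1
      simp only [hP.m2_eq, Function.comp_def, Sum.elim_inl, Sum.elim_inr, Pi.add_apply,
        neg_mulVec, one_mulVec, mulVec, dotProduct, mul_diagonal, diagonal_mul, of_apply,
        transpose_apply, Pi.neg_apply, Pi.zero_apply]
      have h2 : ∑ j, P.psi1 m 0 i * cauchy P.p j i * -(P.p j * P.phi2 m 0 j) *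
          (P.phi1 n m 0 z j * solV P.p θ P.res j) = P.psi1 m 0 i *
            ∑ j, cauchy P.p j i * (θ j * solV P.p θ P.res j) := by
        rw [Finset.mul_sum]
        refine Finset.sum_congr rfl fun j _ => ?_
        rw [hθ, ← hP.phi_mul]
        ring
      rw [h2]
      linear_combination -P.psi1 m 0 i * h1
  rw [sigma, hm1, hm2, borderedDet_add, borderedDet_eq h, F, tau, mul_comm P.b, mul_assoc]
  congr 2
  rw [resS, Finset.mul_sum]
  simp only [dotProduct, Fintype.sum_sum_type, Sum.elim_inl, Sum.elim_inr, Pi.zero_apply, zero_mul,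
    Finset.sum_const_zero, zero_add]
  refine Finset.sum_congr rfl fun j _ => ?_
  rw [hθ, ← hP.phi_mul, hphi2]
  ring

lemma h_eq (n m : ℤ) (z : ℝ) : P.h n m z =
    P.F n m z * -(P.b ^ (1 - n) * resS P.p P.res (P.weight n m z)) := by
  rw [h, hP.sigma_eq, sub_eq_add_neg, zpow_one_add₀ hP.b_ne_zero]
  ring

lemma hasDerivAt_F (n m : ℤ) (z : ℝ) : HasDerivAt (fun w : ℝ => P.F n m w)
    (P.F n m z * resZ P.p P.res (P.weight n m z)) z := by
  have hw : ∀ i, HasDerivAt (fun t => P.weight n m t i)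
      ((P.res i - 1 / 2) * P.weight n m z i) z := by
    intro i
    have h1 : HasDerivAt (fun t : ℝ =>
        1 / 2 * ((1 + P.b * P.p i) / (1 - P.b * P.p i)) * (t : ℂ))
        (1 / 2 * ((1 + P.b * P.p i) / (1 - P.b * P.p i)) * 1) z :=
      (Complex.ofRealCLM.hasDerivAt (x := z)).const_mul _
    have h2 := (h1.cexp.const_mul (P.p i ^ (1 - n))).mul_const
      (((1 - P.a / P.p i) / (1 - P.a * P.p i)) ^ m)
    refine HasDerivAt.congr_deriv h2 ?_
    have h3 : P.res i - 1 / 2 = 1 / 2 * ((1 + P.b * P.p i) / (1 - P.b * P.p i)) := by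
      have := hP.one_sub_b_ne i
      rw [res]
      field_simp
      ring
    rw [weight, expZeta, h3]
    ring
  have := hasDerivAt_solDet hP.mul_conj_ne hP.b_mul_conj hP.res_mul hw
    (isSol_solV hP.mul_conj_ne _ P.res)
  simp only [hP.F_eq]
  exact this

lemma F_pos (n m : ℤ) (z : ℝ) : 0 < (P.F n m z).re := by
  rw [hP.F_eq]; exact solDet_pos hP.mul_conj_ne _

lemma conj_F (n m : ℤ) (z : ℝ) : conj (P.F n m z) = P.F n m z := by
  rw [hP.F_eq, conj_solDet]

lemma F_im (n m : ℤ) (z : ℝ) : (P.F n m z).im = 0 := Complex.conj_eq_iff_im.1 (hP.conj_F n m z)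

lemma F_ne_zero (n m : ℤ) (z : ℝ) : P.F n m z ≠ 0 := fun h => by
  have := hP.F_pos n m z
  simp [h] at this

lemma deriv_log_F (n m : ℤ) (z : ℝ) : deriv (fun w : ℝ => Complex.log (P.F n m w)) z =
    resZ P.p P.res (P.weight n m z) := by
  have h := (hP.hasDerivAt_F n m z).clog_real (Or.inl (hP.F_pos n m z))
  rw [h.deriv, mul_div_cancel_left₀ _ (hP.F_ne_zero n m z)]

/-- `resZ` is the logarithmic derivative of a real function. -/
lemma conj_resZ (n m : ℤ) (z : ℝ) :
    conj (resZ P.p P.res (P.weight n m z)) = resZ P.p P.res (P.weight n m z) := by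
  have h1 := hP.hasDerivAt_F n m z
  have h2 : HasDerivAt (fun w : ℝ => conj (P.F n m w)) _ z := h1.star
  simp only [hP.conj_F] at h2
  have h3 := h2.unique h1
  rw [star_mul'] at h3
  have h4 : star (P.F n m z) = P.F n m z := hP.conj_F n m z
  rw [h4] at h3
  exact mul_left_cancel₀ (hP.F_ne_zero n m z) h3

end Good

end Params

end

/-! ### The discrete nonlinear Schrödinger equation -/

/-- The relations between the lattice intervals `ε`, `δ` and the constants `a`, `c`. -/
structure Lattice (ε δ a : ℝ) (c : ℂ) : Prop where
  eps_pos : 0 < ε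
  delta_ne : δ ≠ 0
  a_pos : 0 < a
  c_mul_conj : c * conj c = 1
  a_mul_c : a * c = 1 - Complex.I * (ε ^ 2 / δ)

lemma lattice_of_eq {ε δ a : ℝ} {c : ℂ} (hε : 0 < ε) (hδ : δ ≠ 0)
    (ha : a = Real.sqrt (1 + ε ^ 4 / δ ^ 2)) (hc : c = (1 - Complex.I * (ε ^ 2 / δ)) / a) :
    Lattice ε δ a c := by
  have h1 : 0 < 1 + ε ^ 4 / δ ^ 2 := by positivity
  have ha0 : 0 < a := ha ▸ Real.sqrt_pos.2 h1
  have ha1 : (a : ℂ) ≠ 0 := by exact_mod_cast ha0.ne'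
  have ha2 : (a : ℂ) ^ 2 = 1 + ε ^ 4 / δ ^ 2 := by
    have : a ^ 2 = 1 + ε ^ 4 / δ ^ 2 := by rw [ha, Real.sq_sqrt h1.le]
    exact_mod_cast this
  have hac : a * c = 1 - Complex.I * (ε ^ 2 / δ) := by rw [hc]; field_simp
  refine ⟨hε, hδ, ha0, ?_, hac⟩
  have h2 : (a * c) * conj (a * c) = a ^ 2 := by
    rw [hac, ha2]
    simp only [map_sub, map_one, map_mul, Complex.conj_I, map_div₀, map_pow, Complex.conj_ofReal]
    linear_combination (-(ε ^ 2 / δ : ℂ) ^ 2) * Complex.I_sq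
  rw [map_mul, Complex.conj_ofReal] at h2
  have h3 : (a : ℂ) ^ 2 * (c * conj c) = a ^ 2 * 1 := by linear_combination h2
  exact mul_left_cancel₀ (pow_ne_zero 2 ha1) h3

namespace Lattice

variable {ε δ a : ℝ} {c : ℂ} (hL : Lattice ε δ a c)

include hL

lemma c_ne_zero : c ≠ 0 := left_ne_zero_of_mul_eq_one hL.c_mul_conj

lemma conj_c : conj c = c⁻¹ := eq_inv_of_mul_eq_one_right hL.c_mul_conj

lemma norm_c : ‖c‖ = 1 := by
  have h := hL.c_mul_conj
  rw [Complex.mul_conj'] at h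
  have h2 : ‖c‖ ^ 2 = 1 := by exact_mod_cast h
  exact (pow_eq_one_iff_of_nonneg (norm_nonneg _) two_ne_zero).1 h2

lemma a_mul_inv_c : a * c⁻¹ = 1 + Complex.I * (ε ^ 2 / δ) := by
  have h := congrArg conj hL.a_mul_c
  simp only [map_sub, map_one, map_mul, Complex.conj_I, map_div₀, map_pow,
    Complex.conj_ofReal, hL.conj_c] at h
  rw [h]
  ring

lemma two_a_div : 2 * (a : ℂ) / (c + 1 / c) = a ^ 2 := by
  have h1 : (a : ℂ) * (c + 1 / c) = 2 := by
    linear_combination hL.a_mul_c + hL.a_mul_inv_c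
  have h2 : c + 1 / c ≠ 0 := right_ne_zero_of_mul (h1 ▸ two_ne_zero)
  rw [div_eq_iff h2]
  linear_combination (-a : ℂ) * h1

end Lattice

namespace Params

variable {N : ℕ} {P : Params N}

/-- The Ablowitz–Ladik potential `G / F`. -/
def amp (P : Params N) (z : ℝ) (n m : ℤ) : ℂ := solAmp P.p (P.weight n m z)

/-- The factor `Γ_n^m (1 + |x_n^m|²) / a`, `x = G / F`, as a ratio of determinants. -/
def speed (P : Params N) (z : ℝ) (n m : ℤ) : ℂ :=
  P.a * (P.F (n - 1) (m + 1) z * P.F (n + 1) m z) / (P.F n (m + 1) z * P.F n m z)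

/-- The gauge factor between `u` and the Ablowitz–Ladik potential. -/
def gauge (c : ℂ) (n m : ℤ) : ℂ := (-1) ^ m * c ^ (-n - 2 * m)

lemma gauge_add_one_left {c : ℂ} (hc : c ≠ 0) (n m : ℤ) :
    gauge c (n + 1) m = gauge c n m * c⁻¹ := by
  rw [gauge, gauge, mul_assoc, ← zpow_sub_one₀ hc]
  congr 2
  ring

lemma gauge_add_one_right {c : ℂ} (hc : c ≠ 0) (n m : ℤ) :
    gauge c n (m + 1) = -(gauge c n m * c⁻¹ * c⁻¹) := by
  rw [gauge, gauge, mul_assoc, mul_assoc, ← mul_assoc (c ^ (-n - 2 * m)), ← zpow_sub_one₀ hc,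
    ← zpow_sub_one₀ hc, zpow_add_one₀ (by norm_num : (-1 : ℂ) ≠ 0)]
  have : -n - 2 * (m + 1) = -n - 2 * m - 1 - 1 := by ring
  rw [this]
  ring

lemma gauge_sub_one_add_one {c : ℂ} (hc : c ≠ 0) (n m : ℤ) :
    gauge c (n - 1) (m + 1) = -(gauge c n m * c⁻¹) := by
  have h := gauge_add_one_left hc (n - 1) m
  rw [sub_add_cancel] at h
  rw [gauge_add_one_right hc, h]

lemma norm_gauge {c : ℂ} (hc : ‖c‖ = 1) (n m : ℤ) : ‖gauge c n m‖ = 1 := by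
  rw [gauge, norm_mul, norm_zpow, norm_zpow, hc, norm_neg, norm_one, one_zpow, one_zpow, one_mul]

lemma Gam_eq {ε δ : ℝ} {c : ℂ} (hL : Lattice ε δ P.a c) (z : ℝ) (n m : ℤ) :
    P.Gam c z n m = P.a ^ 2 *
    ((P.F (n - 1) (m + 1) z * P.F n m z) / (P.F n (m + 1) z * P.F (n - 1) m z)) := by
  rw [Gam, hL.two_a_div]

namespace Good

variable (hP : P.Good)

include hP

lemma solNorm_eq (n m : ℤ) (z : ℝ) :
    solNorm P.p (P.weight n m z) = P.F (n - 1) m z / P.F n m z := by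
  have h := solNorm_mul_solDet hP.mul_conj_ne (P.weight n m z)
  have h2 := hP.p_mul_weight (n - 1) m z
  rw [sub_add_cancel] at h2
  rw [h2, ← hP.F_eq, ← hP.F_eq] at h
  rw [eq_div_iff (hP.F_ne_zero n m z), h, mul_comm]

lemma one_add_amp (z : ℝ) (n m : ℤ) : 1 + P.amp z n m * conj (P.amp z n m) =
    P.F (n - 1) m z * P.F (n + 1) m z / (P.F n m z * P.F n m z) := by
  have h := solNorm_mul hP.p_ne_zero hP.mul_conj_ne (P.weight (n + 1) m z)
  rw [hP.p_mul_weight, hP.solNorm_eq, hP.solNorm_eq, add_sub_cancel_right] at h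
  have h0 := hP.F_ne_zero n m z
  have h1 := hP.F_ne_zero (n + 1) m z
  rw [amp]
  field_simp at h ⊢
  linear_combination -h

lemma speed_eq (z : ℝ) (n m : ℤ) : P.speed z n m =
    P.a * solNorm P.p (P.weight n (m + 1) z) / solNorm P.p (P.weight (n + 1) m z) := by
  have h0 := hP.F_ne_zero n m z
  have h1 := hP.F_ne_zero (n + 1) m z
  have h2 := hP.F_ne_zero n (m + 1) z
  rw [speed, hP.solNorm_eq, hP.solNorm_eq, add_sub_cancel_right]
  field_simp

lemma conj_speed (z : ℝ) (n m : ℤ) : conj (P.speed z n m) = P.speed z n m := by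
  simp [speed, hP.conj_F]

lemma amp_dNLS (z : ℝ) (n m : ℤ) : P.amp z n (m + 1) - P.amp z n m +
    P.speed z n m * (P.amp z (n + 1) m - P.amp z (n - 1) (m + 1)) = 0 := by
  have h := solAmp_dNLS hP.p_ne_zero hP.mul_conj_ne (hP.weight_succ n m z)
  have h2 := hP.p_mul_weight (n - 1) (m + 1) z
  rw [sub_add_cancel] at h2
  rwa [← hP.speed_eq, hP.p_mul_weight, h2] at h

lemma u_eq_amp (ε : ℝ) (c : ℂ) (z : ℝ) (n m : ℤ) :
    P.u ε c z n m = gauge c n m / ε * P.amp z n m := by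
  rw [u, hP.G_eq, mul_div_cancel_left₀ _ (hP.F_ne_zero n m z)]
  rfl

/-- `1 + ε² |u|²` as a ratio of determinants, whence the second equation of dNLS. -/
lemma one_add_u {ε δ : ℝ} {c : ℂ} (hL : Lattice ε δ P.a c) (z : ℝ) (n m : ℤ) :
    1 + (ε : ℂ) ^ 2 * (‖P.u ε c z n m‖ : ℂ) ^ 2 =
      P.F (n - 1) m z * P.F (n + 1) m z / (P.F n m z * P.F n m z) := by
  have hε := hL.eps_pos
  rw [← hP.one_add_amp, Complex.mul_conj', hP.u_eq_amp, norm_mul, norm_div,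
    norm_gauge hL.norm_c, Complex.norm_real, Real.norm_of_nonneg hε.le]
  have : (ε : ℂ) ≠ 0 := by exact_mod_cast hε.ne'
  push_cast
  field_simp

lemma ofReal_Gam_re {ε δ : ℝ} {c : ℂ} (hL : Lattice ε δ P.a c) (z : ℝ) (n m : ℤ) :
    ((P.Gam c z n m).re : ℂ) = P.Gam c z n m := by
  apply Complex.conj_eq_iff_re.1
  simp [Gam_eq hL, hP.conj_F]

lemma one_add_u_mul_Gam {ε δ : ℝ} {c : ℂ} (hL : Lattice ε δ P.a c) (z : ℝ) (n m : ℤ) :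
    (1 + (ε : ℂ) ^ 2 * (‖P.u ε c z n m‖ : ℂ) ^ 2) * P.Gam c z n m = P.a * P.speed z n m := by
  have h0 := hP.F_ne_zero n m z
  have h1 := hP.F_ne_zero (n - 1) m z
  have h2 := hP.F_ne_zero n (m + 1) z
  rw [hP.one_add_u hL, Gam_eq hL, speed]
  field_simp

/-- The `N`-soliton potentials solve dNLS. -/
lemma isSolution {ε δ : ℝ} {c : ℂ} (hL : Lattice ε δ P.a c) (z : ℝ) :
    IsSolution ε δ (P.u ε c z) (fun n m => (P.Gam c z n m).re) := by
  intro n m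
  have hc := hL.c_ne_zero
  have hε : (ε : ℂ) ≠ 0 := by exact_mod_cast hL.eps_pos.ne'
  constructor
  · have h1 : Complex.I * (ε ^ 2 / δ) - 1 = -(P.a * c) := by rw [hL.a_mul_c]; ring
    have h2 : Complex.I * (ε ^ 2 / δ) + 1 = P.a * c⁻¹ := by rw [hL.a_mul_inv_c]; ring
    rw [hP.ofReal_Gam_re hL, mul_assoc _ (1 + _), hP.one_add_u_mul_Gam hL, h1, h2, hP.u_eq_amp,
      hP.u_eq_amp, hP.u_eq_amp, hP.u_eq_amp, gauge_add_one_left hc, gauge_add_one_right hc,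
      gauge_sub_one_add_one hc]
    have h3 : c * c⁻¹ = 1 := mul_inv_cancel₀ hc
    linear_combination (gauge c n m / ε * P.a * c⁻¹) * hP.amp_dNLS z n m +
      (gauge c n m / ε * P.a * c⁻¹ * P.amp z n (m + 1)) * h3
  · have key : ((((P.Gam c z (n + 1) m).re / (P.Gam c z n m).re : ℝ)) : ℂ) =
        (((1 + ε ^ 2 * ‖P.u ε c z n m‖ ^ 2) / (1 + ε ^ 2 * ‖P.u ε c z n (m + 1)‖ ^ 2) : ℝ) : ℂ) := by
      push_cast
      rw [hP.ofReal_Gam_re hL, hP.ofReal_Gam_re hL, hP.one_add_u hL, hP.one_add_u hL,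
        Gam_eq hL, Gam_eq hL, add_sub_cancel_right]
      have h0 := hP.F_ne_zero n m z
      have h1 := hP.F_ne_zero (n - 1) m z
      have h2 := hP.F_ne_zero n (m + 1) z
      have h3 := hP.F_ne_zero (n + 1) m z
      have h4 := hP.F_ne_zero (n + 1) (m + 1) z
      have h5 := hP.F_ne_zero (n - 1) (m + 1) z
      have h6 : (P.a : ℂ) ≠ 0 := by exact_mod_cast hL.a_pos.ne'
      field_simp
    exact_mod_cast key

end Good

end Params

/-! ### The spinors and the coordinates of the curve -/

namespace Params

variable {N : ℕ} {P : Params N}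

/-- The first component of the Baker–Akhiezer function at `λ = c` on the edge from `n` to
`n + 1`. The phase makes the transition between adjacent edges depend on `u` only. -/
def spinF (P : Params N) (c : ℂ) (z : ℝ) (n m : ℤ) : ℂ :=
  c ^ m * circF P.p P.res (P.weight (n + 1) m z)

/-- The second component of the Baker–Akhiezer function at `λ = c` on the edge from `n` to
`n + 1`, with a phase as in `spinF`. -/
def spinH (P : Params N) (c : ℂ) (z : ℝ) (n m : ℤ) : ℂ :=
  (-1) ^ m * c ^ (-n - m) * circH P.p P.res (P.weight (n + 1) m z)

/-- The squared length of the spinor with components `spinF` and `spinH`, see `Good.spin_norm`. -/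
def spinNorm (P : Params N) (z : ℝ) (n m : ℤ) : ℂ := solNorm P.p (P.weight (n + 1) m z)

/-- The complex number whose real and imaginary parts are the first two coordinates of `γ / ε`. -/
def curveXY (P : Params N) (z : ℝ) (n m : ℤ) : ℂ := 2 * ((-1) ^ m * (P.h n m z / P.F n m z))

/-- The third coordinate of `γ / ε`. -/
def curveZ (P : Params N) (z : ℝ) (n m : ℤ) : ℂ :=
  2 * resZ P.p P.res (P.weight n m z) - n - 2 * m

/-- The potential `ε u`. -/
def pot (P : Params N) (c : ℂ) (z : ℝ) (n m : ℤ) : ℂ := gauge c n m * P.amp z n m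

variable {ε δ : ℝ} {c : ℂ}

lemma neg_one_zpow_mul_self (m : ℤ) : ((-1 : ℂ)) ^ m * (-1) ^ m = 1 := by
  rw [← mul_zpow]; norm_num

lemma conj_neg_one_zpow (m : ℤ) : conj ((-1 : ℂ) ^ m) = (-1) ^ m := by
  rw [map_zpow₀, map_neg, map_one]

lemma gauge_eq (hc : c ≠ 0) (n m : ℤ) :
    gauge c n m = (-1) ^ m * (c ^ n)⁻¹ * (c ^ m)⁻¹ * (c ^ m)⁻¹ := by
  have h : c ^ (-n - 2 * m) = (c ^ n)⁻¹ * (c ^ m)⁻¹ * (c ^ m)⁻¹ := by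
    have : -n - 2 * m = -n + -m + -m := by ring
    rw [this, zpow_add₀ hc, zpow_add₀ hc, zpow_neg, zpow_neg]
  rw [gauge, h]
  ring

lemma spinH_eq (hc : c ≠ 0) (z : ℝ) (n m : ℤ) : P.spinH c z n m =
    (-1) ^ m * (c ^ n)⁻¹ * (c ^ m)⁻¹ * circH P.p P.res (P.weight (n + 1) m z) := by
  rw [spinH, sub_eq_add_neg, zpow_add₀ hc, zpow_neg, zpow_neg]
  ring

end Params

namespace Lattice

open Params

variable {N : ℕ} {P : Params N} {ε δ a : ℝ} {c : ℂ} (hL : Lattice ε δ a c)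

include hL

lemma conj_zpow_c (n : ℤ) : conj (c ^ n) = (c ^ n)⁻¹ := by
  rw [map_zpow₀, hL.conj_c, inv_zpow]

lemma conj_gauge (n m : ℤ) :
    conj (gauge c n m) = (-1) ^ m * c ^ n * c ^ m * c ^ m := by
  rw [gauge_eq hL.c_ne_zero]
  simp only [map_mul, map_inv₀, hL.conj_zpow_c, conj_neg_one_zpow, inv_inv]

lemma conj_spinF (z : ℝ) (n m : ℤ) : conj (P.spinF c z n m) =
    (c ^ m)⁻¹ * conj (circF P.p P.res (P.weight (n + 1) m z)) := by
  rw [spinF, map_mul, hL.conj_zpow_c]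

lemma conj_spinH (z : ℝ) (n m : ℤ) : conj (P.spinH c z n m) =
    (-1) ^ m * c ^ n * c ^ m * conj (circH P.p P.res (P.weight (n + 1) m z)) := by
  rw [spinH_eq hL.c_ne_zero]
  simp only [map_mul, map_inv₀, hL.conj_zpow_c, conj_neg_one_zpow, inv_inv]

end Lattice

namespace Params

variable {N : ℕ} {P : Params N}

namespace Good

variable (hP : P.Good) {ε δ : ℝ} {c : ℂ}

include hP

lemma spinNorm_ne_zero (z : ℝ) (n m : ℤ) : P.spinNorm z n m ≠ 0 :=
  solNorm_ne_zero hP.mul_conj_ne _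

variable (hL : Lattice ε δ P.a c)

include hL

lemma spin_norm (z : ℝ) (n m : ℤ) : P.spinF c z n m * conj (P.spinF c z n m) +
    P.spinH c z n m * conj (P.spinH c z n m) = P.spinNorm z n m := by
  have h := circF_norm hP.mul_conj_ne hP.b_mul_conj hP.res_mul (P.weight (n + 1) m z)
  have hn : c ^ n ≠ 0 := zpow_ne_zero _ hL.c_ne_zero
  have hm : c ^ m ≠ 0 := zpow_ne_zero _ hL.c_ne_zero
  rw [hL.conj_spinF, hL.conj_spinH, spinF, spinH_eq hL.c_ne_zero, spinNorm, ← h]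
  have h1 := neg_one_zpow_mul_self m
  set σ := (-1 : ℂ) ^ m
  set k := c ^ n
  set s := c ^ m
  field_simp
  linear_combination (circH P.p P.res (P.weight (n + 1) m z) *
    conj (circH P.p P.res (P.weight (n + 1) m z))) * h1

/-- The transition between adjacent edges, `α_{n-1} = α_n + ε u_n^* β_n`. -/
lemma spinF_sub_one (z : ℝ) (n m : ℤ) : P.spinF c z (n - 1) m =
    P.spinF c z n m + conj (P.pot c z n m) * P.spinH c z n m := by
  have hn : c ^ n ≠ 0 := zpow_ne_zero _ hL.c_ne_zero
  have hm : c ^ m ≠ 0 := zpow_ne_zero _ hL.c_ne_zero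
  have h := circF_mul hP.p_ne_zero hP.mul_conj_ne P.res (P.weight (n + 1) m z)
  rw [hP.p_mul_weight] at h
  rw [pot, map_mul, hL.conj_gauge, spinH_eq hL.c_ne_zero, spinF, spinF, sub_add_cancel, h, amp]
  have h1 := neg_one_zpow_mul_self m
  set σ := (-1 : ℂ) ^ m
  set k := c ^ n
  set s := c ^ m
  field_simp
  linear_combination (-circH P.p P.res (P.weight (n + 1) m z) *
    conj (solAmp P.p (P.weight n m z))) * h1

/-- The edge of the curve is the Hopf image of the spinor: third coordinate. -/
lemma curveZ_succ_sub (z : ℝ) (n m : ℤ) : P.curveZ z (n + 1) m - P.curveZ z n m =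
    (P.spinH c z n m * conj (P.spinH c z n m) - P.spinF c z n m * conj (P.spinF c z n m)) /
      P.spinNorm z n m := by
  have hc := hL.c_ne_zero
  have hN := hP.spinNorm_ne_zero z n m
  have h := resZ_mul hP.p_ne_zero hP.mul_conj_ne P.res (P.weight (n + 1) m z)
  rw [hP.p_mul_weight] at h
  have h1 := hP.spin_norm hL z n m
  have h2 : P.spinH c z n m * conj (P.spinH c z n m) =
      circH P.p P.res (P.weight (n + 1) m z) * conj (circH P.p P.res (P.weight (n + 1) m z)) := by
    have hn : c ^ n ≠ 0 := zpow_ne_zero _ hc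
    have hm : c ^ m ≠ 0 := zpow_ne_zero _ hc
    have h1 := neg_one_zpow_mul_self m
    rw [hL.conj_spinH, spinH_eq hc]
    set σ := (-1 : ℂ) ^ m
    set k := c ^ n
    set s := c ^ m
    field_simp
    linear_combination (circH P.p P.res (P.weight (n + 1) m z) *
      conj (circH P.p P.res (P.weight (n + 1) m z))) * h1
  rw [eq_div_iff hN, curveZ, curveZ, h]
  have h3 : circH P.p P.res (P.weight (n + 1) m z) *
      conj (circH P.p P.res (P.weight (n + 1) m z)) / solNorm P.p (P.weight (n + 1) m z) *
      P.spinNorm z n m = P.spinH c z n m * conj (P.spinH c z n m) := by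
    rw [h2, spinNorm]
    exact div_mul_cancel₀ _ hN
  push_cast
  linear_combination 2 * h3 + h1

variable (hb : P.b = c⁻¹)

include hb

/-- The transition between adjacent edges, `β_{n-1} = β_n - ε u_n α_n`. -/
lemma spinH_sub_one (z : ℝ) (n m : ℤ) : P.spinH c z (n - 1) m =
    P.spinH c z n m - P.pot c z n m * P.spinF c z n m := by
  have hc := hL.c_ne_zero
  have hn : c ^ n ≠ 0 := zpow_ne_zero _ hc
  have hm : c ^ m ≠ 0 := zpow_ne_zero _ hc
  have h := circH_mul hP.p_ne_zero hP.mul_conj_ne hP.b_mul_conj hP.res_mul (P.weight (n + 1) m z)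
  rw [hP.p_mul_weight, hb] at h
  rw [pot, gauge_eq hc, spinH_eq hc, spinH_eq hc, spinF, sub_add_cancel, h, zpow_sub_one₀ hc, amp]
  set σ := (-1 : ℂ) ^ m
  set k := c ^ n
  set s := c ^ m
  field_simp

lemma h_div_F (z : ℝ) (n m : ℤ) :
    P.h n m z / P.F n m z = -(c ^ n * c⁻¹ * resS P.p P.res (P.weight n m z)) := by
  rw [hP.h_eq, mul_div_cancel_left₀ _ (hP.F_ne_zero n m z), hb, inv_zpow, ← zpow_neg, neg_sub,
    zpow_sub_one₀ hL.c_ne_zero]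

/-- The edge of the curve is the Hopf image of the spinor: first two coordinates. -/
lemma curveXY_succ_sub (z : ℝ) (n m : ℤ) : P.curveXY z (n + 1) m - P.curveXY z n m =
    2 * conj (P.spinF c z n m) * conj (P.spinH c z n m) / P.spinNorm z n m := by
  have hc := hL.c_ne_zero
  have hn : c ^ n ≠ 0 := zpow_ne_zero _ hc
  have hm : c ^ m ≠ 0 := zpow_ne_zero _ hc
  have hN := hP.spinNorm_ne_zero z n m
  have h := resS_mul hP.p_ne_zero hP.mul_conj_ne hP.res_mul (P.weight (n + 1) m z)
  rw [hP.p_mul_weight, hb] at h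
  rw [curveXY, curveXY, hP.h_div_F hL hb, hP.h_div_F hL hb, zpow_add_one₀ hc, hL.conj_spinF,
    hL.conj_spinH, ← sub_eq_zero]
  rw [spinNorm] at hN ⊢
  have h2 : resS P.p P.res (P.weight n m z) = c * (resS P.p P.res (P.weight (n + 1) m z) +
      conj (circH P.p P.res (P.weight (n + 1) m z)) *
      conj (circF P.p P.res (P.weight (n + 1) m z)) / solNorm P.p (P.weight (n + 1) m z)) := by
    rw [← h]; field_simp
  rw [h2]
  set σ := (-1 : ℂ) ^ m
  set k := c ^ n
  set s := c ^ m
  field_simp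
  ring

/-- The Baker–Akhiezer function at `λ = c` after one step of `m`, where `1 - a b = -I ε² / δ` for
`b = 1 / c`. -/
lemma circ_weight_succ (z : ℝ) (n m : ℤ) :
    Complex.I * (ε ^ 2 / δ) * conj (circF P.p P.res (P.weight n (m + 1) z)) =
      (1 - P.speed z n m * c) * conj (circF P.p P.res (P.weight (n + 1) m z)) +
      (P.amp z n m + P.speed z n m * P.amp z (n - 1) (m + 1)) *
        conj (circH P.p P.res (P.weight (n + 1) m z)) ∧
    Complex.I * (ε ^ 2 / δ) * conj (circH P.p P.res (P.weight n (m + 1) z)) =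
      (c - P.speed z n m) * conj (circH P.p P.res (P.weight (n + 1) m z)) -
      c * (conj (P.amp z n m) + P.speed z n m * conj (P.amp z (n - 1) (m + 1))) *
        conj (circF P.p P.res (P.weight (n + 1) m z)) := by
  have hp' := hP.p_mul_weight (n - 1) (m + 1) z
  rw [sub_add_cancel] at hp'
  have h1 := congrArg conj (circF_mobius hP.p_ne_zero hP.mul_conj_ne hP.b_mul_conj hP.res_mul
    (hP.weight_succ n m z) (hP.speed_eq z n m))
  have h2 := congrArg conj (circH_mobius hP.p_ne_zero hP.mul_conj_ne hP.b_mul_conj hP.res_mul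
    (hP.weight_succ n m z) (hP.speed_eq z n m))
  rw [hP.p_mul_weight, hp', hb] at h1 h2
  simp only [map_mul, map_sub, map_add, map_one, Complex.conj_ofReal, hP.conj_speed, map_inv₀,
    hL.conj_c, inv_inv, Complex.conj_conj, hL.a_mul_c] at h1 h2
  rw [amp, amp]
  constructor
  · linear_combination h1
  · linear_combination h2

/-- The first two coordinates of the motion of the curve, as a combination of the tangent vector and
of the vector orthogonal to it which belongs to the complex number `W`. -/
lemma curveXY_deform (z : ℝ) (n m : ℤ) {W : ℂ}
    (hW : W = (1 + Complex.I * (ε ^ 2 / δ)) * P.pot c z n m -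
      P.a * P.speed z n m * P.pot c z (n - 1) (m + 1)) :
    (ε ^ 2 / δ) ^ 2 * P.spinNorm z n m * (P.curveXY z n (m + 1) - P.curveXY z n m) =
      2 * (2 * (P.a * P.speed z n m - 1) * conj (P.spinF c z n m) * conj (P.spinH c z n m) +
        conj W * conj (P.spinF c z n m) ^ 2 - W * conj (P.spinH c z n m) ^ 2) := by
  have hc := hL.c_ne_zero
  have hn : c ^ n ≠ 0 := zpow_ne_zero _ hc
  have hm : c ^ m ≠ 0 := zpow_ne_zero _ hc
  have hN := hP.spinNorm_ne_zero z n m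
  have hS := resS_mobius hP.p_ne_zero hP.mul_conj_ne hP.res_mul (hP.weight_succ n m z)
  obtain ⟨hf, hh⟩ := hP.circ_weight_succ hL hb z n m
  have hac := hL.a_mul_c
  have hab := hL.a_mul_inv_c
  have hW' : W = gauge c n m * c⁻¹ *
      (P.a * (P.amp z n m + P.speed z n m * P.amp z (n - 1) (m + 1))) := by
    rw [hW, pot, pot, gauge_sub_one_add_one hc, ← hab]
    ring
  have hWc : conj W = conj (gauge c n m) * c *
      (P.a * (conj (P.amp z n m) + P.speed z n m * conj (P.amp z (n - 1) (m + 1)))) := by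
    rw [hW']
    simp only [map_mul, map_add, map_inv₀, Complex.conj_ofReal, hP.conj_speed, hL.conj_c, inv_inv]
  rw [hP.p_mul_weight, hb] at hS
  rw [hWc, hW', curveXY, curveXY, hP.h_div_F hL hb, hP.h_div_F hL hb, hL.conj_spinF,
    hL.conj_spinH, zpow_add_one₀ (by norm_num : (-1 : ℂ) ≠ 0), hL.conj_gauge,
    gauge_eq hc]
  rw [spinNorm] at hN ⊢
  have h1 := neg_one_zpow_mul_self m
  set σ := (-1 : ℂ) ^ m
  set k := c ^ n
  set s := c ^ m
  set f := conj (circF P.p P.res (P.weight (n + 1) m z))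
  set f' := conj (circF P.p P.res (P.weight n (m + 1) z))
  set h := conj (circH P.p P.res (P.weight (n + 1) m z))
  set h' := conj (circH P.p P.res (P.weight n (m + 1) z))
  set X := P.amp z n m + P.speed z n m * P.amp z (n - 1) (m + 1)
  set X' := conj (P.amp z n m) + P.speed z n m * conj (P.amp z (n - 1) (m + 1))
  set S := resS P.p P.res (P.weight n m z)
  set S' := resS P.p P.res (P.weight n (m + 1) z)
  set g := P.speed z n m
  set 𝔫 := solNorm P.p (P.weight (n + 1) m z)
  set A := (P.a : ℂ)
  set t := (ε ^ 2 / δ : ℂ)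
  set I := Complex.I
  have hI : I ^ 2 = -1 := Complex.I_sq
  -- the step of `resS`, with the factor `a - b = - I t b` divided out
  have hS1 : I * t * 𝔫 * (S' + S) = A * (f' * h + c * h' * f) := by
    have h2 : (A - c⁻¹) = -(I * t) * c⁻¹ := by
      have : A = A * c * c⁻¹ := by field_simp
      rw [this, hac]; ring
    rw [h2, hab] at hS
    field_simp at hS
    linear_combination -hS
  have hS2 : t ^ 2 * 𝔫 * (S' + S) =
      -(A * (((1 - g * c) * f + X * h) * h + c * ((c - g) * h - c * X' * f) * f)) := by
    linear_combination (-I * t) * hS1 - A * h * hf - A * c * f * hh +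
      (t ^ 2 * 𝔫 * (S' + S)) * hI
  have hcc : c * c⁻¹ = 1 := mul_inv_cancel₀ hc
  have e1 : t ^ 2 * 𝔫 * (2 * (σ * -1 * -(k * c⁻¹ * S')) - 2 * (σ * -(k * c⁻¹ * S))) =
      2 * σ * k * c⁻¹ * (t ^ 2 * 𝔫 * (S' + S)) := by ring
  rw [e1, hS2]
  have h3 : A * c + A * c⁻¹ = 2 := by rw [hac, hab]; ring
  have h4 : 2 * (A * g - 1) = 2 * A * g - A * c - A * c⁻¹ := by linear_combination h3
  rw [h4]
  field_simp
  linear_combination (σ * A * X * h ^ 2) * h1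

/-- The third coordinate of the motion of the curve, with the same coefficients as in
`curveXY_deform`. -/
lemma curveZ_deform (z : ℝ) (n m : ℤ) {W : ℂ}
    (hW : W = (1 + Complex.I * (ε ^ 2 / δ)) * P.pot c z n m -
      P.a * P.speed z n m * P.pot c z (n - 1) (m + 1)) :
    (ε ^ 2 / δ) ^ 2 * P.spinNorm z n m * (P.curveZ z n (m + 1) - P.curveZ z n m) =
      2 * ((P.a * P.speed z n m - 1) * (P.spinH c z n m * conj (P.spinH c z n m) -
        P.spinF c z n m * conj (P.spinF c z n m)) +
        W * P.spinF c z n m * conj (P.spinH c z n m) +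
        conj W * conj (P.spinF c z n m) * P.spinH c z n m) := by
  have hc := hL.c_ne_zero
  have hn : c ^ n ≠ 0 := zpow_ne_zero _ hc
  have hm : c ^ m ≠ 0 := zpow_ne_zero _ hc
  have hN := hP.spinNorm_ne_zero z n m
  have hZ := resZ_mobius hP.p_ne_zero hP.mul_conj_ne hP.res_mul (hP.weight_succ n m z)
  obtain ⟨hf, hh⟩ := hP.circ_weight_succ hL hb z n m
  have hac := hL.a_mul_c
  have hab := hL.a_mul_inv_c
  have hnorm := circF_norm hP.mul_conj_ne hP.b_mul_conj hP.res_mul (P.weight (n + 1) m z)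
  have hW' : W = gauge c n m * c⁻¹ *
      (P.a * (P.amp z n m + P.speed z n m * P.amp z (n - 1) (m + 1))) := by
    rw [hW, pot, pot, gauge_sub_one_add_one hc, ← hab]
    ring
  have hWc : conj W = conj (gauge c n m) * c *
      (P.a * (conj (P.amp z n m) + P.speed z n m * conj (P.amp z (n - 1) (m + 1)))) := by
    rw [hW']
    simp only [map_mul, map_add, map_inv₀, Complex.conj_ofReal, hP.conj_speed, hL.conj_c, inv_inv]
  rw [hP.p_mul_weight, hb, map_inv₀, hL.conj_c, inv_inv] at hZ
  rw [hWc, hW', curveZ, curveZ, hL.conj_spinF, hL.conj_spinH, spinF, spinH_eq hc,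
    hL.conj_gauge, gauge_eq hc]
  rw [spinNorm] at hN ⊢
  have h1 := neg_one_zpow_mul_self m
  set σ := (-1 : ℂ) ^ m
  set k := c ^ n
  set s := c ^ m
  set f₀ := circF P.p P.res (P.weight (n + 1) m z)
  set h₀ := circH P.p P.res (P.weight (n + 1) m z)
  set f := conj f₀
  set f' := conj (circF P.p P.res (P.weight n (m + 1) z))
  set h := conj h₀
  set h' := conj (circH P.p P.res (P.weight n (m + 1) z))
  set X := P.amp z n m + P.speed z n m * P.amp z (n - 1) (m + 1)
  set X' := conj (P.amp z n m) + P.speed z n m * conj (P.amp z (n - 1) (m + 1))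
  set Z := resZ P.p P.res (P.weight n m z)
  set Z' := resZ P.p P.res (P.weight n (m + 1) z)
  set g := P.speed z n m
  set 𝔫 := solNorm P.p (P.weight (n + 1) m z)
  set A := (P.a : ℂ)
  set t := (ε ^ 2 / δ : ℂ)
  set I := Complex.I
  have hI : I ^ 2 = -1 := Complex.I_sq
  -- the step of `resZ`, with the factor `a - b^* = I t c` divided out
  have hZ1 : I * t * 𝔫 * (Z' - Z - 1) = 𝔫 - A * c⁻¹ * f' * f₀ + A * h' * h₀ := by
    have h2 : (A - c) = (I * t) * c := by
      have : A = A * c⁻¹ * c := by field_simp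
      rw [this, hab]; ring
    have h3 : A = (1 + I * t) * c := by rw [← hab]; field_simp
    rw [h2, hab] at hZ
    have h4 : c * (I * t * 𝔫 * (Z' - Z - 1)) = c * (𝔫 - A * c⁻¹ * f' * f₀ + A * h' * h₀) := by
      field_simp at hZ ⊢
      linear_combination hZ + 𝔫 * h3
    exact mul_left_cancel₀ hc h4
  have hZ2 : t ^ 2 * 𝔫 * (Z' - Z - 1) = -(I * t * 𝔫) +
      A * c⁻¹ * f₀ * ((1 - g * c) * f + X * h) - A * h₀ * ((c - g) * h - c * X' * f) := by
    linear_combination (-I * t) * hZ1 + A * c⁻¹ * f₀ * hf - A * h₀ * hh +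
      (t ^ 2 * 𝔫 * (Z' - Z - 1)) * hI
  push_cast
  have e1 : t ^ 2 * 𝔫 * (2 * Z' - n - 2 * (m + 1) - (2 * Z - n - 2 * m)) =
      2 * (t ^ 2 * 𝔫 * (Z' - Z - 1)) := by ring
  rw [e1, hZ2, ← hnorm]
  have e2 : σ * k⁻¹ * s⁻¹ * h₀ * (σ * k * s * h) = h₀ * h := by
    field_simp
    linear_combination h₀ * h * h1
  have e3 : s * f₀ * (s⁻¹ * f) = f₀ * f := by field_simp
  have e4 : σ * k⁻¹ * s⁻¹ * s⁻¹ * c⁻¹ * (A * X) * (s * f₀) * (σ * k * s * h) =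
      c⁻¹ * A * X * f₀ * h := by
    field_simp
    linear_combination A * X * f₀ * h * h1
  have e5 : σ * k * s * s * c * (A * X') * (s⁻¹ * f) * (σ * k⁻¹ * s⁻¹ * h₀) =
      c * A * X' * f * h₀ := by
    field_simp
    linear_combination A * X' * f * h₀ * h1
  have hcc : c * c⁻¹ = 1 := mul_inv_cancel₀ hc
  rw [e2, e3, e4, e5]
  linear_combination (2 * f₀ * f) * hab - 2 * h₀ * h * hac - 2 * A * g * f₀ * f * hcc

end Good

end Params

/-! ### Vectors in space from spinors -/

section Spinor

/-- The vector with coordinates `Re ξ`, `Im ξ`, `Re η`. -/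
def vec (ξ η : ℂ) : E3 := !₂[ξ.re, ξ.im, η.re]

lemma vec_add (ξ η ξ' η' : ℂ) : vec ξ η + vec ξ' η' = vec (ξ + ξ') (η + η') := by
  ext i
  fin_cases i <;> simp [vec]

lemma vec_sub (ξ η ξ' η' : ℂ) : vec ξ η - vec ξ' η' = vec (ξ - ξ') (η - η') := by
  ext i
  fin_cases i <;> simp [vec]

lemma smul_vec (r : ℝ) (ξ η : ℂ) : r • vec ξ η = vec (r * ξ) (r * η) := by
  ext i
  fin_cases i <;> simp [vec]

/-- The unit vector defined by a spinor `(α, β)`, the image of `(β : α^*)` under the Hopf map. -/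
def spinT (α β : ℂ) : E3 :=
  vec (2 * (conj α * conj β) / (α * conj α + β * conj β))
    ((β * conj β - α * conj α) / (α * conj α + β * conj β))

/-- The map from `ℂ` to the plane orthogonal to `spinT α β`, an isometry respecting the
orientation. -/
def spinE (α β W : ℂ) : E3 :=
  vec ((conj W * conj α ^ 2 - W * conj β ^ 2) / (α * conj α + β * conj β))
    ((W * α * conj β + conj W * conj α * β) / (α * conj α + β * conj β))

lemma spinE_add (α β W W' : ℂ) : spinE α β W + spinE α β W' = spinE α β (W + W') := by
  rw [spinE, spinE, spinE, vec_add, map_add]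
  congr 1 <;> ring

lemma smul_spinE (r : ℝ) (α β W : ℂ) : r • spinE α β W = spinE α β (r * W) := by
  rw [spinE, spinE, smul_vec, map_mul, Complex.conj_ofReal]
  congr 1 <;> ring

lemma inner_E3 (v w : E3) : inner ℝ v w = v 0 * w 0 + v 1 * w 1 + v 2 * w 2 := by
  simp [PiLp.inner_apply, Fin.sum_univ_three]
  ring

lemma cross_smul_left (r : ℝ) (v w : E3) : cross (r • v) w = r • cross v w := by
  simp [cross]

lemma cross_sub_left (u v w : E3) : cross (u - v) w = cross u w - cross v w := by
  simp [cross]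

lemma cross_self_E3 (v : E3) : cross v v = 0 := by
  simp [cross]

variable {α β : ℂ}

/-- The coordinates of `spinT` and `spinE` as real fractions. -/
lemma spin_coords (hne : α * conj α + β * conj β ≠ 0) : ∃ a₁ a₂ b₁ b₂ d : ℝ,
    d = a₁ ^ 2 + a₂ ^ 2 + b₁ ^ 2 + b₂ ^ 2 ∧ d ≠ 0 ∧
    spinT α β = !₂[2 * (a₁ * b₁ - a₂ * b₂) / d, -(2 * (a₁ * b₂ + a₂ * b₁)) / d,
      (b₁ ^ 2 + b₂ ^ 2 - a₁ ^ 2 - a₂ ^ 2) / d] ∧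
    ∀ W, spinE α β W = !₂[(W.re * (a₁ ^ 2 - a₂ ^ 2 - b₁ ^ 2 + b₂ ^ 2) -
        2 * W.im * (a₁ * a₂ + b₁ * b₂)) / d,
      (-2 * W.re * (a₁ * a₂ - b₁ * b₂) - W.im * (a₁ ^ 2 - a₂ ^ 2 + b₁ ^ 2 - b₂ ^ 2)) / d,
      2 * (W.re * (a₁ * b₁ + a₂ * b₂) - W.im * (a₂ * b₁ - a₁ * b₂)) / d] := by
  have hd : α * conj α + β * conj β = ((α.re ^ 2 + α.im ^ 2 + β.re ^ 2 + β.im ^ 2 : ℝ) : ℂ) := by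
    rw [Complex.mul_conj, Complex.mul_conj, Complex.normSq_apply, Complex.normSq_apply]
    push_cast
    ring
  generalize hD : α.re ^ 2 + α.im ^ 2 + β.re ^ 2 + β.im ^ 2 = d at hd
  refine ⟨α.re, α.im, β.re, β.im, d, hD.symm, ?_, ?_, ?_⟩
  · intro h
    rw [hd, h] at hne
    simp at hne
  · rw [spinT, vec, hd]
    ext i
    fin_cases i <;> simp [Complex.div_ofReal_re, Complex.div_ofReal_im] <;> ring
  · intro W
    rw [spinE, vec, hd]
    ext i
    fin_cases i <;> simp [Complex.div_ofReal_re, Complex.div_ofReal_im, pow_two] <;> ring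

lemma inner_spinT_self (hne : α * conj α + β * conj β ≠ 0) :
    inner ℝ (spinT α β) (spinT α β) = 1 := by
  obtain ⟨a₁, a₂, b₁, b₂, d, hd, hd0, hT, -⟩ := spin_coords hne
  rw [inner_E3, hT]
  simp
  field_simp
  rw [hd]
  ring

lemma inner_spinT_spinE (hne : α * conj α + β * conj β ≠ 0) (W : ℂ) :
    inner ℝ (spinT α β) (spinE α β W) = 0 := by
  obtain ⟨a₁, a₂, b₁, b₂, d, hd, hd0, hT, hE⟩ := spin_coords hne
  rw [inner_E3, hT, hE]
  simp
  field_simp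
  ring

lemma inner_spinE (hne : α * conj α + β * conj β ≠ 0) (W W' : ℂ) :
    inner ℝ (spinE α β W) (spinE α β W') = (W * conj W').re := by
  obtain ⟨a₁, a₂, b₁, b₂, d, hd, hd0, hT, hE⟩ := spin_coords hne
  rw [inner_E3, hE, hE]
  simp
  field_simp
  rw [hd]
  ring

lemma cross_spinE_spinT (hne : α * conj α + β * conj β ≠ 0) (W : ℂ) :
    cross (spinE α β W) (spinT α β) = spinE α β (-(Complex.I * W)) := by
  obtain ⟨a₁, a₂, b₁, b₂, d, hd, hd0, hT, hE⟩ := spin_coords hne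
  rw [cross, hT, hE, hE]
  ext i
  fin_cases i <;> simp [cross_apply] <;> field_simp <;> rw [hd] <;> ring

lemma cross_spinE (hne : α * conj α + β * conj β ≠ 0) (W W' : ℂ) :
    cross (spinE α β W) (spinE α β W') = (conj W * W').im • spinT α β := by
  obtain ⟨a₁, a₂, b₁, b₂, d, hd, hd0, hT, hE⟩ := spin_coords hne
  rw [cross, hT, hE, hE]
  ext i
  fin_cases i <;> simp [cross_apply] <;> field_simp <;> rw [hd] <;> ring

/-- The transition `(α, β) ↦ (α + U^* β, β - U α)`, `U = r w`, is a rotation about the axis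
`spinE α β (I w)`, by an angle whose half has the tangent `r`. -/
lemma spin_transition (hne : α * conj α + β * conj β ≠ 0) {r : ℝ} {w α' β' : ℂ}
    (hw : w * conj w = 1) (hα : α' = α + conj (r * w) * β) (hβ : β' = β - r * w * α) :
    spinT α' β' = ((1 - r ^ 2) / (1 + r ^ 2)) • spinT α β -
      (2 * r / (1 + r ^ 2)) • spinE α β w ∧
    spinE α' β' w = ((1 - r ^ 2) / (1 + r ^ 2)) • spinE α β w +
      (2 * r / (1 + r ^ 2)) • spinT α β ∧
    spinE α' β' (Complex.I * w) = spinE α β (Complex.I * w) := by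
  have hr : (1 + r ^ 2 : ℂ) ≠ 0 := by
    have : (1 + r ^ 2 : ℝ) ≠ 0 := by positivity
    exact_mod_cast this
  have hα' : conj α' = conj α + r * w * conj β := by
    rw [hα]; simp
  have hβ' : conj β' = conj β - r * conj w * conj α := by
    rw [hβ]; simp
  have hα : α' = α + r * conj w * β := by
    rw [hα]; simp
  have hd : α' * conj α' + β' * conj β' = (1 + r ^ 2) * (α * conj α + β * conj β) := by
    rw [hα', hβ', hα, hβ]
    linear_combination (r ^ 2 * (α * conj α + β * conj β)) * hw
  refine ⟨?_, ?_, ?_⟩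
  · rw [spinT, spinT, spinE, smul_vec, smul_vec, vec_sub, hd, hα', hβ', hα, hβ]
    generalize α * conj α + β * conj β = d at hne
    push_cast
    congr 1
    · field_simp
      linear_combination (-r ^ 2 * conj α * conj β) * hw
    · field_simp
      linear_combination (r ^ 2 * (α * conj α - β * conj β)) * hw
  · rw [spinE, spinT, spinE, smul_vec, smul_vec, vec_add, hd, hα', hβ', hα, hβ]
    generalize α * conj α + β * conj β = d at hne
    push_cast
    congr 1
    · field_simp
      linear_combination (4 * r * conj α * conj β +
        r ^ 2 * (w * conj β ^ 2 - conj w * conj α ^ 2)) * hw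
    · field_simp
      linear_combination (2 * r * (β * conj β - α * conj α) -
        r ^ 2 * (w * α * conj β + conj w * conj α * β)) * hw
  · rw [spinE, spinE, hd, hα', hβ', hα, hβ]
    generalize α * conj α + β * conj β = d at hne
    simp only [map_mul, Complex.conj_I]
    congr 1
    · field_simp
      linear_combination (-r ^ 2 * (conj w * conj α ^ 2 + w * conj β ^ 2)) * hw
    · field_simp
      linear_combination (r ^ 2 * (w * α * conj β - conj w * conj α * β)) * hw

end Spinor

/-- Every function on `ℤ` is a difference. -/
lemma exists_antidifference (d : ℤ → ℝ) (x : ℝ) : ∃ k : ℤ → ℝ, k 0 = x ∧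
    ∀ n, k n - k (n - 1) = d n := by
  refine ⟨fun n => x + ∑ i ∈ Finset.Ioc 0 n, d i - ∑ i ∈ Finset.Ioc n 0, d i, by simp, fun n => ?_⟩
  rcases lt_or_ge 0 n with h | h
  · have h1 : Finset.Ioc 0 n = insert n (Finset.Ioc 0 (n - 1)) := by ext i; simp; omega
    have h2 : Finset.Ioc n 0 = ∅ := by ext i; simp; omega
    have h3 : Finset.Ioc (n - 1) 0 = ∅ := by ext i; simp; omega
    simp only [h1, h2, h3, Finset.sum_empty]
    rw [Finset.sum_insert (by simp)]
    ring
  · have h1 : Finset.Ioc (n - 1) 0 = insert n (Finset.Ioc n 0) := by ext i; simp; omega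
    have h2 : Finset.Ioc 0 n = ∅ := by ext i; simp; omega
    have h3 : Finset.Ioc 0 (n - 1) = ∅ := by ext i; simp; omega
    simp only [h1, h2, h3, Finset.sum_empty]
    rw [Finset.sum_insert (by simp)]
    ring

/-- A choice of the arguments of the `U n` whose successive differences lie in `(-π, π]`. -/
lemma exists_phases (U : ℤ → ℂ) : ∃ Λ ν : ℤ → ℝ,
    (∀ n, U n = ‖U n‖ * Complex.exp (Complex.I * Λ n)) ∧
    (∀ n, -Real.pi ≤ ν n ∧ ν n < Real.pi) ∧ ∀ n, Λ n - Λ (n - 1) = -ν n := by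
  have hexp : ∀ x : ℝ, ∀ j : ℤ, Complex.exp (Complex.I * ((x + j * (2 * Real.pi) : ℝ) : ℂ)) =
      Complex.exp (Complex.I * x) := by
    intro x j
    have : Complex.I * ((x + j * (2 * Real.pi) : ℝ) : ℂ) =
        Complex.I * x + j * (2 * Real.pi * Complex.I) := by push_cast; ring
    rw [this, Complex.exp_add, Complex.exp_int_mul_two_pi_mul_I, mul_one]
  set ν : ℤ → ℝ := fun n => toIcoMod Real.two_pi_pos (-Real.pi) ((U (n - 1)).arg - (U n).arg)
  obtain ⟨Λ, h0, hΛ⟩ := exists_antidifference (fun n => -ν n) (U 0).arg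
  refine ⟨Λ, ν, ?_, ?_, hΛ⟩
  · have hj : ∀ n, ∃ j : ℤ, Λ n - Λ (n - 1) = (U n).arg - (U (n - 1)).arg + j * (2 * Real.pi) := by
      intro n
      refine ⟨toIcoDiv Real.two_pi_pos (-Real.pi) ((U (n - 1)).arg - (U n).arg), ?_⟩
      rw [hΛ]
      have := toIcoMod_add_toIcoDiv_zsmul Real.two_pi_pos (-Real.pi) ((U (n - 1)).arg - (U n).arg)
      simp only [zsmul_eq_mul] at this
      simp only [ν]
      linear_combination -this
    have key : ∀ n, ∃ j : ℤ, Λ n = (U n).arg + j * (2 * Real.pi) := by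
      intro n
      induction n using Int.induction_on with
      | zero => exact ⟨0, by simp [h0]⟩
      | succ i ih =>
        obtain ⟨j, hj1⟩ := ih
        obtain ⟨k, hk⟩ := hj (i + 1)
        rw [add_sub_cancel_right] at hk
        exact ⟨j + k, by push_cast; linear_combination hk + hj1⟩
      | pred i ih =>
        obtain ⟨j, hj1⟩ := ih
        obtain ⟨k, hk⟩ := hj (-i)
        exact ⟨j - k, by push_cast; linear_combination hj1 - hk⟩
    intro n
    obtain ⟨j, hj⟩ := key n
    rw [hj, hexp, mul_comm Complex.I, Complex.norm_mul_exp_arg_mul_I]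
  · intro n
    have := toIcoMod_mem_Ico Real.two_pi_pos (-Real.pi) ((U (n - 1)).arg - (U n).arg)
    exact ⟨this.1, by linarith [this.2]⟩

/-! ### The Frenet frame of a curve given by spinors -/

/-- A discrete curve whose tangent vectors come from spinors `(α n, β n)` which satisfy
`α (n - 1) = α n + U n ^* β n`, `β (n - 1) = β n - U n α n`, together with a choice of phases of
the `U n`. Where `U n` is zero the phase `Λ n` is arbitrary, apart from `nu_eq`. -/
structure SpinCurve (ε : ℝ) (γ : ℤ → E3) (α β U : ℤ → ℂ) (κ ν Λ : ℤ → ℝ) : Prop where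
  eps_pos : 0 < ε
  ne : ∀ n, α n * conj (α n) + β n * conj (β n) ≠ 0
  diff : ∀ n, γ (n + 1) - γ n = ε • spinT (α n) (β n)
  stepF : ∀ n, α (n - 1) = α n + conj (U n) * β n
  stepH : ∀ n, β (n - 1) = β n - U n * α n
  kappa : ∀ n, κ n = 2 * Real.arctan ‖U n‖
  phase : ∀ n, U n = ‖U n‖ * Complex.exp (Complex.I * Λ n)
  nu_mem : ∀ n, -Real.pi ≤ ν n ∧ ν n < Real.pi
  nu_eq : ∀ n, Λ n - Λ (n - 1) = -ν n

lemma exp_mul_conj (x : ℝ) :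
    Complex.exp (Complex.I * x) * conj (Complex.exp (Complex.I * x)) = 1 := by
  rw [Complex.mul_conj', mul_comm, Complex.norm_exp_ofReal_mul_I]
  norm_num

namespace SpinCurve

variable {ε : ℝ} {γ : ℤ → E3} {α β U : ℤ → ℂ} {κ ν Λ : ℤ → ℝ}
  (h : SpinCurve ε γ α β U κ ν Λ)

include h

lemma tan_half (n : ℤ) : Real.tan (κ n / 2) = ‖U n‖ := by
  rw [h.kappa, mul_div_cancel_left₀ _ two_ne_zero, Real.tan_arctan]

lemma cos_half_sq (n : ℤ) : Real.cos (κ n / 2) ^ 2 = 1 / (1 + ‖U n‖ ^ 2) := by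
  rw [h.kappa, mul_div_cancel_left₀ _ two_ne_zero, Real.cos_sq_arctan]

lemma cos_kappa (n : ℤ) : Real.cos (κ n) = (1 - ‖U n‖ ^ 2) / (1 + ‖U n‖ ^ 2) := by
  have h1 : κ n = 2 * (κ n / 2) := by ring
  have h2 : 0 < 1 + ‖U n‖ ^ 2 := by positivity
  rw [h1, Real.cos_two_mul, h.cos_half_sq]
  field_simp
  ring

lemma sin_kappa (n : ℤ) : Real.sin (κ n) = 2 * ‖U n‖ / (1 + ‖U n‖ ^ 2) := by
  have h1 : κ n = 2 * (κ n / 2) := by ring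
  have hc : Real.cos (κ n / 2) ≠ 0 := by
    rw [h.kappa, mul_div_cancel_left₀ _ two_ne_zero]
    exact (Real.cos_arctan_pos _).ne'
  have h3 : Real.sin (κ n / 2) = ‖U n‖ * Real.cos (κ n / 2) := by
    rw [← h.tan_half, Real.tan_mul_cos hc]
  rw [h1, Real.sin_two_mul, h3]
  have h4 := h.cos_half_sq n
  linear_combination 2 * ‖U n‖ * h4

lemma kappa_mem (n : ℤ) : 0 ≤ κ n ∧ κ n < Real.pi := by
  rw [h.kappa]
  have h1 := Real.arctan_lt_pi_div_two ‖U n‖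
  have h2 := Real.arctan_nonneg.2 (norm_nonneg (U n))
  exact ⟨by linarith, by linarith⟩

lemma kappa_pos {n : ℤ} (hU : U n ≠ 0) : 0 < κ n := by
  rw [h.kappa]
  have := Real.arctan_pos.2 (norm_pos_iff.2 hU)
  linarith

lemma sin_kappa_pos {n : ℤ} (hU : U n ≠ 0) : 0 < Real.sin (κ n) :=
  Real.sin_pos_of_pos_of_lt_pi (h.kappa_pos hU) (h.kappa_mem n).2

lemma tangent_eq (n : ℤ) : tangent ε γ n = spinT (α n) (β n) := by
  rw [tangent, h.diff, smul_smul, one_div_mul_cancel h.eps_pos.ne', one_smul]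

/-- The rotation between adjacent edges. -/
lemma transition (n : ℤ) :
    spinT (α (n - 1)) (β (n - 1)) = Real.cos (κ n) • spinT (α n) (β n) -
      Real.sin (κ n) • spinE (α n) (β n) (Complex.exp (Complex.I * Λ n)) ∧
    spinE (α (n - 1)) (β (n - 1)) (Complex.exp (Complex.I * Λ n)) =
      Real.cos (κ n) • spinE (α n) (β n) (Complex.exp (Complex.I * Λ n)) +
      Real.sin (κ n) • spinT (α n) (β n) ∧
    spinE (α (n - 1)) (β (n - 1)) (Complex.I * Complex.exp (Complex.I * Λ n)) =
      spinE (α n) (β n) (Complex.I * Complex.exp (Complex.I * Λ n)) := by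
  have h1 := h.stepF n
  have h2 := h.stepH n
  have h3 := h.phase n
  rw [h.cos_kappa, h.sin_kappa]
  exact spin_transition (h.ne n) (exp_mul_conj (Λ n)) (by rw [h1]; nth_rw 1 [h3])
    (by rw [h2]; nth_rw 1 [h3])

lemma cross_tangent (n : ℤ) : cross (tangent ε γ (n - 1)) (tangent ε γ n) =
    Real.sin (κ n) • spinE (α n) (β n) (Complex.I * Complex.exp (Complex.I * Λ n)) := by
  rw [h.tangent_eq, h.tangent_eq, (h.transition n).1, cross_sub_left, cross_smul_left,
    cross_smul_left, cross_self_E3, cross_spinE_spinT (h.ne n), smul_zero, zero_sub, ← smul_neg]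
  congr 1
  rw [← neg_one_smul ℝ, smul_spinE]
  congr 1
  push_cast
  ring

lemma norm_spinE_I (n : ℤ) :
    ‖spinE (α n) (β n) (Complex.I * Complex.exp (Complex.I * Λ n))‖ = 1 := by
  have h1 := inner_spinE (h.ne n) (Complex.I * Complex.exp (Complex.I * Λ n))
    (Complex.I * Complex.exp (Complex.I * Λ n))
  rw [map_mul, mul_mul_mul_comm, exp_mul_conj, Complex.conj_I, mul_neg, Complex.I_mul_I,
    real_inner_self_eq_norm_sq, neg_neg, mul_one, Complex.one_re] at h1
  exact (pow_eq_one_iff_of_nonneg (norm_nonneg _) two_ne_zero).1 h1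

lemma binormal_eq {n : ℤ} (hU : U n ≠ 0) : binormal ε γ n =
    spinE (α n) (β n) (Complex.I * Complex.exp (Complex.I * Λ n)) := by
  have h1 := h.sin_kappa_pos hU
  rw [binormal, h.cross_tangent, norm_smul, h.norm_spinE_I, mul_one, smul_smul,
    Real.norm_of_nonneg h1.le, one_div_mul_cancel h1.ne', one_smul]

lemma normal_eq {n : ℤ} (hU : U n ≠ 0) : normal ε γ n =
    spinE (α n) (β n) (Complex.exp (Complex.I * Λ n)) := by
  rw [normal, h.binormal_eq hU, h.tangent_eq, cross_spinE_spinT (h.ne n)]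
  congr 1
  linear_combination (-Complex.exp (Complex.I * Λ n)) * Complex.I_sq

lemma frame_mem {n : ℤ} (hU : U n ≠ 0) :
    frame ε γ n ∈ Matrix.specialOrthogonalGroup (Fin 3) ℝ := by
  have hT := h.tangent_eq n
  have hN := h.normal_eq hU
  have hB := h.binormal_eq hU
  set w := Complex.exp (Complex.I * Λ n) with hw
  have hww : w * conj w = 1 := exp_mul_conj _
  have e1 : inner ℝ (tangent ε γ n) (tangent ε γ n) = 1 := by
    rw [hT, inner_spinT_self (h.ne n)]
  have e2 : inner ℝ (tangent ε γ n) (normal ε γ n) = 0 := by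
    rw [hT, hN, inner_spinT_spinE (h.ne n)]
  have e3 : inner ℝ (tangent ε γ n) (binormal ε γ n) = 0 := by
    rw [hT, hB, inner_spinT_spinE (h.ne n)]
  have e4 : inner ℝ (normal ε γ n) (normal ε γ n) = 1 := by
    rw [hN, inner_spinE (h.ne n), hww, Complex.one_re]
  have e5 : inner ℝ (normal ε γ n) (binormal ε γ n) = 0 := by
    rw [hN, hB, inner_spinE (h.ne n), map_mul, Complex.conj_I]
    have : w * (-Complex.I * conj w) = -Complex.I := by linear_combination (-Complex.I) * hww
    rw [this]; simp
  have e6 : inner ℝ (binormal ε γ n) (binormal ε γ n) = 1 := by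
    rw [hB, real_inner_self_eq_norm_sq, h.norm_spinE_I]; norm_num
  have e7 : cross (normal ε γ n) (binormal ε γ n) = tangent ε γ n := by
    rw [hN, hB, hT, cross_spinE (h.ne n)]
    have : conj w * (Complex.I * w) = Complex.I := by linear_combination Complex.I * hww
    rw [this, Complex.I_im, one_smul]
  have c0 := congrFun (congrArg WithLp.ofLp e7) 0
  have c1 := congrFun (congrArg WithLp.ofLp e7) 1
  have c2 := congrFun (congrArg WithLp.ofLp e7) 2
  simp only [cross, cross_apply, Matrix.cons_val_zero, Matrix.cons_val_one, Matrix.cons_val]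
    at c0 c1 c2
  rw [inner_E3] at e1 e2 e3 e4 e5 e6
  rw [Matrix.mem_specialOrthogonalGroup_iff]
  constructor
  · rw [Matrix.mem_orthogonalGroup_iff']
    ext i j
    fin_cases i <;> fin_cases j <;>
      simp [frame, Matrix.mul_apply, Fin.sum_univ_three] <;> linarith
  · rw [Matrix.det_fin_three]
    simp [frame]
    linear_combination e1 + (tangent ε γ n).ofLp 0 * c0 + (tangent ε γ n).ofLp 1 * c1 +
      (tangent ε γ n).ofLp 2 * c2

/-- The axes of adjacent rotations differ by the angle `ν n`. -/
lemma exp_phase (n : ℤ) : Complex.exp (Complex.I * Λ n) =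
    Complex.exp (Complex.I * Λ (n - 1)) * (Real.cos (ν n) - Complex.I * Real.sin (ν n)) := by
  have h1 : Complex.I * (Λ n : ℂ) = Complex.I * Λ (n - 1) + ((-ν n : ℝ) : ℂ) * Complex.I := by
    rw [← h.nu_eq]; push_cast; ring
  rw [h1, Complex.exp_add, Complex.exp_mul_I, ← Complex.ofReal_cos, ← Complex.ofReal_sin,
    Real.cos_neg, Real.sin_neg]
  push_cast
  ring

/-- The angle between adjacent edges, and the angle between adjacent osculating planes, are read off
from `transition`: the binormal does not change under the rotation at its vertex. -/
lemma hasComplexCurvature {u : ℤ → ℂ} (hu : ∀ n, U n = ε * u n) :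
    HasComplexCurvature ε γ u κ ν Λ := by
  have hε : (ε : ℂ) ≠ 0 := by exact_mod_cast h.eps_pos.ne'
  have hne : ∀ {n}, u n ≠ 0 → U n ≠ 0 := fun {n} hn => by
    rw [hu]; exact mul_ne_zero hε hn
  refine ⟨fun n => ?_, h.kappa_mem, fun n => ?_, fun n hn => h.kappa_pos (hne hn),
    fun n hn => ⟨?_, h.frame_mem (hne hn)⟩, fun n _ _ => h.nu_mem n, fun n h1 h2 => ?_,
    fun n h1 h2 => ?_, fun n => ?_, fun n _ _ => h.nu_eq n⟩
  · have h1 := inner_spinT_self (h.ne n)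
    rw [real_inner_self_eq_norm_sq] at h1
    have h2 : ‖spinT (α n) (β n)‖ = 1 :=
      (pow_eq_one_iff_of_nonneg (norm_nonneg _) two_ne_zero).1 h1
    rw [h.diff, norm_smul, h2, mul_one, Real.norm_of_nonneg h.eps_pos.le]
  · rw [h.tangent_eq, h.tangent_eq, (h.transition n).1, inner_sub_left, real_inner_smul_left,
      real_inner_smul_left, inner_spinT_self (h.ne n), real_inner_comm,
      inner_spinT_spinE (h.ne n)]
    ring
  · rw [h.cross_tangent]
    refine smul_ne_zero (h.sin_kappa_pos (hne hn)).ne' (norm_ne_zero_iff.1 ?_)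
    rw [h.norm_spinE_I]
    exact one_ne_zero
  · have hw := exp_mul_conj (Λ (n - 1))
    rw [h.binormal_eq (hne h2), h.binormal_eq (hne h1), ← (h.transition n).2.2,
      inner_spinE (h.ne _), h.exp_phase]
    set w := Complex.exp (Complex.I * Λ (n - 1))
    have : Complex.I * (w * (Real.cos (ν n) - Complex.I * Real.sin (ν n))) * conj (Complex.I * w) =
        Real.cos (ν n) - Complex.I * Real.sin (ν n) := by
      rw [map_mul, Complex.conj_I]
      linear_combination (Real.cos (ν n) - Complex.I * Real.sin (ν n)) * hw -
        (Real.cos (ν n) - Complex.I * Real.sin (ν n)) * w * conj w * Complex.I_sq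
    rw [this]
    simp [-Complex.ofReal_cos, -Complex.ofReal_sin]
  · have hw := exp_mul_conj (Λ (n - 1))
    rw [h.binormal_eq (hne h2), h.normal_eq (hne h1), ← (h.transition n).2.2,
      inner_spinE (h.ne _), h.exp_phase]
    set w := Complex.exp (Complex.I * Λ (n - 1))
    have : Complex.I * (w * (Real.cos (ν n) - Complex.I * Real.sin (ν n))) * conj w =
        Real.sin (ν n) + Complex.I * Real.cos (ν n) := by
      linear_combination (Real.sin (ν n) + Complex.I * Real.cos (ν n)) * hw -
        Real.sin (ν n) * w * conj w * Complex.I_sq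
    rw [this]
    simp [-Complex.ofReal_cos, -Complex.ofReal_sin]
  · rw [h.tan_half, mul_assoc, ← h.phase, hu]
    field_simp

lemma frenetSerret {u : ℤ → ℂ} (hu : ∀ n, U n = ε * u n) : FrenetSerret ε γ u κ ν := by
  intro n h1 h2
  have hε : (ε : ℂ) ≠ 0 := by exact_mod_cast h.eps_pos.ne'
  have hU1 : U n ≠ 0 := by rw [hu]; exact mul_ne_zero hε h1
  have hU2 : U (n + 1) ≠ 0 := by rw [hu]; exact mul_ne_zero hε h2
  obtain ⟨t1, t2, t3⟩ := h.transition (n + 1)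
  have hexp := h.exp_phase (n + 1)
  rw [add_sub_cancel_right] at t1 t2 t3 hexp
  rw [← h.tangent_eq, ← h.tangent_eq, ← h.normal_eq hU2] at t1
  rw [← h.tangent_eq, ← h.normal_eq hU2] at t2
  rw [← h.binormal_eq hU2] at t3
  have w1 : spinE (α n) (β n) (Complex.exp (Complex.I * Λ (n + 1))) =
      Real.cos (ν (n + 1)) • normal ε γ n - Real.sin (ν (n + 1)) • binormal ε γ n := by
    rw [h.normal_eq hU1, h.binormal_eq hU1, sub_eq_add_neg, ← neg_smul, smul_spinE, smul_spinE,
      spinE_add, hexp]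
    congr 1
    push_cast
    ring
  have w2 : spinE (α n) (β n) (Complex.I * Complex.exp (Complex.I * Λ (n + 1))) =
      Real.sin (ν (n + 1)) • normal ε γ n + Real.cos (ν (n + 1)) • binormal ε γ n := by
    rw [h.normal_eq hU1, h.binormal_eq hU1, smul_spinE, smul_spinE, spinE_add, hexp]
    congr 1
    linear_combination (-Complex.exp (Complex.I * Λ n) * Real.sin (ν (n + 1))) * Complex.I_sq
  -- the transition expresses the frame at `n` in that at `n + 1`; it is inverted by `hsc`
  rw [w1] at t2
  rw [w2] at t3
  have hsc := Real.sin_sq_add_cos_sq (κ (n + 1))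
  have eT : ∀ i, tangent ε γ (n + 1) i = Real.cos (κ (n + 1)) * tangent ε γ n i +
      Real.sin (κ (n + 1)) * (Real.cos (ν (n + 1)) * normal ε γ n i -
        Real.sin (ν (n + 1)) * binormal ε γ n i) := by
    intro i
    have a1 := congrFun (congrArg WithLp.ofLp t1) i
    have a2 := congrFun (congrArg WithLp.ofLp t2) i
    simp only [PiLp.sub_apply, PiLp.add_apply, PiLp.smul_apply, smul_eq_mul] at a1 a2
    linear_combination (-tangent ε γ (n + 1) i) * hsc - Real.cos (κ (n + 1)) * a1 -
      Real.sin (κ (n + 1)) * a2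
  have eN : ∀ i, normal ε γ (n + 1) i = -Real.sin (κ (n + 1)) * tangent ε γ n i +
      Real.cos (κ (n + 1)) * (Real.cos (ν (n + 1)) * normal ε γ n i -
        Real.sin (ν (n + 1)) * binormal ε γ n i) := by
    intro i
    have a1 := congrFun (congrArg WithLp.ofLp t1) i
    have a2 := congrFun (congrArg WithLp.ofLp t2) i
    simp only [PiLp.sub_apply, PiLp.add_apply, PiLp.smul_apply, smul_eq_mul] at a1 a2
    linear_combination (-normal ε γ (n + 1) i) * hsc + Real.sin (κ (n + 1)) * a1 -
      Real.cos (κ (n + 1)) * a2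
  have eB : ∀ i, binormal ε γ (n + 1) i = Real.sin (ν (n + 1)) * normal ε γ n i +
        Real.cos (ν (n + 1)) * binormal ε γ n i := by
    intro i
    have a3 := congrFun (congrArg WithLp.ofLp t3) i
    simp only [PiLp.add_apply, PiLp.smul_apply, smul_eq_mul] at a3
    exact a3.symm
  ext i j
  fin_cases j <;>
    simp [frame, R1, R3, Matrix.mul_apply, Fin.sum_univ_three, eT, eN, eB] <;> ring

end SpinCurve

/-! ### The soliton curve and its deformation -/

namespace Params

variable {N : ℕ} {P : Params N} {ε δ : ℝ} {c : ℂ}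

/-- The curve `γ_n^m` as a vector. -/
def spaceCurve (P : Params N) (ε z : ℝ) (n m : ℤ) : E3 := ε • vec (P.curveXY z n m) (P.curveZ z n m)

lemma pot_eq_u (hP : P.Good) (hL : Lattice ε δ P.a c) (z : ℝ) (n m : ℤ) :
    P.pot c z n m = ε * P.u ε c z n m := by
  have : (ε : ℂ) ≠ 0 := by exact_mod_cast hL.eps_pos.ne'
  rw [hP.u_eq_amp, pot]
  field_simp

lemma ofReal_spaceCurve (hP : P.Good) (ε z : ℝ) (n m : ℤ) (i : Fin 3) :
    ((P.spaceCurve ε z n m i : ℝ) : ℂ) = P.curve ε z n m i := by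
  have h1 : conj (P.curveXY z n m) = 2 * ((-1) ^ m * (conj (P.h n m z) / P.F n m z)) := by
    rw [curveXY, map_mul, map_mul, conj_neg_one_zpow, map_div₀, hP.conj_F, map_ofNat]
  fin_cases i
  · simp only [spaceCurve, vec, curve]
    simp only [Fin.zero_eta, PiLp.smul_apply, Matrix.cons_val_zero, smul_eq_mul,
      Complex.ofReal_mul, Complex.re_eq_add_conj, h1]
    rw [curveXY]
    ring
  · simp only [spaceCurve, vec, curve]
    simp [Complex.im_eq_sub_conj, h1]
    rw [curveXY]
    field_simp
    linear_combination (ε * (P.h n m z - conj (P.h n m z)) / P.F n m z) * Complex.I_sq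
  · have h2 : ((P.curveZ z n m).re : ℂ) = P.curveZ z n m := by
      apply Complex.conj_eq_iff_re.1
      rw [curveZ]
      simp [hP.conj_resZ, Complex.conj_ofNat]
    simp only [spaceCurve, vec, curve, hP.deriv_log_F]
    simp [h2]
    rw [curveZ]
    simp

/-- The soliton curve is a discrete space curve with spinors `spinF`, `spinH`. -/
lemma spinCurve (hP : P.Good) (hL : Lattice ε δ P.a c) (hb : P.b = c⁻¹) (z : ℝ) (m : ℤ)
    {ν Λ : ℤ → ℝ}
    (hΛ : ∀ n, P.pot c z n m = ‖P.pot c z n m‖ * Complex.exp (Complex.I * Λ n))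
    (hν : ∀ n, -Real.pi ≤ ν n ∧ ν n < Real.pi) (hΛν : ∀ n, Λ n - Λ (n - 1) = -ν n) :
    SpinCurve ε (fun n => P.spaceCurve ε z n m) (fun n => P.spinF c z n m)
      (fun n => P.spinH c z n m) (fun n => P.pot c z n m)
      (fun n => 2 * Real.arctan ‖P.pot c z n m‖) ν Λ where
  eps_pos := hL.eps_pos
  ne n := by rw [hP.spin_norm hL]; exact hP.spinNorm_ne_zero z n m
  diff n := by
    rw [spaceCurve, spaceCurve, ← smul_sub, vec_sub, hP.curveXY_succ_sub hL hb,
      hP.curveZ_succ_sub hL, spinT, hP.spin_norm hL, mul_assoc]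
  stepF n := hP.spinF_sub_one hL z n m
  stepH n := hP.spinH_sub_one hL hb z n m
  kappa _ := rfl
  phase := hΛ
  nu_mem := hν
  nu_eq := hΛν

/-- The deformation in terms of the spinors. The number `k` is `Γ / cos² (κ / 2)`. -/
lemma spaceCurve_deform (hP : P.Good) (hL : Lattice ε δ P.a c) (hb : P.b = c⁻¹) (z : ℝ)
    (n m : ℤ) {W : ℂ} {k : ℝ} (hk : P.a * P.speed z n m = k)
    (hW : W = (1 + Complex.I * (ε ^ 2 / δ)) * P.pot c z n m - k * P.pot c z (n - 1) (m + 1)) :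
    (1 / δ) • (P.spaceCurve ε z n (m + 1) - P.spaceCurve ε z n m) =
      (2 / ε ^ 3) • ((δ * (k - 1)) • spinT (P.spinF c z n m) (P.spinH c z n m) +
        spinE (P.spinF c z n m) (P.spinH c z n m) (δ * W)) := by
  have hε : (ε : ℂ) ≠ 0 := by exact_mod_cast hL.eps_pos.ne'
  have hδ : (δ : ℂ) ≠ 0 := by exact_mod_cast hL.delta_ne
  have hN := hP.spinNorm_ne_zero z n m
  have h1 := hP.curveXY_deform hL hb z n m (hk ▸ hW)
  have h2 := hP.curveZ_deform hL hb z n m (hk ▸ hW)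
  rw [hk] at h1 h2
  rw [spaceCurve, spaceCurve, ← smul_sub, vec_sub, smul_smul, smul_vec, spinT, spinE, smul_vec,
    vec_add, smul_vec, hP.spin_norm hL, map_mul, Complex.conj_ofReal]
  push_cast
  field_simp at h1 h2
  congr 1
  · field_simp
    linear_combination h1
  · field_simp
    linear_combination h2

/-- The coefficients `Q` and `R` are the real and imaginary parts of `δ W e^{-iΛ}` for the `W` of
`spaceCurve_deform`. -/
lemma deformation (hP : P.Good) (hL : Lattice ε δ P.a c) (hb : P.b = c⁻¹) (z : ℝ)
    {ν Λ : ℤ → ℤ → ℝ}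
    (hΛ : ∀ m n, P.pot c z n m = ‖P.pot c z n m‖ * Complex.exp (Complex.I * Λ m n))
    (hν : ∀ m n, -Real.pi ≤ ν m n ∧ ν m n < Real.pi)
    (hΛν : ∀ m n, Λ m n - Λ m (n - 1) = -ν m n) :
    Deformation ε δ (P.spaceCurve ε z) (P.u ε c z) (fun n m => (P.Gam c z n m).re)
      (fun n m => 2 * Real.arctan ‖P.pot c z n m‖) (fun n m => Λ m n) := by
  intro n m hu
  have hε : (ε : ℂ) ≠ 0 := by exact_mod_cast hL.eps_pos.ne'
  have hδ : (δ : ℂ) ≠ 0 := by exact_mod_cast hL.delta_ne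
  have hU : P.pot c z n m ≠ 0 := by
    rw [pot_eq_u hP hL]; exact mul_ne_zero hε hu
  have h := spinCurve hP hL hb z m (hΛ m) (hν m) (hΛν m)
  have h' := spinCurve hP hL hb z (m + 1) (hΛ (m + 1)) (hν (m + 1)) (hΛν (m + 1))
  have ht := h.tan_half n
  have ht' := h'.tan_half (n - 1)
  have hcos := h.cos_half_sq n
  have hT := h.tangent_eq n
  have hN := h.normal_eq (n := n) hU
  have hB := h.binormal_eq (n := n) hU
  -- the factor `Γ / cos² (κ / 2)`
  obtain ⟨k, hkdef⟩ : ∃ k, k = (P.Gam c z n m).re /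
      Real.cos (2 * Real.arctan ‖P.pot c z n m‖ / 2) ^ 2 := ⟨_, rfl⟩
  have hk : P.a * P.speed z n m = k := by
    rw [hkdef, hcos, div_div_eq_mul_div, div_one, pot_eq_u hP hL, norm_mul, Complex.norm_real,
      Real.norm_of_nonneg hL.eps_pos.le, ← hP.one_add_u_mul_Gam hL]
    have hG := hP.ofReal_Gam_re hL z n m
    push_cast
    linear_combination (-(1 + (ε : ℂ) ^ 2 * ‖P.u ε c z n m‖ ^ 2)) * hG
  rw [spaceCurve_deform hP hL hb z n m hk rfl]
  simp only [coeffP, coeffQ, coeffR]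
  rw [hT, hN, hB, ← hkdef, ht, ht', smul_spinE, smul_spinE, add_assoc, spinE_add]
  congr 3
  · ring
  have hexp : Complex.exp (Complex.I * Λ (m + 1) (n - 1)) = Complex.exp (Complex.I * Λ m n) *
      (Real.cos (Λ (m + 1) (n - 1) - Λ m n) +
        Complex.I * Real.sin (Λ (m + 1) (n - 1) - Λ m n)) := by
    have h1 : Complex.I * (Λ (m + 1) (n - 1) : ℂ) = Complex.I * Λ m n +
        ((Λ (m + 1) (n - 1) - Λ m n : ℝ) : ℂ) * Complex.I := by
      push_cast; ring
    rw [h1, Complex.exp_add, Complex.exp_mul_I, ← Complex.ofReal_cos, ← Complex.ofReal_sin]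
    ring
  have e1 := hΛ m n
  have e2 := hΛ (m + 1) (n - 1)
  rw [hexp] at e2
  generalize ‖P.pot c z n m‖ = r at e1 ⊢
  generalize ‖P.pot c z (n - 1) (m + 1)‖ = r' at e2 ⊢
  rw [e1, e2]
  push_cast
  field_simp
  ring

end Params

end DNLS

end

theorem theorem3 (ε δ : ℝ) (hε : 0 < ε) (hδ : δ ≠ 0) (N : ℕ) (p : Fin N → ℂ)
    (a : ℝ) (ha : a = Real.sqrt (1 + ε ^ 4 / δ ^ 2))
    (c : ℂ) (hc : c = (1 - Complex.I * (ε ^ 2 / δ)) / a)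
    (hp0 : ∀ i, p i ≠ 0)
    (hpa : ∀ i, (a : ℂ) * p i ≠ 1 ∧ p i ≠ (a : ℂ))
    (hpp : ∀ i j, p i * (starRingEnd ℂ) (p j) ≠ 1)
    (z : ℝ) :
    (∀ b : ℂ, ‖b‖ = 1 →
      (∀ (n m : ℤ) (w : ℝ), ((DNLS.Params.mk a b p).F n m w).im = 0 ∧
        0 < ((DNLS.Params.mk a b p).F n m w).re) ∧
      ∃ Γ : ℤ → ℤ → ℝ, (∀ n m, (Γ n m : ℂ) = (DNLS.Params.mk a b p).Gam c z n m) ∧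
        DNLS.IsSolution ε δ ((DNLS.Params.mk a b p).u ε c z) Γ) ∧
    (∃ (γ : ℤ → ℤ → DNLS.E3) (Γ κ ν Λ : ℤ → ℤ → ℝ),
        (∀ n m i, ((γ n m i : ℝ) : ℂ) = (DNLS.Params.mk a c⁻¹ p).curve ε z n m i) ∧
        (∀ n m, (Γ n m : ℂ) = (DNLS.Params.mk a c⁻¹ p).Gam c z n m) ∧
        (∀ m, DNLS.HasComplexCurvature ε (fun n => γ n m)
          (fun n => (DNLS.Params.mk a c⁻¹ p).u ε c z n m)
          (fun n => κ n m) (fun n => ν n m) (fun n => Λ n m)) ∧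
        (∀ m, DNLS.FrenetSerret ε (fun n => γ n m)
          (fun n => (DNLS.Params.mk a c⁻¹ p).u ε c z n m)
          (fun n => κ n m) (fun n => ν n m)) ∧
        DNLS.Deformation ε δ γ ((DNLS.Params.mk a c⁻¹ p).u ε c z) Γ κ Λ) := by
  have hL : DNLS.Lattice ε δ a c := DNLS.lattice_of_eq hε hδ ha hc
  have good : ∀ b : ℂ, ‖b‖ = 1 → (DNLS.Params.mk a b p).Good := fun b hb =>
    { p_ne_zero := hp0
      one_sub_ne := fun i => sub_ne_zero.2 (hpa i).1.symm
      sub_ne := fun i => sub_ne_zero.2 fun h =>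
        (hpa i).2 ((eq_div_iff (hp0 i)).1 h ▸ (one_mul _).symm)
      mul_conj_ne := hpp
      norm_b := hb }
  refine ⟨fun b hb => ⟨fun n m w => ⟨(good b hb).F_im n m w, (good b hb).F_pos n m w⟩,
    fun n m => (DNLS.Params.Gam (.mk a b p) c z n m).re,
    fun n m => (good b hb).ofReal_Gam_re hL z n m, (good b hb).isSolution hL z⟩, ?_⟩
  have hP := good c⁻¹ (by rw [norm_inv, hL.norm_c, inv_one])
  generalize hPdef : DNLS.Params.mk a c⁻¹ p = P at hP ⊢
  have hb : P.b = c⁻¹ := by rw [← hPdef]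
  replace hL : DNLS.Lattice ε δ P.a c := by rw [← hPdef]; exact hL
  choose Λ ν hΛ hν hΛν using fun m => DNLS.exists_phases fun n => P.pot c z n m
  have hcurve := fun m => P.spinCurve hP hL hb z m (hΛ m) (hν m) (hΛν m)
  exact ⟨P.spaceCurve ε z, fun n m => (P.Gam c z n m).re,
    fun n m => 2 * Real.arctan ‖P.pot c z n m‖, fun n m => ν m n, fun n m => Λ m n,
    P.ofReal_spaceCurve hP ε z, hP.ofReal_Gam_re hL z,
    fun m => (hcurve m).hasComplexCurvature fun n => P.pot_eq_u hP hL z n m,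
    fun m => (hcurve m).frenetSerret fun n => P.pot_eq_u hP hL z n m,
    P.deformation hP hL hb z hΛ hν hΛν⟩
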